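/- Let $k$ be an algebraically closed field of characteristic $p>0$, let $K_0=\operatorname{Frac}(W(k))$ be the fraction field of the ring of Witt vectors of $k$, fix an algebraic closure of $K_0$, and put $K_n=K_0(\zeta_{p^n})$, where $\zeta_{p^n}$ is a primitive $p^n$-th root of unity. Every finite extension $F$ of $K_0$ carries its discrete valuation $v_F$, normalized so that a uniformizer has valuation $1$; write $v_n=v_{K_n}$ and $e_F=v_F(p)$. For a finite Galois extension $M/F$ of finite extensions of $K_0$ with group $G$, and a uniformizer $\pi_M$ of $M$, let $G_i=\{g\in G: v_M(g\pi_M-\pi_M)\ge i+1\}$ for real $i\ge 0$, let $\phi_{M/F}(u)=\int_0^u \frac{dx}{[G_0:G_x]}$ for $u\ge 0$, let $\psi_{M/F}$ be the inverse of $\phi_{M/F}$ on $[0,\infty)$, and let $G^i=G_{\psi_{M/F}(i)}$. The conductor of $M/F$ is $h_{M/F}=\sup\{i\in[0,\infty): G^i\ne\{\mathrm{id}\}\}$ (with $h_{M/F}=0$ if $M=F$). For $F$ a finite extension of $K_1$, an element $a=1+t\in F^\times$ is called $p$-primitive for $F$ if either $p\nmid v_F(a)$, or $0<v_F(t)<\frac{p}{p-1}e_F$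 and $p\nmid v_F(t)$. Let $\ell\ge 1$ and $c\ge 1$ be integers, and let $a=1+t\in K_\ell$ be $p$-primitive for $K_\ell$ with $v_\ell(a)\ge 0$. Put $K=K_{\max(\ell,c)}(\sqrt[p^c]{a})$, for any choice of the $p^c$-th root. Then $K$ is Galois over $K_\ell$. Let $L$ be the Galois closure of $K$ over $K_0$. Then: (i) $h_{K/K_\ell}=(c(p-1)+1)\,p^{\ell-1}-v_\ell(t)$; (ii) $h_{L/K_0}=\max\left(\ell-1,\; c+\ell-1-\dfrac{v_\ell(t)-1}{p^{\ell-1}(p-1)}\right)$. -/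

import Mathlib

noncomputable section

namespace RamificationConductor

section General

/- Here `A` is the valuation ring of a complete discrete valuation field and `L` is a finite
extension of that field.  The valuation ring of `L` is the integral closure of `A` in `L`. -/
variable (A : Type*) [CommRing A] (L : Type*) [Field L] [Algebra A L]

/-- `ϖ` is a uniformizer of `L`, i.e. an irreducible element of the valuation ring of `L`. -/
def IsUniformizer (ϖ : L) : Prop :=
  ∃ x : integralClosure A L, Irreducible x ∧ (x : L) = ϖ

/-- `x = u ϖ ^ n` for a uniformizer `ϖ` of `L` and a unit `u` of the valuation ring of `L`. -/
def HasOrd (x : L) (n : ℤ) : Prop :=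
  ∃ ϖ : L, IsUniformizer A L ϖ ∧ ∃ u : (integralClosure A L)ˣ,
    x = ((u : integralClosure A L) : L) * ϖ ^ n

open Classical in
/-- The valuation `v_L` of `L`, normalized so that uniformizers have valuation `1`;
the value at `0` is `⊤`. -/
def ord (x : L) : WithTop ℤ :=
  if h : ∃ n : ℤ, HasOrd A L x n then ((h.choose : ℤ) : WithTop ℤ) else ⊤

/-- `a = 1 + t` is `p`-primitive for `L` if either `p ∤ v_L(a)`, or
`0 < v_L(t) < (p / (p - 1)) e_L` and `p ∤ v_L(t)`, where `e_L = v_L(p)`. -/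
def IsPPrimitive (p : ℕ) (a : L) : Prop :=
  (∃ m : ℤ, ord A L a = m ∧ ¬ (p : ℤ) ∣ m) ∨
    ∃ n e : ℤ, ord A L (a - 1) = n ∧ ord A L (p : L) = e ∧
      0 < n ∧ (n : ℝ) < (p : ℝ) / ((p : ℝ) - 1) * (e : ℝ) ∧ ¬ (p : ℤ) ∣ n

variable (K : Type*) [Field K] [Algebra K L]

/-- The lower numbering ramification group `G_i`, `i ≥ 0` real, of a Galois extension `L / K`:
`g ∈ G_i` iff `v_L(g π - π) ≥ i + 1` for a uniformizer `π` of `L`. -/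
def lowerGroup (i : ℝ) : Set (L ≃ₐ[K] L) :=
  {g | ∀ π : L, IsUniformizer A L π →
    ((i + 1 : ℝ) : WithTop ℝ) ≤ (ord A L (g π - π)).map (fun n : ℤ => (n : ℝ))}

/-- The Herbrand function `φ_{L/K}(u) = ∫_0^u dt / [G_0 : G_t]`. -/
def herbrandPhi (u : ℝ) : ℝ :=
  ∫ t in (0 : ℝ)..u, ((lowerGroup A L K t).ncard : ℝ) / ((lowerGroup A L K 0).ncard : ℝ)

/-- `ψ_{L/K} : [0, ∞) → [0, ∞)`, the inverse of `φ_{L/K}`. -/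
def herbrandPsi (v : ℝ) : ℝ :=
  Function.invFunOn (herbrandPhi A L K) (Set.Ici 0) v

/-- The upper numbering ramification group `G^i = G_{ψ_{L/K}(i)}`. -/
def upperGroup (i : ℝ) : Set (L ≃ₐ[K] L) :=
  lowerGroup A L K (herbrandPsi A L K i)

/-- The conductor `h_{L/K} = sup {i ≥ 0 | G^i ≠ {id}}`
(it is `0` for the trivial extension, the supremum being taken in `[0, ∞)`). -/
def ramConductor : ℝ :=
  sSup {i : ℝ | 0 ≤ i ∧ upperGroup A L K i ≠ {1}}

end General

section Cyclotomic

variable (p : ℕ) (K₀ Ω : Type*) [Field K₀] [Field Ω] [Algebra K₀ Ω]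

/-- `K_n = K_0(ζ_{p^n})`, inside the algebraic closure `Ω` of `K_0`. -/
def cyc (n : ℕ) : IntermediateField K₀ Ω :=
  IntermediateField.adjoin K₀ {ζ : Ω | IsPrimitiveRoot ζ (p ^ n)}

/-- If `A` acts compatibly on `K_0` and `Ω`, then its action on an intermediate field is
compatible with the one on `Ω`. -/
instance isScalarTower_top (A : Type*) [CommRing A] [Algebra A K₀] [Algebra A Ω]
    [IsScalarTower A K₀ Ω] (E : IntermediateField K₀ Ω) : IsScalarTower A E Ω :=
  IsScalarTower.of_algebraMap_eq fun _ => rfl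

/-- The field `K_{max(ℓ, c)}(b)`, regarded as an extension of `K_ℓ`. -/
def kummerExt (ℓ c : ℕ) (b : Ω) : IntermediateField (cyc p K₀ Ω ℓ) Ω :=
  IntermediateField.adjoin (cyc p K₀ Ω ℓ) ((cyc p K₀ Ω (max ℓ c) : Set Ω) ∪ {b})

/-- The Galois closure over `K_0` of `K_{max(ℓ, c)}(b)`, inside `Ω`. -/
def kummerClosure (ℓ c : ℕ) (b : Ω) : IntermediateField K₀ Ω :=
  IntermediateField.normalClosure K₀ ((kummerExt p K₀ Ω ℓ c b).restrictScalars K₀) Ω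

end Cyclotomic

end RamificationConductor

end

noncomputable section

namespace RamificationConductor

/-! ### Finite extensions of complete discrete valuation rings -/

section CompleteDVR

open IsLocalRing

/-! All fields are measured by one valuation $w$ with $w(p)=1$. The residue field is algebraically
closed, so every extension is totally ramified, and a uniformizer of $M$ has value
$\varepsilon_M=e/[M:F]$, where $e$ is the value of a uniformizer of $F$. For a Galois extension
$N/F$ with uniformizer $\pi$, put $j(g)=w(g\pi-\pi)$ and $\Phi_H(s)=\sum_{h\in H}\min(j(h),s)$, with
$j(1)=\infty$. Integrating $|G_t|$ gives $\phi(u)=\Phi_G(\varepsilon_N(u+1))/e-1$, so the conductor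
is $\Phi_G(\max j)/e-1$ (`IsTotRam.ramConductor_eq`).

The movement $w(g\varpi-\varpi)$ of a uniformizer of an intermediate field $E$ is the sum of $j$
over the coset $g\,\mathrm{Gal}(N/E)$ (`IsTotRam.map_sub_eq_sum`). Hence, if $E/M$ has degree $d$
and a single nontrivial movement $j_0$, then $\Phi_M=\Phi_E+(d-1)\min(j_0,\Phi_E)$, where $\Phi_M$
stands for $\Phi_{\mathrm{Gal}(N/M)}$; $E/M$ need not be Galois (`IsTotRam.Phi_step`).

Let $a\in M$ be primitive and let $n$ be the order of $a-1$. A $p$-th root $b$ has degree $p$ and is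
again primitive with the same $n$, and a uniformizer of $E=M(b)$ moves by
$J=1/(p-1)-(n-1)\varepsilon_E$. The corresponding number $J'$ for $M$ satisfies $pJ=J'+1$. So in a
tower of $c$ such steps the top layer has the last break, and there
$\Phi_M=\beta:=1/(p-1)-(n-1)\varepsilon_M+c$ (`IsTotRam.kummer_tower`). For $M=K_\ell$ this gives
(i).

The field $K_\ell/K_0$ is a step of degree $p-1$ followed by the same tower for $\zeta_p$, with
$n=1$; its movements are all $1/(p-1)$, and beyond that value it adds $\ell-1/(p-1)$ to $\Phi$. In
(ii) the last break is whichever of $\beta$ and $1/(p-1)$ is larger, hence the maximum.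

The Galois closure $N$ is larger than $E=K_\ell(b)$, but the extra roots of unity need no
computation. Since $b$ has full degree, each $\xi b$ with $\xi^{p^c}=1$ is a conjugate of $b$, so a
normal subgroup fixing $E$ fixes these $\xi$ and is trivial. The maximum of $j$ is therefore
attained outside $\mathrm{Gal}(N/E)$ (`IsRamFun.exists_max_notMem`), where the tower determines it.
-/

theorem Basis.mem_ideal_smul_top_iff {A B ι : Type*} [CommRing A] [AddCommGroup B] [Module A B]
    [Finite ι] (β : Module.Basis ι A B) (I : Ideal A) (x : B) :
    x ∈ (I • ⊤ : Submodule A B) ↔ ∀ i, β.repr x i ∈ I := by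
  have := Fintype.ofFinite ι
  refine ⟨fun hx i => ?_, fun h => ?_⟩
  · refine Submodule.smul_induction_on hx (fun r hr y _ => ?_) fun y z hy hz => ?_
    · simpa using I.mul_mem_right _ hr
    · simpa using I.add_mem hy hz
  · rw [← β.sum_repr x]
    exact Submodule.sum_mem _ fun i _ => Submodule.smul_mem_smul (h i) trivial

/-- Congruence modulo $I^nB$ can be tested on the coordinates in a basis, so limits are taken
coordinatewise. -/
theorem isAdicComplete_of_finite_free {A : Type*} [CommRing A] (I : Ideal A) [IsAdicComplete I A]
    (B : Type*) [AddCommGroup B] [Module A B] [Module.Finite A B] [Module.Free A B] :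
    IsAdicComplete I B := by
  let β := Module.Free.chooseBasis A B
  have key : ∀ (n : ℕ) (x y : B), x ≡ y [SMOD (I ^ n • ⊤ : Submodule A B)] ↔
      ∀ i, β.repr x i ≡ β.repr y i [SMOD (I ^ n • ⊤ : Submodule A A)] := by
    intro n x y
    simp [SModEq.sub_mem, Basis.mem_ideal_smul_top_iff β, Ideal.mul_top]
  refine { haus' := fun x hx => ?_, prec' := fun f hf => ?_ }
  · refine β.repr.injective (Finsupp.ext fun i => ?_)
    refine (IsHausdorff.haus (I := I) inferInstance (β.repr x i) fun n => ?_).trans (by simp)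
    simpa using (key n x 0).1 (hx n) i
  · have h : ∀ i, ∃ L : A, ∀ n, β.repr (f n) i ≡ L [SMOD (I ^ n • ⊤ : Submodule A A)] := fun i =>
      IsPrecomplete.prec (I := I) inferInstance fun {m n} hmn => (key m _ _).1 (hf hmn) i
    choose L hL using h
    refine ⟨β.equivFun.symm L, fun n => (key n _ _).2 fun i => ?_⟩
    have : β.repr (β.equivFun.symm L) i = L i := by
      rw [← β.equivFun_apply, LinearEquiv.apply_symm_apply]
    rw [this]
    exact hL i n

/-- An element of an artinian ring without nontrivial idempotents is nilpotent or a unit. -/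
theorem isNilpotent_or_isUnit_of_isArtinianRing {R : Type*} [CommRing R] [IsArtinianRing R]
    (hR : ∀ e : R, IsIdempotentElem e → e = 0 ∨ e = 1) (x : R) : IsNilpotent x ∨ IsUnit x := by
  obtain ⟨n, y, hn⟩ := IsArtinian.exists_pow_succ_smul_dvd x (1 : R)
  replace hn : x ^ n * (x * y) = x ^ n := by
    simpa [pow_succ, mul_assoc] using hn
  have hk : ∀ m : ℕ, x ^ n * (x * y) ^ m = x ^ n := by
    intro m
    induction m with
    | zero => simp
    | succ m ih => rw [pow_succ, ← mul_assoc, ih, hn]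
  -- Descending powers of $x$ stabilize: $x^n=x^n(xy)$. Then $(xy)^n$ is the idempotent of the
  -- factor on which $x$ is invertible.
  have he : IsIdempotentElem ((x * y) ^ n) := by
    have := hk n
    rw [IsIdempotentElem]
    nth_rewrite 1 [mul_pow]
    rw [mul_assoc, mul_left_comm, this, mul_comm, mul_pow]
  rcases hR _ he with h | h
  · left
    exact ⟨n, by rw [← hk n, h, mul_zero]⟩
  · right
    have hu : IsUnit (x ^ n) := IsUnit.of_mul_eq_one (y ^ n) (by rw [← mul_pow, h])
    exact IsUnit.of_mul_eq_one y (hu.mul_left_cancel (by rw [hn, mul_one]))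

/-- A domain `B` that is `I`-adically complete with `B ⧸ I` artinian is local. -/
theorem isLocalRing_of_isAdicComplete_of_isArtinianRing {B : Type*} [CommRing B] [IsDomain B]
    (I : Ideal B) [IsAdicComplete I B] [IsArtinianRing (B ⧸ I)] (hI : I ≠ ⊤) :
    IsLocalRing B := by
  have hjac : I ≤ Ideal.jacobson ⊥ := IsAdicComplete.le_jacobson_bot I
  have hloc : IsLocalHom (Ideal.Quotient.mk I) := isLocalHom_of_le_jacobson_bot I hjac
  have hnt : Nontrivial (B ⧸ I) := Ideal.Quotient.nontrivial_iff.2 hI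
  have hidem : ∀ e : B ⧸ I, IsIdempotentElem e → e = 0 ∨ e = 1 := by
    intro e he
    obtain ⟨e₀, rfl⟩ := Ideal.Quotient.mk_surjective e
    have hmem : e₀ ^ 2 - e₀ ∈ I := by
      rw [← Ideal.Quotient.eq_zero_iff_mem, map_sub, map_pow, pow_two, he.eq, sub_self]
    -- Idempotents lift along $B\to B/I$ by Hensel's lemma for $X^2-X$, whose derivative is a unit
    -- at $e_0$ since $(2e_0-1)^2=1+4(e_0^2-e_0)$. In a domain the lift can only be $0$ or $1$.
    obtain ⟨f, hf⟩ : ∃ f : Polynomial B, f = Polynomial.X ^ 2 - Polynomial.X := ⟨_, rfl⟩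
    have hmonic : f.Monic := by
      rw [hf]
      monicity!
    have heval : ∀ x, f.eval x = x ^ 2 - x := by simp [hf]
    have hderiv : f.derivative.eval e₀ = 2 * e₀ - 1 := by
      simp only [hf, Polynomial.derivative_sub, Polynomial.derivative_X_pow,
        Polynomial.derivative_X]
      simp
    have hunit : IsUnit (Ideal.Quotient.mk I (f.derivative.eval e₀)) := by
      refine IsUnit.of_mul_eq_one (Ideal.Quotient.mk I (2 * e₀ - 1)) ?_
      rw [hderiv, ← map_mul, ← map_one (Ideal.Quotient.mk I), Ideal.Quotient.eq]
      have : (2 * e₀ - 1) * (2 * e₀ - 1) - 1 = 4 * (e₀ ^ 2 - e₀) := by ring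
      rw [this]
      exact I.mul_mem_left _ hmem
    obtain ⟨a, ha, hae⟩ := HenselianRing.is_henselian (I := I) f hmonic e₀
      (by rw [heval]; exact hmem) hunit
    have h1 : a * (a - 1) = 0 := by
      have : a ^ 2 - a = 0 := by rw [← heval]; exact ha
      linear_combination this
    have h2 : Ideal.Quotient.mk I e₀ = Ideal.Quotient.mk I a := (Ideal.Quotient.eq.2 hae).symm
    rcases mul_eq_zero.1 h1 with h | h
    · left; rw [h2, h, map_zero]
    · right; rw [h2, sub_eq_zero.1 h, map_one]
  have hdich := isNilpotent_or_isUnit_of_isArtinianRing hidem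
  refine IsLocalRing.of_nonunits_add fun a b ha hb => ?_
  have hnil : ∀ x : B, x ∈ nonunits B → IsNilpotent (Ideal.Quotient.mk I x) := fun x hx =>
    (hdich _).resolve_right fun hu => hx (isUnit_of_map_unit _ x hu)
  intro hu
  have hab : IsNilpotent (Ideal.Quotient.mk I (a + b)) := by
    rw [map_add]
    exact (Commute.all _ _).isNilpotent_add (hnil a ha) (hnil b hb)
  exact hab.not_isUnit (hu.map _)

/-- A Dedekind domain that is finite and free over a complete discrete valuation ring is a discrete
valuation ring. -/
theorem isDiscreteValuationRing_of_finite_free (A : Type*) [CommRing A] [IsDomain A]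
    [IsDiscreteValuationRing A] [IsAdicComplete (maximalIdeal A) A]
    (B : Type*) [CommRing B] [IsDedekindDomain B] [Algebra A B] [FaithfulSMul A B]
    [Module.Finite A B] [Module.Free A B] : IsDiscreteValuationRing B := by
  obtain ⟨I, hIdef⟩ : ∃ I, I = (maximalIdeal A).map (algebraMap A B) := ⟨_, rfl⟩
  have hI : I ≠ ⊤ := by
    obtain ⟨Q, hQ, hQe⟩ := Ideal.exists_ideal_over_maximal_of_isIntegral
      (S := B) (maximalIdeal A) (by
        rw [(RingHom.injective_iff_ker_eq_bot (algebraMap A B)).1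
          (FaithfulSMul.algebraMap_injective _ _)]
        exact bot_le)
    exact ne_top_of_le_ne_top hQ.ne_top (hIdef ▸ Ideal.map_le_iff_le_comap.2 hQe.ge)
  have hc : IsAdicComplete (maximalIdeal A) B := isAdicComplete_of_finite_free _ _
  have hc' : IsAdicComplete I B := by
    rw [hIdef]
    exact { (IsHausdorff.map_algebraMap_iff (I := maximalIdeal A) (M := B) (S := B)).2
              inferInstance,
            (IsPrecomplete.map_algebraMap_iff (I := maximalIdeal A) (M := B) (S := B)).2
              inferInstance with }
  have hart : IsArtinianRing (B ⧸ I) := by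
    rw [hIdef]
    have : IsArtinianRing (A ⧸ maximalIdeal A) :=
      inferInstanceAs (IsArtinianRing (ResidueField A))
    have : Module.Finite (A ⧸ maximalIdeal A) (B ⧸ (maximalIdeal A).map (algebraMap A B)) :=
      Module.Finite.of_restrictScalars_finite A (A ⧸ maximalIdeal A) _
    exact IsArtinianRing.of_finite (A ⧸ maximalIdeal A) _
  have hloc : IsLocalRing B := isLocalRing_of_isAdicComplete_of_isArtinianRing I hI
  have hnf : ¬ IsField B := by
    intro hf
    have h0 := IsLocalRing.isField_iff_maximalIdeal_eq.1 hf
    have h1 : I ≤ ⊥ := h0 ▸ IsLocalRing.le_maximalIdeal hI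
    obtain ⟨ϖ, hϖ⟩ := IsDiscreteValuationRing.exists_irreducible A
    have h2 : algebraMap A B ϖ = 0 :=
      h1 (hIdef ▸ Ideal.mem_map_of_mem _ ((mem_maximalIdeal _).2 hϖ.not_isUnit))
    exact hϖ.ne_zero (FaithfulSMul.algebraMap_injective A B (by simpa using h2))
  exact ((IsDiscreteValuationRing.TFAE B hnf).out 0 2).2 ‹IsDedekindDomain B›

/-- In a finite free extension of discrete valuation rings with algebraically closed residue field,
every element is congruent to one of the base ring modulo the maximal ideal. -/
theorem exists_sub_mem_maximalIdeal (A : Type*) [CommRing A] [IsLocalRing A]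
    [IsAlgClosed (ResidueField A)] (B : Type*) [CommRing B] [IsLocalRing B] [Algebra A B]
    [Module.Finite A B] [FaithfulSMul A B] (x : B) :
    ∃ a : A, x - algebraMap A B a ∈ maximalIdeal B := by
  have : IsLocalHom (algebraMap A B) := Algebra.IsIntegral.isLocalHom A B
  have hs := (IsAlgClosed.algebraMap_bijective_of_isIntegral
    (k := ResidueField A) (K := ResidueField B)).2
  obtain ⟨y, hy⟩ := hs (residue B x)
  obtain ⟨a, rfl⟩ := residue_surjective y
  refine ⟨a, ?_⟩
  rw [← residue_eq_zero_iff, map_sub, ← hy, sub_eq_zero]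
  rfl

/-- The ramification index is the degree if the residue field is algebraically closed. -/
theorem associated_uniformizer_pow_finrank (A : Type*) [CommRing A] [IsDomain A]
    [IsDiscreteValuationRing A] [IsAlgClosed (ResidueField A)] (B : Type*) [CommRing B] [IsDomain B]
    [IsDiscreteValuationRing B] [Algebra A B] [Module.Finite A B] [Module.Free A B]
    [FaithfulSMul A B] {a : A} {ϖ : B} (ha : Irreducible a) (hϖ : Irreducible ϖ) :
    Associated (algebraMap A B a) (ϖ ^ Module.finrank A B) := by
  have hlh : IsLocalHom (algebraMap A B) := Algebra.IsIntegral.isLocalHom A B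
  have hover : (maximalIdeal B).LiesOver (maximalIdeal A) := inferInstance
  have hn0 : maximalIdeal A ≠ ⊥ := IsDiscreteValuationRing.not_a_field A
  have hB0 : maximalIdeal B ≠ ⊥ := IsDiscreteValuationRing.not_a_field B
  have hprimes : (maximalIdeal A).primesOver B = {maximalIdeal B} := by
    ext Q
    refine ⟨fun ⟨hQ, hQo⟩ => ?_, ?_⟩
    · have hQm : Q.IsMaximal := Ideal.IsMaximal.of_liesOver_isMaximal Q (maximalIdeal A)
      exact IsLocalRing.eq_maximalIdeal hQm
    · rintro rfl
      exact ⟨inferInstance, hover⟩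
  have : Fintype ((maximalIdeal A).primesOver B) := by
    rw [hprimes]
    infer_instance
  -- In $\sum ef=[B:A]$ there is one term because $B$ is local, and there $f=1$ because $A$ surjects
  -- onto the residue field of $B$.
  have hsum := Ideal.sum_ramification_inertia_eq_finrank (maximalIdeal A) B
  have huniq : ∀ q : (maximalIdeal A).primesOver B, q.1 = maximalIdeal B := fun q => by
    have : q.1 ∈ ({maximalIdeal B} : Set (Ideal B)) := hprimes.subset q.2
    exact this
  have hone : (Finset.univ : Finset ((maximalIdeal A).primesOver B)) =
      {⟨maximalIdeal B, by rw [hprimes]; rfl⟩} := by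
    ext q
    simpa [Subtype.ext_iff] using huniq q
  rw [hone, Finset.sum_singleton] at hsum
  have hres : (maximalIdeal B).inertiaDeg A = 1 := by
    rw [Ideal.inertiaDeg_eq_of_isMaximal (maximalIdeal A) (maximalIdeal B)]
    let : Field (A ⧸ maximalIdeal A) := Ideal.Quotient.field _
    refine finrank_eq_one (1 : B ⧸ maximalIdeal B) one_ne_zero fun x => ?_
    obtain ⟨x, rfl⟩ := Ideal.Quotient.mk_surjective x
    obtain ⟨r, hr⟩ := exists_sub_mem_maximalIdeal A B x
    refine ⟨Ideal.Quotient.mk _ r, ?_⟩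
    rw [Algebra.smul_def, mul_one, Ideal.Quotient.algebraMap_mk_of_liesOver, eq_comm,
      Ideal.Quotient.eq]
    exact hr
  have ha0 : algebraMap A B a ≠ 0 := fun h =>
    ha.ne_zero (FaithfulSMul.algebraMap_injective A B (by simpa using h))
  obtain ⟨m, hm⟩ := IsDiscreteValuationRing.associated_pow_irreducible ha0 hϖ
  have hmap : (maximalIdeal A).map (algebraMap A B) = maximalIdeal B ^ m := by
    rw [ha.maximalIdeal_eq, hϖ.maximalIdeal_eq, Ideal.map_span, Set.image_singleton,
      Ideal.span_singleton_pow, Ideal.span_singleton_eq_span_singleton]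
    exact hm
  have hram : (maximalIdeal B).ramificationIdx A = m := by
    rw [Ideal.IsDedekindDomain.ramificationIdx_eq_multiplicity (maximalIdeal A) (maximalIdeal B)
      (by rw [hmap]; exact pow_ne_zero _ hB0), hmap]
    exact multiplicity_pow_self hB0 (by
      rw [Ideal.isUnit_iff]; exact (maximalIdeal.isMaximal B).ne_top) m
  rw [hram, hres, mul_one] at hsum
  rw [← hsum]
  exact hm

end CompleteDVR

end RamificationConductor

end

noncomputable section

namespace RamificationConductor

/-! ### The normalized valuation of one field -/

section Ord

set_option linter.unusedSectionVars false

variable {A : Type*} [CommRing A] {E : Type*} [Field E] [Algebra A E]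
  [IsDiscreteValuationRing (integralClosure A E)] [IsFractionRing (integralClosure A E) E]

theorem IsUniformizer.ne_zero {ϖ : E} (h : IsUniformizer A E ϖ) : ϖ ≠ 0 := by
  obtain ⟨x, hx, rfl⟩ := h
  simpa using hx.ne_zero

theorem exists_isUniformizer : ∃ ϖ : E, IsUniformizer A E ϖ := by
  obtain ⟨x, hx⟩ := IsDiscreteValuationRing.exists_irreducible (integralClosure A E)
  exact ⟨x, x, hx, rfl⟩

theorem exists_unit_mul_zpow {ϖ : E} (hϖ : IsUniformizer A E ϖ) {x : E} (hx : x ≠ 0) :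
    ∃ (n : ℤ) (u : (integralClosure A E)ˣ), x = ((u : integralClosure A E) : E) * ϖ ^ n := by
  obtain ⟨y, hy, rfl⟩ := hϖ
  obtain ⟨n, u, h⟩ := IsDiscreteValuationRing.exists_units_eq_smul_zpow_of_irreducible hy hx
  exact ⟨n, u, by rw [h]; rfl⟩

theorem exists_hasOrd {x : E} (hx : x ≠ 0) : ∃ n, HasOrd A E x n := by
  obtain ⟨ϖ, hϖ⟩ := exists_isUniformizer (A := A) (E := E)
  obtain ⟨n, u, h⟩ := exists_unit_mul_zpow hϖ hx
  exact ⟨n, ϖ, hϖ, u, h⟩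

theorem IsUniformizer.exists_unit_mul {ϖ ϖ' : E} (h : IsUniformizer A E ϖ)
    (h' : IsUniformizer A E ϖ') :
    ∃ u : (integralClosure A E)ˣ, ϖ' = ((u : integralClosure A E) : E) * ϖ := by
  obtain ⟨x, hx, rfl⟩ := h
  obtain ⟨y, hy, rfl⟩ := h'
  obtain ⟨u, hu⟩ := IsDiscreteValuationRing.associated_of_irreducible _ hx hy
  exact ⟨u, by rw [← hu, mul_comm]; rfl⟩

theorem unit_ne_zero (u : (integralClosure A E)ˣ) : ((u : integralClosure A E) : E) ≠ 0 := by
  simp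

theorem HasOrd.ne_zero {x : E} {n : ℤ} (h : HasOrd A E x n) : x ≠ 0 := by
  obtain ⟨ϖ, hϖ, u, rfl⟩ := h
  exact mul_ne_zero (unit_ne_zero u) (zpow_ne_zero _ hϖ.ne_zero)

/-- `HasOrd` can be tested on any uniformizer. -/
theorem HasOrd.exists_unit {x : E} {n : ℤ} (h : HasOrd A E x n) {ϖ : E}
    (hϖ : IsUniformizer A E ϖ) :
    ∃ u : (integralClosure A E)ˣ, x = ((u : integralClosure A E) : E) * ϖ ^ n := by
  obtain ⟨ϖ', hϖ', u, rfl⟩ := h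
  obtain ⟨v, rfl⟩ := hϖ.exists_unit_mul hϖ'
  have hv : (((v ^ n : (integralClosure A E)ˣ) : integralClosure A E) : E) =
      ((v : integralClosure A E) : E) ^ n := by
    let f : (integralClosure A E)ˣ →* Eˣ := Units.map (algebraMap (integralClosure A E) E).toMonoidHom
    change ((f (v ^ n) : Eˣ) : E) = (f v : E) ^ n
    rw [map_zpow, Units.val_zpow_eq_zpow_val]
  refine ⟨u * v ^ n, ?_⟩
  rw [Units.val_mul, MulMemClass.coe_mul, hv, mul_zpow]
  ring

theorem HasOrd.mul {x y : E} {m n : ℤ} (hx : HasOrd A E x m) (hy : HasOrd A E y n) :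
    HasOrd A E (x * y) (m + n) := by
  obtain ⟨ϖ, hϖ, u, rfl⟩ := hx
  obtain ⟨v, rfl⟩ := hy.exists_unit hϖ
  refine ⟨ϖ, hϖ, u * v, ?_⟩
  rw [zpow_add₀ hϖ.ne_zero, Units.val_mul, MulMemClass.coe_mul]
  ring

theorem HasOrd.inv {x : E} {m : ℤ} (hx : HasOrd A E x m) : HasOrd A E x⁻¹ (-m) := by
  obtain ⟨ϖ, hϖ, u, rfl⟩ := hx
  refine ⟨ϖ, hϖ, u⁻¹, ?_⟩
  have : (((u⁻¹ : (integralClosure A E)ˣ) : integralClosure A E) : E) =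
      (((u : integralClosure A E) : E))⁻¹ := by
    refine eq_inv_of_mul_eq_one_left ?_
    rw [← MulMemClass.coe_mul, Units.inv_mul]
    rfl
  rw [this, mul_inv, zpow_neg]

/-- If $x$ were integral of negative order, multiplying by a power of the uniformizer would exhibit
the unit $u$ as a multiple of the uniformizer. -/
theorem HasOrd.nonneg_iff {x : E} {m : ℤ} (hx : HasOrd A E x m) : 0 ≤ m ↔ IsIntegral A x := by
  obtain ⟨ϖ, ⟨y, hy, rfl⟩, u, rfl⟩ := hx
  constructor
  · intro hm
    lift m to ℕ using hm
    have := ((u : integralClosure A E) * y ^ m).2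
    simpa [mem_integralClosure_iff] using this
  · intro hi
    by_contra! hm
    obtain ⟨k, rfl⟩ : ∃ k : ℕ, m = -((k : ℤ) + 1) := ⟨(-m - 1).toNat, by omega⟩
    have hy0 : (y : E) ≠ 0 := by simpa using hy.ne_zero
    let z : integralClosure A E := ⟨_, hi⟩
    have hz : z * y ^ (k + 1) = u := by
      apply Subtype.ext
      change ((u : integralClosure A E) : E) * (y : E) ^ (-((k : ℤ) + 1)) * ((y : E)) ^ (k + 1) = _
      rw [mul_assoc, zpow_neg, ← Nat.cast_succ, zpow_natCast, inv_mul_cancel₀ (pow_ne_zero _ hy0),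
        mul_one]
    refine hy.not_isUnit (isUnit_of_dvd_unit ?_ u.isUnit)
    rw [← hz, pow_succ]
    exact ⟨z * y ^ k, by ring⟩

/-- Writing $1=xx^{-1}$ in two ways gives $1$ the orders $m-n$ and $n-m$, both nonnegative because
$1$ is integral. This makes the choice in `ord` harmless. -/
theorem HasOrd.unique {x : E} {m n : ℤ} (hm : HasOrd A E x m) (hn : HasOrd A E x n) : m = n := by
  have hx := hm.ne_zero
  have h1 := hm.mul hn.inv
  have h2 := hn.mul hm.inv
  rw [mul_inv_cancel₀ hx] at h1 h2
  have h1' := h1.nonneg_iff.2 isIntegral_one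
  have h2' := h2.nonneg_iff.2 isIntegral_one
  omega

theorem ord_eq_coe_iff {x : E} {n : ℤ} : ord A E x = n ↔ HasOrd A E x n := by
  unfold ord
  split_ifs with h
  · rw [WithTop.coe_inj]
    exact ⟨fun hn => hn ▸ h.choose_spec, fun hn => h.choose_spec.unique hn⟩
  · simp only [WithTop.top_ne_coe, false_iff]
    exact fun hn => h ⟨n, hn⟩

theorem ord_eq_top_iff {x : E} : ord A E x = ⊤ ↔ x = 0 := by
  constructor
  · intro h
    by_contra hx
    obtain ⟨n, hn⟩ := exists_hasOrd (A := A) hx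
    rw [ord_eq_coe_iff.2 hn] at h
    exact WithTop.coe_ne_top h
  · rintro rfl
    unfold ord
    rw [dif_neg]
    rintro ⟨n, hn⟩
    exact hn.ne_zero rfl

theorem ord_nonneg_iff {x : E} : 0 ≤ ord A E x ↔ IsIntegral A x := by
  rcases eq_or_ne x 0 with rfl | hx
  · simp [ord_eq_top_iff.2, isIntegral_zero]
  · obtain ⟨n, hn⟩ := exists_hasOrd (A := A) hx
    rw [ord_eq_coe_iff.2 hn, ← hn.nonneg_iff]
    exact_mod_cast Iff.rfl

theorem hasOrd_one : HasOrd A E 1 0 := by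
  obtain ⟨ϖ, hϖ⟩ := exists_isUniformizer (A := A) (E := E)
  exact ⟨ϖ, hϖ, 1, by simp⟩

theorem ord_mul (x y : E) : ord A E (x * y) = ord A E x + ord A E y := by
  rcases eq_or_ne x 0 with rfl | hx
  · simp [ord_eq_top_iff.2]
  rcases eq_or_ne y 0 with rfl | hy
  · simp [ord_eq_top_iff.2]
  obtain ⟨m, hm⟩ := exists_hasOrd (A := A) hx
  obtain ⟨n, hn⟩ := exists_hasOrd (A := A) hy
  rw [ord_eq_coe_iff.2 hm, ord_eq_coe_iff.2 hn, ord_eq_coe_iff.2 (hm.mul hn)]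
  rfl

theorem ord_le_ord_add {x y : E} (hxy : ord A E x ≤ ord A E y) :
    ord A E x ≤ ord A E (x + y) := by
  rcases eq_or_ne x 0 with rfl | hx
  · simpa using hxy
  rcases eq_or_ne y 0 with rfl | hy
  · simp
  obtain ⟨m, hm⟩ := exists_hasOrd (A := A) hx
  obtain ⟨n, hn⟩ := exists_hasOrd (A := A) hy
  have hmn : m ≤ n := by
    rw [ord_eq_coe_iff.2 hm, ord_eq_coe_iff.2 hn] at hxy
    exact_mod_cast hxy
  have h1 : IsIntegral A (y * x⁻¹) := (hn.mul hm.inv).nonneg_iff.1 (by omega)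
  have h2 : x + y = x * (1 + y * x⁻¹) := by field_simp
  rw [h2, ord_mul]
  exact le_add_of_nonneg_right (ord_nonneg_iff.2 (isIntegral_one.add h1))

variable (A E) in
/-- The normalized valuation as an additive valuation. -/
def ordValuation : AddValuation E (WithTop ℤ) :=
  AddValuation.of (ord A E) (ord_eq_top_iff.2 rfl) (ord_eq_coe_iff.2 hasOrd_one)
    (fun x y => by
      rcases le_total (ord A E x) (ord A E y) with h | h
      · rw [min_eq_left h]
        exact ord_le_ord_add h
      · rw [min_eq_right h, add_comm]
        exact ord_le_ord_add h)
    ord_mul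

theorem IsUniformizer.ord_eq {ϖ : E} (h : IsUniformizer A E ϖ) : ord A E ϖ = (1 : ℤ) :=
  ord_eq_coe_iff.2 ⟨ϖ, h, 1, by simp⟩

end Ord

end RamificationConductor

end

noncomputable section

namespace RamificationConductor

theorem AddValuation.map_pow_coe {E : Type*} [Field E] (w : AddValuation E (WithTop ℝ)) {x : E}
    {r : ℝ} (hr : w x = r) (n : ℕ) : w (x ^ n) = ((n * r : ℝ) : WithTop ℝ) := by
  rw [_root_.AddValuation.map_pow, hr, ← WithTop.coe_nsmul, nsmul_eq_mul]

theorem AddValuation.map_zpow_coe {E : Type*} [Field E] (w : AddValuation E (WithTop ℝ)) {x : E}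
    {r : ℝ} (hr : w x = r) (n : ℤ) : w (x ^ n) = ((n * r : ℝ) : WithTop ℝ) := by
  obtain ⟨m, rfl | rfl⟩ := n.eq_nat_or_neg
  · simpa using AddValuation.map_pow_coe w hr m
  · have : ((-(m : ℤ) : ℤ) : ℝ) * r = -(m * r) := by
      push_cast
      ring
    rw [zpow_neg, zpow_natCast, _root_.AddValuation.map_inv, AddValuation.map_pow_coe w hr, this]
    rfl

/-! ### The valuation normalized on the base ring, common to all finite extensions -/

section NormalizedValuation

set_option linter.unusedSectionVars false

open IsLocalRing Module

variable (A : Type*) [CommRing A] [IsDomain A] [IsDiscreteValuationRing A]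
  [IsAdicComplete (maximalIdeal A) A] [IsAlgClosed (ResidueField A)]
  (K : Type*) [Field K] [CharZero K] [Algebra A K] [IsFractionRing A K]

section Extension

variable (E : Type*) [Field E] [Algebra K E] [Algebra A E] [IsScalarTower A K E]
  [FiniteDimensional K E]

theorem faithfulSMul_of_isScalarTower (A K E : Type*) [CommRing A] [Field K] [Algebra A K]
    [IsFractionRing A K] [Field E] [Algebra K E] [Algebra A E] [IsScalarTower A K E] :
    FaithfulSMul A E := by
  rw [faithfulSMul_iff_algebraMap_injective, IsScalarTower.algebraMap_eq A K E]
  exact (algebraMap K E).injective.comp (IsFractionRing.injective A K)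

theorem finite_integralClosure (A K E : Type*) [CommRing A] [IsDomain A]
    [IsDiscreteValuationRing A] [Field K] [CharZero K] [Algebra A K]
    [IsFractionRing A K] [Field E] [Algebra K E] [Algebra A E] [IsScalarTower A K E]
    [FiniteDimensional K E] : Module.Finite A (integralClosure A E) :=
  IsIntegralClosure.finite A K E (integralClosure A E)

theorem free_integralClosure (A K E : Type*) [CommRing A] [IsDomain A]
    [IsDiscreteValuationRing A] [Field K] [CharZero K] [Algebra A K]
    [IsFractionRing A K] [Field E] [Algebra K E] [Algebra A E] [IsScalarTower A K E]
    [FiniteDimensional K E] : Module.Free A (integralClosure A E) := by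
  have := faithfulSMul_of_isScalarTower A K E
  have : Module.IsTorsionFree A E := inferInstance
  exact IsIntegralClosure.module_free A K E (integralClosure A E)

theorem finrank_integralClosure (A K E : Type*) [CommRing A] [IsDomain A]
    [IsDiscreteValuationRing A] [Field K] [CharZero K] [Algebra A K]
    [IsFractionRing A K] [Field E] [Algebra K E] [Algebra A E] [IsScalarTower A K E]
    [FiniteDimensional K E] : finrank A (integralClosure A E) = finrank K E := by
  have := faithfulSMul_of_isScalarTower A K E
  have : Module.IsTorsionFree A E := inferInstance
  exact IsIntegralClosure.rank A K E (integralClosure A E)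

/-- The integral closure of a complete discrete valuation ring in a finite extension of
its fraction field is a discrete valuation ring. -/
theorem isDiscreteValuationRing_integralClosure (A K E : Type*) [CommRing A] [IsDomain A]
    [IsDiscreteValuationRing A] [IsAdicComplete (maximalIdeal A) A] [Field K] [CharZero K] [Algebra A K]
    [IsFractionRing A K] [Field E] [Algebra K E] [Algebra A E] [IsScalarTower A K E]
    [FiniteDimensional K E] :
    IsDiscreteValuationRing (integralClosure A E) := by
  have := finite_integralClosure A K E
  have := free_integralClosure A K E
  have := faithfulSMul_of_isScalarTower A K E
  have := integralClosure.isDedekindDomain A K E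
  have : FaithfulSMul A (integralClosure A E) := inferInstance
  exact isDiscreteValuationRing_of_finite_free A (integralClosure A E)

theorem isFractionRing_integralClosure (A K E : Type*) [CommRing A] [IsDomain A]
    [IsDiscreteValuationRing A] [Field K] [CharZero K] [Algebra A K]
    [IsFractionRing A K] [Field E] [Algebra K E] [Algebra A E] [IsScalarTower A K E]
    [FiniteDimensional K E] :
    IsFractionRing (integralClosure A E) E :=
  integralClosure.isFractionRing_of_finite_extension K E

/-- Total ramification: up to a unit, $a$ is the $[E:K]$-th power of a uniformizer of $E$. -/
theorem ord_algebraMap_of_irreducible {a : A} (ha : Irreducible a) :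
    ord A E (algebraMap A E a) = (finrank K E : ℤ) := by
  have := finite_integralClosure A K E
  have := free_integralClosure A K E
  have := faithfulSMul_of_isScalarTower A K E
  have : FaithfulSMul A (integralClosure A E) := inferInstance
  have := isDiscreteValuationRing_integralClosure A K E
  have := isFractionRing_integralClosure A K E
  obtain ⟨ϖ, hϖ⟩ := IsDiscreteValuationRing.exists_irreducible (integralClosure A E)
  obtain ⟨u, hu⟩ := (associated_uniformizer_pow_finrank A (integralClosure A E) ha hϖ).symm
  rw [finrank_integralClosure A K E] at hu
  refine ord_eq_coe_iff.2 ⟨ϖ, ⟨ϖ, hϖ, rfl⟩, u, ?_⟩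
  rw [IsScalarTower.algebraMap_apply A (integralClosure A E) E, ← hu, mul_comm, zpow_natCast]
  simp [Algebra.algebraMap_eq_smul_one, Subalgebra.smul_def]

/-- The valuation of a finite extension of `K` which takes the value `1` at the uniformizers
of `A`. -/
def ramVal : AddValuation E (WithTop ℝ) :=
  haveI := isDiscreteValuationRing_integralClosure A K E
  haveI := isFractionRing_integralClosure A K E
  (ordValuation A E).map
    (AddMonoidHom.withTopMap (AddMonoidHom.mulRight ((finrank K E : ℝ)⁻¹) |>.comp
      (Int.castAddHom ℝ))) rfl (by
      refine WithTop.monotone_map_iff.2 fun m n h => ?_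
      have h' : (m : ℝ) ≤ n := by exact_mod_cast h
      exact mul_le_mul_of_nonneg_right h' (by positivity))

variable {E}

theorem ramVal_apply (x : E) :
    ramVal A K E x = (ord A E x).map fun n : ℤ => (n : ℝ) * (finrank K E : ℝ)⁻¹ := rfl

theorem ramVal_eq_of_ord_eq {x : E} {n : ℤ} (h : ord A E x = n) :
    ramVal A K E x = ((n * (finrank K E : ℝ)⁻¹ : ℝ) : WithTop ℝ) := by
  rw [ramVal_apply, h]
  rfl

theorem finrank_inv_pos : 0 < (finrank K E : ℝ)⁻¹ := by
  have : 0 < finrank K E := finrank_pos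
  positivity

theorem ord_eq_of_ramVal_eq {x : E} {n : ℤ}
    (h : ramVal A K E x = ((n * (finrank K E : ℝ)⁻¹ : ℝ) : WithTop ℝ)) : ord A E x = n := by
  rw [ramVal_apply] at h
  obtain ⟨m, hm, hmn⟩ : ∃ m : ℤ, ord A E x = m ∧
      (m : ℝ) * (finrank K E : ℝ)⁻¹ = n * (finrank K E : ℝ)⁻¹ := by
    cases hx : ord A E x with
    | top =>
      rw [hx, WithTop.map_top] at h
      exact absurd h WithTop.top_ne_coe
    | coe m => exact ⟨m, rfl, by simpa only [hx, WithTop.map_coe, WithTop.coe_inj] using h⟩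
  have h1 := finrank_inv_pos K (E := E)
  have : (m : ℝ) = n := mul_right_cancel₀ h1.ne' hmn
  rw [hm]
  exact_mod_cast this

theorem exists_ramVal_eq {x : E} (hx : x ≠ 0) :
    ∃ n : ℤ, ramVal A K E x = ((n * (finrank K E : ℝ)⁻¹ : ℝ) : WithTop ℝ) := by
  have := isDiscreteValuationRing_integralClosure A K E
  have := isFractionRing_integralClosure A K E
  obtain ⟨n, hn⟩ := exists_hasOrd (A := A) hx
  exact ⟨n, ramVal_eq_of_ord_eq A K (ord_eq_coe_iff.2 hn)⟩

theorem ramVal_nonneg_iff {x : E} : 0 ≤ ramVal A K E x ↔ IsIntegral A x := by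
  have := isDiscreteValuationRing_integralClosure A K E
  have := isFractionRing_integralClosure A K E
  rw [← ord_nonneg_iff, ramVal_apply]
  have h1 := finrank_inv_pos K (E := E)
  cases h : ord A E x with
  | top => simp
  | coe n =>
    rw [WithTop.map_coe]
    norm_cast
    rw [mul_nonneg_iff_of_pos_right h1]
    norm_cast

variable (E) in
theorem ramVal_uniformizer {a : A} (ha : Irreducible a) : ramVal A K E (algebraMap A E a) = 1 := by
  rw [ramVal_eq_of_ord_eq A K (ord_algebraMap_of_irreducible A K E ha)]
  have : (finrank K E : ℝ) ≠ 0 := by exact_mod_cast (finrank_pos (R := K) (M := E)).ne'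
  norm_cast
  exact mul_inv_cancel₀ this

variable (E) in
theorem exists_ramVal_eq_finrank_inv :
    ∃ x : E, ramVal A K E x = ((finrank K E : ℝ)⁻¹ : ℝ) := by
  have := isDiscreteValuationRing_integralClosure A K E
  have := isFractionRing_integralClosure A K E
  obtain ⟨ϖ, hϖ⟩ := exists_isUniformizer (A := A) (E := E)
  exact ⟨ϖ, by simpa using ramVal_eq_of_ord_eq A K hϖ.ord_eq⟩

/-- Every integral element is congruent to an element of `A`. -/
theorem exists_pos_ramVal_sub {x : E} (hx : 0 ≤ ramVal A K E x) :
    ∃ a : A, 0 < ramVal A K E (x - algebraMap A E a) := by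
  have := finite_integralClosure A K E
  have := faithfulSMul_of_isScalarTower A K E
  have : FaithfulSMul A (integralClosure A E) := inferInstance
  have := isDiscreteValuationRing_integralClosure A K E
  have := isFractionRing_integralClosure A K E
  obtain ⟨a, ha⟩ := exists_sub_mem_maximalIdeal A (integralClosure A E)
    ⟨x, (ramVal_nonneg_iff A K).1 hx⟩
  refine ⟨a, ?_⟩
  obtain ⟨ϖ, hϖ⟩ := IsDiscreteValuationRing.exists_irreducible (integralClosure A E)
  rw [hϖ.maximalIdeal_eq, Ideal.mem_span_singleton] at ha
  obtain ⟨c, hc⟩ := ha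
  have hc' : x - algebraMap A E a = ϖ * c := congrArg Subtype.val hc
  have hϖ' : IsUniformizer A E (ϖ : E) := ⟨ϖ, hϖ, rfl⟩
  have h1 : 0 < ramVal A K E ϖ := by
    rw [ramVal_eq_of_ord_eq A K hϖ'.ord_eq]
    have h1 := finrank_inv_pos K (E := E)
    norm_cast
    simpa using h1
  rw [hc', AddValuation.map_mul]
  exact add_pos_of_pos_of_nonneg h1 ((ramVal_nonneg_iff A K).2 c.2)

variable {E' : Type*} [Field E'] [Algebra K E'] [Algebra A E'] [IsScalarTower A K E']
  [FiniteDimensional K E']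

/-- The normalized valuations are compatible with all embeddings. -/
theorem ramVal_map (f : E →ₐ[A] E') (x : E) : ramVal A K E' (f x) = ramVal A K E x := by
  have := isDiscreteValuationRing_integralClosure A K E
  have := isFractionRing_integralClosure A K E
  rcases eq_or_ne x 0 with rfl | hx
  · simp
  obtain ⟨p, hp⟩ := IsDiscreteValuationRing.exists_irreducible A
  have hint : ∀ y : integralClosure A E, 0 ≤ ramVal A K E' (f y) := fun y =>
    (ramVal_nonneg_iff A K).2 (IsIntegral.map f y.2)
  have hunit : ∀ u : (integralClosure A E)ˣ, ramVal A K E' (f (u : integralClosure A E)) = 0 := by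
    intro u
    have h1 : ramVal A K E' (f (u : integralClosure A E)) +
        ramVal A K E' (f ((u⁻¹ : (integralClosure A E)ˣ) : integralClosure A E)) = 0 := by
      rw [← AddValuation.map_mul, ← map_mul, ← MulMemClass.coe_mul, Units.mul_inv]
      simp
    refine le_antisymm ?_ (hint _)
    rw [← h1]
    exact le_add_of_nonneg_right (hint _)
  obtain ⟨ϖ, hϖ⟩ := exists_isUniformizer (A := A) (E := E)
  have hfϖ : f ϖ ≠ 0 := by simpa using hϖ.ne_zero
  obtain ⟨r, hr⟩ := WithTop.ne_top_iff_exists.1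
    ((AddValuation.ne_top_iff (ramVal A K E')).2 hfϖ)
  have hz : ∀ n : ℤ, ramVal A K E' (f ϖ ^ n) = ((n * r : ℝ) : WithTop ℝ) :=
    AddValuation.map_zpow_coe _ hr.symm
  obtain ⟨u, hu⟩ := (ord_eq_coe_iff.1 (ord_algebraMap_of_irreducible A K E hp)).exists_unit hϖ
  -- The value $r$ of $f(\varpi)$ is pinned down by a uniformizer of $A$, which $f$ fixes and which
  -- has value $1$ in both fields.
  have h1 : (finrank K E : ℝ) * r = 1 := by
    have := ramVal_uniformizer A K E' hp
    rw [← f.commutes, hu, map_mul, AddValuation.map_mul, hunit, zero_add, map_zpow₀, hz] at this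
    exact_mod_cast this
  obtain ⟨n, hn⟩ := exists_hasOrd (A := A) hx
  rw [ramVal_eq_of_ord_eq A K (ord_eq_coe_iff.2 hn)]
  obtain ⟨v, rfl⟩ := hn.exists_unit hϖ
  rw [map_mul, AddValuation.map_mul, hunit, zero_add, map_zpow₀, hz, eq_inv_of_mul_eq_one_right h1]

end Extension

end NormalizedValuation

end RamificationConductor

end

noncomputable section

namespace RamificationConductor

/-! ### Ramification functions on an abstract finite group -/

section RamificationFunction

set_option linter.unusedSectionVars false

open Finset
open scoped Classical

variable {G : Type*} [Group G] [Fintype G]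

/-- The properties of `g ↦ v(g π - π)`, `g ≠ 1`; the value at `1` is irrelevant. -/
structure IsRamFun (j : G → ℝ) : Prop where
  mul : ∀ g h, g ≠ 1 → h ≠ 1 → g * h ≠ 1 → min (j g) (j h) ≤ j (g * h)
  inv : ∀ g, j g⁻¹ = j g
  conj : ∀ g h, j (h * g * h⁻¹) = j g

/-- `min (j g) s`, where `j 1` is read as infinity. -/
def cap (j : G → ℝ) (g : G) (s : ℝ) : ℝ := if g = 1 then s else min (j g) s

/-- The Herbrand function attached to a subgroup `H`, in the additive normalization. -/
def Phi (j : G → ℝ) (H : Subgroup G) (s : ℝ) : ℝ := ∑ h with h ∈ H, cap j h s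

variable {j : G → ℝ}

theorem cap_mono (g : G) : Monotone (cap j g) := by
  intro s t hst
  unfold cap
  split_ifs
  · exact hst
  · exact min_le_min_left _ hst

theorem Phi_mono (H : Subgroup G) : Monotone (Phi j H) := fun _ _ hst =>
  sum_le_sum fun g _ => cap_mono g hst

theorem Phi_strictMono (H : Subgroup G) : StrictMono (Phi j H) := by
  intro s t hst
  refine sum_lt_sum (fun g _ => cap_mono g hst.le) ⟨1, by simp [H.one_mem], ?_⟩
  simpa [cap] using hst

theorem sum_subgroup_mul_left (H : Subgroup G) {h₀ : G} (hh₀ : h₀ ∈ H) (f : G → ℝ) :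
    ∑ h with h ∈ H, f (h₀ * h) = ∑ h with h ∈ H, f h := by
  refine sum_bij (fun h _ => h₀ * h) ?_ ?_ ?_ ?_
  · intro h hh
    simpa using H.mul_mem hh₀ (by simpa using hh)
  · intro a _ b _ hab
    exact mul_left_cancel hab
  · intro b hb
    refine ⟨h₀⁻¹ * b, ?_, by simp⟩
    simpa using H.mul_mem (H.inv_mem hh₀) (by simpa using hb)
  · intro _ _
    rfl

/-- An element of maximal value in a coset `g H`. -/
theorem IsRamFun.exists_max_coset (hj : IsRamFun j) (H : Subgroup G) {g : G} (hg : g ∉ H) :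
    ∃ h₀ ∈ H, (∀ h ∈ H, j (g * h) ≤ j (g * h₀)) ∧
      (∑ h with h ∈ H, j (g * h) = Phi j H (j (g * h₀))) ∧
      ∀ s, ∑ h with h ∈ H, min (j (g * h)) s = min (Phi j H (j (g * h₀))) (Phi j H s) := by
  obtain ⟨h₀, hh₀, hmax⟩ := exists_max_image (univ.filter (· ∈ H)) (fun h => j (g * h))
    ⟨1, by simp [H.one_mem]⟩
  simp only [mem_filter, mem_univ, true_and] at hh₀ hmax
  have hg₀ : ∀ h ∈ H, g * h₀ * h ≠ 1 := by
    intro h hh h1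
    refine hg ?_
    have : g = (h₀ * h)⁻¹ := by
      rw [eq_inv_iff_mul_eq_one, ← mul_assoc, h1]
    rw [this]
    exact H.inv_mem (H.mul_mem hh₀ hh)
  have hg₀1 : g * h₀ ≠ 1 := by simpa using hg₀ 1 H.one_mem
  -- The ultrametric inequality, applied to $gh_0\cdot h$ and to $(gh_0)^{-1}\cdot gh_0h$, combines
  -- with the maximality of $h_0$ to give equality, including when $j(h)=j(gh_0)$.
  have key : ∀ h ∈ H, j (g * h₀ * h) = cap j h (j (g * h₀)) := by
    intro h hh
    unfold cap
    split_ifs with h1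
    · rw [h1, mul_one]
    · have hle : j (g * h₀ * h) ≤ j (g * h₀) := by
        rw [mul_assoc]
        exact hmax _ (H.mul_mem hh₀ hh)
      have hge := hj.mul _ _ hg₀1 h1 (hg₀ h hh)
      have hh2 := hj.mul (g * h₀)⁻¹ (g * h₀ * h) (inv_ne_one.2 hg₀1) (hg₀ h hh)
        (by rwa [inv_mul_cancel_left])
      rw [hj.inv, inv_mul_cancel_left] at hh2
      rcases lt_or_ge (j h) (j (g * h₀)) with hlt | hge'
      · rw [min_eq_left hlt.le]
        rcases min_le_iff.1 hh2 with h3 | h3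
        · exact absurd h3 (not_le.2 hlt)
        · exact le_antisymm h3 (by rwa [min_eq_right hlt.le] at hge)
      · rw [min_eq_right hge']
        exact le_antisymm hle (by rwa [min_eq_left hge'] at hge)
  have hre : ∀ f : G → ℝ, ∑ h with h ∈ H, f (g * h) = ∑ h with h ∈ H, f (g * h₀ * h) := by
    intro f
    rw [← sum_subgroup_mul_left H hh₀ (fun h => f (g * h))]
    simp only [mul_assoc]
  refine ⟨h₀, hh₀, hmax, ?_, fun s => ?_⟩
  · rw [hre]
    exact sum_congr rfl fun h hh => key h (by simpa using hh)
  · rw [hre fun x => min (j x) s, ← (Phi_mono H).map_min]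
    refine sum_congr rfl fun h hh => ?_
    rw [key h (by simpa using hh)]
    unfold cap
    split_ifs
    · rfl
    · rw [min_assoc]

/-- The Herbrand functions of a subgroup `H' ≤ H` such that the sum of `j` is the same on all
cosets `g H'`, `g ∈ H \ H'`. -/
theorem IsRamFun.Phi_step (hj : IsRamFun j) {H' H : Subgroup G} (hH : H' ≤ H) {d : ℕ}
    (hcard : Nat.card H = d * Nat.card H') {j₀ : ℝ}
    (hj₀ : ∀ g ∈ H, g ∉ H' → ∑ h with h ∈ H', j (g * h) = j₀) (s : ℝ) :
    Phi j H s = Phi j H' s + ((d : ℝ) - 1) * min j₀ (Phi j H' s) := by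
  have hc : ∀ S : Subgroup G, ((univ.filter (· ∈ S)).card : ℝ) = Nat.card S := by
    intro S
    rw [Nat.card_eq_fintype_card, Fintype.card_subtype]
  have hpos : (0 : ℝ) < Nat.card H' := by exact_mod_cast Nat.card_pos
  have hsplit : Phi j H s = Phi j H' s + ∑ g with g ∈ H ∧ g ∉ H', min (j g) s := by
    unfold Phi
    rw [← sum_filter_add_sum_filter_not (univ.filter (· ∈ H)) (· ∈ H'), filter_filter,
      filter_filter]
    congr 1
    · refine sum_congr ?_ fun _ _ => rfl
      ext g
      simp only [mem_filter, mem_univ, true_and]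
      exact ⟨fun h => h.2, fun h => ⟨hH h, h⟩⟩
    · refine sum_congr rfl fun g hg => ?_
      simp only [mem_filter, mem_univ, true_and] at hg
      rw [cap, if_neg]
      rintro rfl
      exact hg.2 H'.one_mem
  -- The double sum is evaluated twice: here by right translation by each $h\in H'$, and in `hT'`
  -- coset by coset, where each inner sum is $\min(j_0,\Phi_{H'}(s))$.
  have hT : ∑ g with g ∈ H ∧ g ∉ H', ∑ h with h ∈ H', min (j (g * h)) s =
      Nat.card H' * ∑ g with g ∈ H ∧ g ∉ H', min (j g) s := by
    rw [sum_comm, ← hc H', ← nsmul_eq_mul, ← sum_const]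
    refine sum_congr rfl fun h hh => ?_
    have hh' : h ∈ H' := by simpa using hh
    refine sum_bij (fun g _ => g * h) ?_ ?_ ?_ ?_
    · intro g hg
      simp only [mem_filter, mem_univ, true_and] at hg ⊢
      rw [H.mul_mem_cancel_right (hH hh'), H'.mul_mem_cancel_right hh']
      exact hg
    · intro a _ b _ hab
      exact mul_right_cancel hab
    · intro b hb
      simp only [mem_filter, mem_univ, true_and] at hb
      refine ⟨b * h⁻¹, ?_, by simp⟩
      simp only [mem_filter, mem_univ, true_and]
      rw [H.mul_mem_cancel_right (H.inv_mem (hH hh')), H'.mul_mem_cancel_right (H'.inv_mem hh')]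
      exact hb
    · intro _ _
      rfl
  have hT' : ∑ g with g ∈ H ∧ g ∉ H', ∑ h with h ∈ H', min (j (g * h)) s =
      ((d : ℝ) - 1) * Nat.card H' * min j₀ (Phi j H' s) := by
    have : ∀ g ∈ univ.filter (fun g => g ∈ H ∧ g ∉ H'), ∑ h with h ∈ H', min (j (g * h)) s =
        min j₀ (Phi j H' s) := by
      intro g hg
      simp only [mem_filter, mem_univ, true_and] at hg
      obtain ⟨h₀, _, _, h1, h2⟩ := hj.exists_max_coset H' hg.2
      rw [h2, ← h1, hj₀ g hg.1 hg.2]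
    rw [sum_congr rfl this, sum_const, nsmul_eq_mul]
    congr 1
    have h1 : (univ.filter fun g => g ∈ H ∧ g ∉ H') =
        (univ.filter (· ∈ H)) \ (univ.filter (· ∈ H')) := by
      ext g
      simp
    rw [h1, cast_card_sdiff (by intro g; simpa using fun h => hH h), hc, hc, hcard]
    push_cast
    ring
  rw [hsplit]
  congr 1
  have := hT.symm.trans hT'
  refine mul_left_cancel₀ hpos.ne' (this.trans ?_)
  ring

/-- The coset sum $j_0$ is $\Phi_{H'}$ at the largest value of $j$ on $gH'$, and $\Phi_{H'}$ is
increasing. -/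
theorem IsRamFun.Phi_step_le (hj : IsRamFun j) {H' H : Subgroup G} {j₀ : ℝ}
    (hj₀ : ∀ g ∈ H, g ∉ H' → ∑ h with h ∈ H', j (g * h) = j₀) {g : G} (hg : g ∈ H) (hg' : g ∉ H') :
    Phi j H' (j g) ≤ j₀ := by
  obtain ⟨h₀, _, h1, h2, _⟩ := hj.exists_max_coset H' hg'
  rw [← hj₀ g hg hg', h2]
  exact Phi_mono H' (by simpa using h1 1 H'.one_mem)

/-- The bound of `IsRamFun.Phi_step_le` is attained by an element with the largest $j$ in its coset.
-/
theorem IsRamFun.exists_Phi_step_eq (hj : IsRamFun j) {H' H : Subgroup G} (hH : H' ≤ H) {j₀ : ℝ}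
    (hj₀ : ∀ g ∈ H, g ∉ H' → ∑ h with h ∈ H', j (g * h) = j₀) (hne : H' ≠ H) :
    ∃ g ∈ H, g ∉ H' ∧ Phi j H' (j g) = j₀ := by
  obtain ⟨g, hg, hg'⟩ := SetLike.exists_of_lt (lt_of_le_of_ne hH hne)
  obtain ⟨h₀, hh₀, _, h2, _⟩ := hj.exists_max_coset H' hg'
  refine ⟨g * h₀, H.mul_mem hg (hH hh₀), ?_, by rw [← h2, hj₀ g hg hg']⟩
  rwa [H'.mul_mem_cancel_right hh₀]

/-- If the subgroup `H` contains no nontrivial normal subgroup, then `j` attains its maximum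
outside of `H`. -/
theorem IsRamFun.exists_max_notMem (hj : IsRamFun j) {H : Subgroup G}
    (hH : ∀ Q : Subgroup G, Q.Normal → Q ≤ H → Q = ⊥) [Nontrivial G] :
    ∃ g ∉ H, ∀ x, x ≠ 1 → j x ≤ j g := by
  obtain ⟨x₁, hx₁⟩ := exists_ne (1 : G)
  obtain ⟨x₀, hx₀, hmax⟩ := exists_max_image (univ.filter (fun x : G => x ≠ 1)) j
    ⟨x₁, by simpa using hx₁⟩
  simp only [mem_filter, mem_univ, true_and] at hx₀ hmax
  -- This is the last nontrivial ramification group. It is normal because $j$ is conjugation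
  -- invariant, so it is not contained in $H$.
  let Q : Subgroup G :=
    { carrier := {x | x = 1 ∨ j x₀ ≤ j x}
      one_mem' := Or.inl rfl
      inv_mem' := by
        rintro x (rfl | h)
        · left; simp
        · right; rwa [hj.inv]
      mul_mem' := by
        rintro x y hx hy
        by_cases hx1 : x = 1
        · simpa [hx1] using hy
        by_cases hy1 : y = 1
        · simpa [hy1] using hx
        by_cases hxy : x * y = 1
        · exact Or.inl hxy
        · right
          exact (le_min (hx.resolve_left hx1) (hy.resolve_left hy1)).trans (hj.mul x y hx1 hy1 hxy) }
  have hQ : Q.Normal := ⟨by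
    rintro x (rfl | h) y
    · left; simp
    · right; rwa [hj.conj]⟩
  have hx₀Q : x₀ ∈ Q := Or.inr le_rfl
  have hne : ¬ Q ≤ H := by
    intro h
    rw [hH Q hQ h] at hx₀Q
    exact hx₀ hx₀Q
  obtain ⟨g, hgQ, hg⟩ := SetLike.not_le_iff_exists.1 hne
  refine ⟨g, hg, fun x hx => (hmax x hx).trans (hgQ.resolve_left ?_)⟩
  rintro rfl
  exact hg H.one_mem

end RamificationFunction

end RamificationConductor

end

noncomputable section

namespace RamificationConductor

/-! ### Totally ramified extensions and movements of uniformizers -/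

section TotallyRamified

open Module

/-- `w` is a discrete valuation of `N`, invariant under the automorphisms over `F`, for which all
intermediate fields `M` are totally ramified over `F`, `e` being the value of a uniformizer
of `F`. -/
structure IsTotRam (F N : Type*) [Field F] [Field N] [Algebra F N]
    (w : AddValuation N (WithTop ℝ)) (e : ℝ) : Prop where
  pos : 0 < e
  map_apply : ∀ (g : N ≃ₐ[F] N) (x : N), w (g x) = w x
  exists_int : ∀ (M : IntermediateField F N), ∀ x ∈ M, x ≠ 0 →
    ∃ z : ℤ, w x = ((z * (e / finrank F M) : ℝ) : WithTop ℝ)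
  exists_unif : ∀ M : IntermediateField F N, ∃ x ∈ M, w x = ((e / finrank F M : ℝ) : WithTop ℝ)
  exists_residue : ∀ x : N, 0 ≤ w x → ∃ a : F, 0 < w (x - algebraMap F N a)

section Concrete

open IsLocalRing

variable (A : Type*) [CommRing A] [IsDomain A] [IsDiscreteValuationRing A]
  [IsAdicComplete (maximalIdeal A) A] [IsAlgClosed (ResidueField A)]
  (K : Type*) [Field K] [CharZero K] [Algebra A K] [IsFractionRing A K]
  (F N : Type*) [Field F] [Field N] [Algebra K F] [Algebra A F]
  [FiniteDimensional K F] [Algebra F N] [Algebra K N] [Algebra A N] [IsScalarTower A K N]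
  [IsScalarTower K F N] [IsScalarTower A F N] [FiniteDimensional K N]

theorem isTotRam_ramVal : IsTotRam F N (ramVal A K N) (finrank K F : ℝ)⁻¹ := by
  have hM : ∀ M : IntermediateField F N, FiniteDimensional K M ∧ IsScalarTower A K M ∧
      ((finrank K F : ℝ)⁻¹ / finrank F M = (finrank K M : ℝ)⁻¹) ∧ IsScalarTower A M N := by
    intro M
    have : FiniteDimensional K M := FiniteDimensional.left K M N
    have : IsScalarTower A K M := IsScalarTower.of_algebraMap_eq fun a => Subtype.ext
      (IsScalarTower.algebraMap_apply A K N a)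
    refine ⟨inferInstance, inferInstance, ?_, IsScalarTower.of_algebraMap_eq fun a => rfl⟩
    rw [← finrank_mul_finrank K F M]
    push_cast
    rw [mul_inv, div_eq_mul_inv]
  refine ⟨finrank_inv_pos K, fun g x => ?_, fun M x hx hx0 => ?_, fun M => ?_, fun x hx => ?_⟩
  · exact ramVal_map A K (g.restrictScalars A).toAlgHom x
  · obtain ⟨h1, h2, h3, h4⟩ := hM M
    obtain ⟨n, hn⟩ := exists_ramVal_eq A K (E := M) (x := ⟨x, hx⟩)
      (fun h => hx0 (congrArg Subtype.val h))
    refine ⟨n, ?_⟩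
    rw [h3, ← hn, ← ramVal_map A K (IsScalarTower.toAlgHom A M N)]
    rfl
  · obtain ⟨h1, h2, h3, h4⟩ := hM M
    obtain ⟨x, hx⟩ := exists_ramVal_eq_finrank_inv A K M
    refine ⟨x, x.2, ?_⟩
    rw [h3, ← hx, ← ramVal_map A K (IsScalarTower.toAlgHom A M N)]
    rfl
  · obtain ⟨a, ha⟩ := exists_pos_ramVal_sub A K hx
    exact ⟨algebraMap A F a, by rwa [← IsScalarTower.algebraMap_apply]⟩

end Concrete

variable {F N : Type*} [Field F] [Field N] [Algebra F N]
    {w : AddValuation N (WithTop ℝ)} {e : ℝ}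

theorem exists_coe_eq (w : AddValuation N (WithTop ℝ)) {x : N} (hx : x ≠ 0) :
    ∃ r : ℝ, w x = r := by
  obtain ⟨r, hr⟩ := WithTop.ne_top_iff_exists.1 ((AddValuation.ne_top_iff w).2 hx)
  exact ⟨r, hr.symm⟩

variable [FiniteDimensional F N]

theorem IsTotRam.div_pos (h : IsTotRam F N w e) (M : IntermediateField F N) :
    0 < e / finrank F M := by
  have : 0 < finrank F M := finrank_pos
  have := h.pos
  positivity

theorem IsTotRam.le_of_pos (h : IsTotRam F N w e) {M : IntermediateField F N} {x : N} (hx : x ∈ M)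
    (hpos : 0 < w x) : ((e / finrank F M : ℝ) : WithTop ℝ) ≤ w x := by
  rcases eq_or_ne x 0 with rfl | hx0
  · simp
  obtain ⟨z, hz⟩ := h.exists_int M x hx hx0
  rw [hz] at hpos ⊢
  have he := h.div_pos M
  have hz0 : 0 < (z : ℝ) * (e / finrank F M) := by exact_mod_cast hpos
  have hz1 : 0 < z := by exact_mod_cast (pos_iff_pos_of_mul_pos hz0).2 he
  have hz2 : (1 : ℝ) ≤ z := by exact_mod_cast hz1
  rw [WithTop.coe_le_coe]
  nlinarith

/-- Automorphisms move no integer of `M` more than a uniformizer. -/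
theorem IsTotRam.le_map_sub (h : IsTotRam F N w e) {M : IntermediateField F N} {π : N}
    (hπM : π ∈ M) (hπ : w π = ((e / finrank F M : ℝ) : WithTop ℝ)) (g : N ≃ₐ[F] N) {x : N}
    (hx : x ∈ M) (hx0 : 0 ≤ w x) : w (g π - π) ≤ w (g x - x) := by
  have he := h.div_pos M
  have hπ0 : π ≠ 0 := by
    rintro rfl
    simp at hπ
  -- Write $x=a+\pi y$ with $a\in F$ fixed by $g$; then $gx-x=(g\pi-\pi)\,gy+\pi(gy-y)$, and each
  -- round of the induction gains the value of $\pi$. A large $n$ leaves only the bound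
  -- $w(g\pi-\pi)$.
  have key : ∀ n : ℕ, ∀ x ∈ M, 0 ≤ w x →
      min (w (g π - π)) ((n * (e / finrank F M) : ℝ) : WithTop ℝ) ≤ w (g x - x) := by
    intro n
    induction n with
    | zero =>
      intro x _ hx0
      refine (min_le_right _ _).trans ?_
      simpa using w.map_le_sub (by rw [h.map_apply]; exact hx0) hx0
    | succ n ih =>
      intro x hx hx0
      obtain ⟨a, ha⟩ := h.exists_residue x hx0
      have hxa : x - algebraMap F N a ∈ M := M.sub_mem hx (M.algebraMap_mem a)
      have hy : (x - algebraMap F N a) / π ∈ M := M.div_mem hxa hπM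
      obtain ⟨y, hydef⟩ : ∃ y, y = (x - algebraMap F N a) / π := ⟨_, rfl⟩
      rw [← hydef] at hy
      have hxy : x - algebraMap F N a = π * y := by rw [hydef]; field_simp
      have hy0 : 0 ≤ w y := by
        have h1 := h.le_of_pos hxa ha
        rw [hxy, AddValuation.map_mul, hπ] at h1
        cases hwy : w y with
        | top => simp
        | coe r =>
          rw [hwy, ← WithTop.coe_add, WithTop.coe_le_coe] at h1
          exact_mod_cast (by linarith : (0 : ℝ) ≤ r)
      have hgx : g x - x = (g π - π) * g y + π * (g y - y) := by
        have h1 : x = algebraMap F N a + π * y := by rw [← hxy]; ring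
        rw [h1, map_add, map_mul, g.commutes]
        ring
      rw [hgx]
      refine w.map_le_add ?_ ?_
      · rw [AddValuation.map_mul, h.map_apply]
        exact (min_le_left _ _).trans (le_add_of_nonneg_right hy0)
      · rw [AddValuation.map_mul, hπ]
        have h1 := ih y hy hy0
        have h2 : min (w (g π - π)) (((n + 1 : ℕ) * (e / finrank F M) : ℝ) : WithTop ℝ) ≤
            ((e / finrank F M : ℝ) : WithTop ℝ) +
              min (w (g π - π)) ((n * (e / finrank F M) : ℝ) : WithTop ℝ) := by
          rcases min_choice (w (g π - π)) ((n * (e / finrank F M) : ℝ) : WithTop ℝ) with h3 | h3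
          · rw [h3]
            exact (min_le_left _ _).trans (le_add_of_nonneg_left (by exact_mod_cast he.le))
          · rw [h3]
            refine (min_le_right _ _).trans ?_
            rw [← WithTop.coe_add, WithTop.coe_le_coe]
            push_cast
            linarith
        exact h2.trans (by gcongr)
  cases hr : w (g x - x) with
  | top => exact le_top
  | coe r =>
    obtain ⟨n, hn⟩ := exists_nat_gt (r / (e / finrank F M))
    have h1 := key n x hx hx0
    rw [hr] at h1
    rcases min_le_iff.1 h1 with h2 | h2
    · exact h2
    · rw [div_lt_iff₀ he] at hn
      rw [WithTop.coe_le_coe] at h2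
      linarith

theorem IsTotRam.map_sub_eq (h : IsTotRam F N w e) {M : IntermediateField F N} {π π' : N}
    (hπM : π ∈ M) (hπ : w π = ((e / finrank F M : ℝ) : WithTop ℝ))
    (hπM' : π' ∈ M) (hπ' : w π' = ((e / finrank F M : ℝ) : WithTop ℝ)) (g : N ≃ₐ[F] N) :
    w (g π - π) = w (g π' - π') := by
  have he := h.div_pos M
  refine le_antisymm (h.le_map_sub hπM hπ g hπM' ?_) (h.le_map_sub hπM' hπ' g hπM ?_)
  · rw [hπ']; exact_mod_cast he.le
  · rw [hπ]; exact_mod_cast he.le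

/-- Integers of $M$ move no more than $\pi$ does, so fixing $\pi$ fixes them all; a nonintegral
element is the inverse of an integral one. -/
theorem IsTotRam.mem_fixingSubgroup_iff (h : IsTotRam F N w e) {M : IntermediateField F N} {π : N}
    (hπM : π ∈ M) (hπ : w π = ((e / finrank F M : ℝ) : WithTop ℝ)) (g : N ≃ₐ[F] N) :
    g ∈ M.fixingSubgroup ↔ g π = π := by
  rw [IntermediateField.mem_fixingSubgroup_iff]
  refine ⟨fun hg => hg π hπM, fun hg => ?_⟩
  have h1 : ∀ x ∈ M, 0 ≤ w x → g x = x := by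
    intro x hx hx0
    have := h.le_map_sub hπM hπ g hx hx0
    rw [hg, sub_self, AddValuation.map_zero, top_le_iff, AddValuation.top_iff] at this
    exact sub_eq_zero.1 this
  intro x hx
  rcases le_total 0 (w x) with hx0 | hx0
  · exact h1 x hx hx0
  · have h2 := h1 x⁻¹ (M.inv_mem hx) (by
      rcases eq_or_ne x 0 with rfl | hne
      · simp
      obtain ⟨r, hr⟩ := exists_coe_eq w hne
      rw [AddValuation.map_inv, hr]
      rw [hr] at hx0
      have : r ≤ 0 := by exact_mod_cast hx0
      exact_mod_cast (neg_nonneg.2 this))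
    rw [map_inv₀] at h2
    exact inv_injective h2

end TotallyRamified

end RamificationConductor

end

noncomputable section

namespace RamificationConductor

/-! ### Movements in subextensions as coset sums -/

section Herbrand

set_option linter.unusedSectionVars false

open Module Finset
open scoped Classical

variable {F N : Type*} [Field F] [Field N] [Algebra F N] [FiniteDimensional F N]
    {w : AddValuation N (WithTop ℝ)} {e : ℝ}

/-- `g ↦ w (g π - π)`, with the value `0` at the elements fixing `π`. -/
def ramFun (w : AddValuation N (WithTop ℝ)) (π : N) (g : N ≃ₐ[F] N) : ℝ := (w (g π - π)).untopD 0

theorem map_prod_coe (w : AddValuation N (WithTop ℝ)) {ι : Type*} (s : Finset ι) {f : ι → N}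
    {r : ι → ℝ} (h : ∀ i ∈ s, w (f i) = r i) : w (∏ i ∈ s, f i) = ((∑ i ∈ s, r i : ℝ) : WithTop ℝ) := by
  induction s using Finset.induction_on with
  | empty => simp
  | insert a s ha ih =>
    rw [prod_insert ha, sum_insert ha, AddValuation.map_mul, h a (mem_insert_self _ _),
      ih fun i hi => h i (mem_insert_of_mem hi)]
    rfl

theorem nonneg_coeff_prod (w : AddValuation N (WithTop ℝ)) {ι : Type*} (s : Finset ι) {f : ι → N}
    (h : ∀ i ∈ s, 0 ≤ w (f i)) (n : ℕ) :
    0 ≤ w ((∏ i ∈ s, (Polynomial.X - Polynomial.C (f i))).coeff n) := by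
  have := Finset.prod_induction (fun i => Polynomial.X - Polynomial.C (f i))
    (fun P : Polynomial N => ∀ n, 0 ≤ w (P.coeff n)) (s := s) ?_ ?_ ?_
  · exact this n
  · intro P Q hP hQ n
    rw [Polynomial.coeff_mul]
    refine w.map_le_sum fun i _ => ?_
    rw [AddValuation.map_mul]
    exact add_nonneg (hP _) (hQ _)
  · intro n
    rw [Polynomial.coeff_one]
    split_ifs <;> simp
  · intro i hi n
    rw [Polynomial.coeff_sub, Polynomial.coeff_X, Polynomial.coeff_C]
    refine w.map_le_sub ?_ ?_
    · split_ifs <;> simp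
    · split_ifs
      · exact h i hi
      · simp

theorem le_map_eval (w : AddValuation N (WithTop ℝ)) {J : WithTop ℝ} {P : Polynomial N}
    (hP : ∀ n, J ≤ w (P.coeff n)) {x : N} (hx : 0 ≤ w x) : J ≤ w (P.eval x) := by
  rw [Polynomial.eval_eq_sum_range]
  refine w.map_le_sum fun i _ => ?_
  rw [AddValuation.map_mul, AddValuation.map_pow]
  exact (hP i).trans (le_add_of_nonneg_right (nsmul_nonneg hx _))

section Uniformizer

variable (h : IsTotRam F N w e) {π : N} (hπ : w π = ((e / finrank F N : ℝ) : WithTop ℝ))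

theorem map_eq_div_finrank_top (hπ : w π = ((e / finrank F N : ℝ) : WithTop ℝ)) :
    w π = ((e / finrank F (⊤ : IntermediateField F N) : ℝ) : WithTop ℝ) := by
  rw [hπ, IntermediateField.finrank_top']

include h hπ

theorem IsTotRam.apply_ne {g : N ≃ₐ[F] N} (hg : g ≠ 1) : g π ≠ π := by
  intro hgπ
  have := (h.mem_fixingSubgroup_iff (M := ⊤) trivial (map_eq_div_finrank_top hπ) g).2 hgπ
  rw [IntermediateField.fixingSubgroup_top, Subgroup.mem_bot] at this
  exact hg this

theorem IsTotRam.map_sub_eq_ramFun {g : N ≃ₐ[F] N} (hg : g ≠ 1) :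
    w (g π - π) = (ramFun w π g : ℝ) := by
  obtain ⟨r, hr⟩ := exists_coe_eq w (sub_ne_zero.2 (h.apply_ne hπ hg))
  rw [ramFun, hr]
  rfl

theorem IsTotRam.div_finrank_le_ramFun {g : N ≃ₐ[F] N} (hg : g ≠ 1) :
    e / finrank F N ≤ ramFun w π g := by
  rw [← WithTop.coe_le_coe, ← h.map_sub_eq_ramFun hπ hg, ← hπ]
  exact w.map_le_sub (h.map_apply g π).ge le_rfl

/-- The ultrametric inequality and the invariance of $w$ give the first two properties. Conjugation
by $x$ replaces $\pi$ by the uniformizer $x^{-1}\pi$, which moves equally. -/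
theorem IsTotRam.isRamFun : IsRamFun (ramFun (F := F) w π) := by
  refine ⟨fun g g' hg hg' hgg' => ?_, fun g => ?_, fun g x => ?_⟩
  · rw [← WithTop.coe_le_coe, WithTop.coe_min, ← h.map_sub_eq_ramFun hπ hg,
      ← h.map_sub_eq_ramFun hπ hg', ← h.map_sub_eq_ramFun hπ hgg']
    have : (g * g') π - π = (g π - π) + g (g' π - π) := by
      rw [map_sub, AlgEquiv.mul_apply]
      ring
    rw [this, ← h.map_apply g (g' π - π)]
    exact w.map_add _ _
  · unfold ramFun
    rw [← h.map_apply g (g⁻¹ π - π), map_sub, w.map_sub_swap]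
    congr 3
    rw [← AlgEquiv.mul_apply, mul_inv_cancel, AlgEquiv.one_apply]
  · unfold ramFun
    have h1 : (x * g * x⁻¹) π - π = x (g (x⁻¹ π) - x⁻¹ π) := by
      rw [map_sub, AlgEquiv.mul_apply, AlgEquiv.mul_apply]
      congr 1
      rw [← AlgEquiv.mul_apply x, mul_inv_cancel, AlgEquiv.one_apply]
    rw [h1, h.map_apply]
    congr 1
    refine h.map_sub_eq (M := ⊤) trivial ?_ trivial (map_eq_div_finrank_top hπ) g
    rw [h.map_apply]
    exact map_eq_div_finrank_top hπ

/-- The movement of a uniformizer of an intermediate field `M` is the sum of the movements of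
a uniformizer of `N` over a coset of `Gal(N/M)`. -/
theorem IsTotRam.map_sub_eq_sum [IsGalois F N] {M : IntermediateField F N} {ϖ : N}
    (hϖM : ϖ ∈ M) (hϖ : w ϖ = ((e / finrank F M : ℝ) : WithTop ℝ)) {g : N ≃ₐ[F] N}
    (hg : g ∉ M.fixingSubgroup) :
    w (g ϖ - ϖ) = ((∑ x with x ∈ M.fixingSubgroup, ramFun w π (g * x) : ℝ) : WithTop ℝ) := by
  -- $P$ is the characteristic polynomial of $\pi$ over $M$. Its constant term is a uniformizer of
  -- $M$, and $P(\pi)=0$, so $(gP-P)(\pi)=\prod_x(\pi-gx\pi)$ has the coset sum as its value.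
  obtain ⟨P, hPdef⟩ : ∃ P : Polynomial N,
    P = ∏ x with x ∈ M.fixingSubgroup, (Polynomial.X - Polynomial.C (x π)) := ⟨_, rfl⟩
  have hepos : 0 < e / finrank F N := by
    have := h.div_pos ⊤
    rwa [IntermediateField.finrank_top'] at this
  have hπ0 : 0 ≤ w π := by
    rw [hπ]
    exact_mod_cast hepos.le
  have hcoeffM : ∀ n, P.coeff n ∈ M := by
    intro n
    rw [← IsGalois.fixedField_fixingSubgroup M, IntermediateField.mem_fixedField_iff]
    intro σ hσ
    have hmap : P.map (σ : N →+* N) = P := by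
      rw [hPdef, Polynomial.map_prod]
      refine prod_bij (fun x _ => σ * x) ?_ ?_ ?_ ?_
      · intro x hx
        simp only [mem_filter, mem_univ, true_and] at hx ⊢
        exact M.fixingSubgroup.mul_mem hσ hx
      · intro a _ b _ hab
        exact mul_left_cancel hab
      · intro b hb
        simp only [mem_filter, mem_univ, true_and] at hb
        refine ⟨σ⁻¹ * b, ?_, by simp⟩
        simp only [mem_filter, mem_univ, true_and]
        exact M.fixingSubgroup.mul_mem (M.fixingSubgroup.inv_mem hσ) hb
      · intro x _
        simp
    calc σ (P.coeff n) = (P.map (σ : N →+* N)).coeff n := by simp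
      _ = P.coeff n := by rw [hmap]
  have hcoeff0 : ∀ n, 0 ≤ w (P.coeff n) := by
    intro n
    rw [hPdef]
    exact nonneg_coeff_prod w _ (fun x _ => by rw [h.map_apply]; exact hπ0) n
  have hconst : w (P.coeff 0) = ((e / finrank F M : ℝ) : WithTop ℝ) := by
    rw [Polynomial.coeff_zero_eq_eval_zero, hPdef, Polynomial.eval_prod]
    refine (map_prod_coe w _ (r := fun _ => e / finrank F N) fun x _ => ?_).trans ?_
    · simp [h.map_apply, hπ]
    · rw [sum_const, nsmul_eq_mul]
      have h1 : (univ.filter (· ∈ M.fixingSubgroup)).card = finrank M N := by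
        rw [← IsGalois.card_fixingSubgroup_eq_finrank M, Nat.card_eq_fintype_card,
          Fintype.card_subtype]
      have h2 : (finrank F M : ℝ) * finrank M N = finrank F N := by
        exact_mod_cast finrank_mul_finrank F M N
      have h3 : (finrank M N : ℝ) ≠ 0 := by exact_mod_cast (finrank_pos (R := M) (M := N)).ne'
      have h4 : (finrank F M : ℝ) ≠ 0 := by exact_mod_cast (finrank_pos (R := F) (M := M)).ne'
      rw [h1, ← h2]
      congr 1
      field_simp
  have hroot : P.eval π = 0 := by
    rw [hPdef, Polynomial.eval_prod]
    exact prod_eq_zero (i := 1) (by simp) (by simp)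
  obtain ⟨Q, hQdef⟩ : ∃ Q : Polynomial N, Q = P.map (g : N →+* N) - P := ⟨_, rfl⟩
  have hQcoeff : ∀ n, Q.coeff n = g (P.coeff n) - P.coeff n := by
    intro n
    simp [hQdef]
  have hQJ : ∀ n, w (g ϖ - ϖ) ≤ w (Q.coeff n) := by
    intro n
    rw [hQcoeff]
    exact h.le_map_sub hϖM hϖ g (hcoeffM n) (hcoeff0 n)
  have hQ0 : w (Q.coeff 0) = w (g ϖ - ϖ) := by
    rw [hQcoeff]
    exact h.map_sub_eq (hcoeffM 0) hconst hϖM hϖ g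
  have hgϖ : g ϖ - ϖ ≠ 0 := by
    rw [sub_ne_zero]
    exact fun h1 => hg ((h.mem_fixingSubgroup_iff hϖM hϖ g).2 h1)
  obtain ⟨J, hJ⟩ := exists_coe_eq w hgϖ
  -- The constant term of $gP-P$ has exactly the value of $g\varpi-\varpi$; the other coefficients
  -- have at least this value and come with a positive power of $\pi$, so the constant term
  -- dominates.
  have hQeval : w (Q.eval π) = w (g ϖ - ϖ) := by
    have h1 : Q.eval π = Q.coeff 0 + Q.divX.eval π * π := by
      conv_lhs => rw [← Polynomial.divX_mul_X_add Q]
      simp [add_comm]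
    have h2 : w (g ϖ - ϖ) ≤ w (Q.divX.eval π) := by
      refine le_map_eval w (fun n => ?_) hπ0
      rw [Polynomial.coeff_divX]
      exact hQJ _
    rw [h1, ← hQ0]
    refine w.map_add_eq_of_lt_left ?_
    rw [hQ0, AddValuation.map_mul, hπ]
    refine lt_of_lt_of_le ?_ (add_le_add_left h2 _)
    rw [hJ, ← WithTop.coe_add, WithTop.coe_lt_coe]
    linarith
  rw [← hQeval, hQdef, Polynomial.eval_sub, hroot, sub_zero, hPdef, Polynomial.map_prod,
    Polynomial.eval_prod]
  refine map_prod_coe w _ fun x hx => ?_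
  have hgx : g * x ≠ 1 := by
    intro h1
    simp only [mem_filter, mem_univ, true_and] at hx
    rw [mul_eq_one_iff_eq_inv] at h1
    exact hg (h1 ▸ M.fixingSubgroup.inv_mem hx)
  rw [← h.map_sub_eq_ramFun hπ hgx, w.map_sub_swap]
  simp

end Uniformizer

end Herbrand

end RamificationConductor

end

noncomputable section

namespace RamificationConductor

/-! ### The Herbrand function and the conductor in terms of movements -/

section Conductor

set_option linter.unusedSectionVars false

open Module Finset MeasureTheory
open scoped Classical

theorem intervalIntegral_ite_le {c u : ℝ} (hc : 0 ≤ c) (hu : 0 ≤ u) :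
    ∫ t in (0 : ℝ)..u, (if t ≤ c then (1 : ℝ) else 0) = min c u := by
  have h1 : (fun t : ℝ => if t ≤ c then (1 : ℝ) else 0) = (Set.Iic c).indicator fun _ => 1 := by
    ext t
    simp [Set.indicator_apply]
  rw [intervalIntegral.integral_of_le hu, h1, integral_indicator measurableSet_Iic,
    Measure.restrict_restrict measurableSet_Iic]
  have h2 : Set.Iic c ∩ Set.Ioc 0 u = Set.Ioc 0 (min c u) := by
    ext t
    simp only [Set.mem_inter_iff, Set.mem_Iic, Set.mem_Ioc, le_min_iff]
    tauto
  rw [h2]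
  simp [le_min hc hu]

theorem intervalIntegrable_ite_le (c a b : ℝ) :
    IntervalIntegrable (fun t : ℝ => if t ≤ c then (1 : ℝ) else 0) volume a b := by
  refine AntitoneOn.intervalIntegrable fun s _ t _ hst => ?_
  split_ifs with h1 h2
  · exact le_rfl
  · exact absurd (hst.trans h1) h2
  · exact zero_le_one
  · exact le_rfl

variable {A : Type*} [CommRing A] {F N : Type*} [Field F] [Field N] [Algebra A N] [Algebra F N]
  [FiniteDimensional F N] [IsGalois F N] {w : AddValuation N (WithTop ℝ)} {e : ℝ}
  (h : IsTotRam F N w e)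
  (hord : ∀ x, w x = (ord A N x).map fun n : ℤ => (n : ℝ) * (e / finrank F N))
  (hunif : ∀ π, IsUniformizer A N π → w π = ((e / finrank F N : ℝ) : WithTop ℝ))
  {π : N} (hπ : IsUniformizer A N π)

include h hord hunif hπ

/-- The identity is listed separately because `ramFun` takes the default value $0$ there instead of
infinity. -/
theorem IsTotRam.mem_lowerGroup_iff (i : ℝ) (g : N ≃ₐ[F] N) :
    g ∈ lowerGroup A N F i ↔ g = 1 ∨ (e / finrank F N) * (i + 1) ≤ ramFun w π g := by
  have hε : 0 < e / finrank F N := by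
    have := h.div_pos ⊤
    rwa [IntermediateField.finrank_top'] at this
  have hmem : ∀ x : N, ((i + 1 : ℝ) : WithTop ℝ) ≤ (ord A N x).map (fun n : ℤ => (n : ℝ)) ↔
      (((e / finrank F N) * (i + 1) : ℝ) : WithTop ℝ) ≤ w x := by
    intro x
    rw [hord]
    cases ord A N x with
    | top => simp
    | coe n =>
      rw [WithTop.map_coe, WithTop.map_coe, WithTop.coe_le_coe, WithTop.coe_le_coe, mul_comm,
        mul_le_mul_iff_left₀ hε]
  have hiff : g ∈ lowerGroup A N F i ↔
      (((e / finrank F N) * (i + 1) : ℝ) : WithTop ℝ) ≤ w (g π - π) := by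
    simp only [lowerGroup, Set.mem_ofPred_eq, hmem]
    refine ⟨fun h1 => h1 π hπ, fun h1 π' hπ' => ?_⟩
    rwa [h.map_sub_eq (M := ⊤) trivial (map_eq_div_finrank_top (hunif π' hπ')) trivial
      (map_eq_div_finrank_top (hunif π hπ)) g]
  rw [hiff]
  rcases eq_or_ne g 1 with rfl | hg
  · simp
  · rw [h.map_sub_eq_ramFun (hunif π hπ) hg, WithTop.coe_le_coe]
    simp [hg]

/-- With $\varepsilon=e/[N:F]$, an element $g\ne1$ belongs to $G_t$ exactly for $t\le
j(g)/\varepsilon-1$, so it contributes $\min(j(g),\varepsilon(u+1))/\varepsilon-1$ to the integral.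
Total ramification gives $|G_0|=[N:F]$, and $[N:F]\,\varepsilon=e$. -/
theorem IsTotRam.herbrandPhi_eq {u : ℝ} (hu : 0 ≤ u) :
    herbrandPhi A N F u = Phi (ramFun (F := F) w π) ⊤ (e / finrank F N * (u + 1)) / e - 1 := by
  obtain ⟨ε, hεdef⟩ : ∃ ε, ε = e / finrank F N := ⟨_, rfl⟩
  have hε : 0 < ε := by
    have := h.div_pos ⊤
    rwa [IntermediateField.finrank_top', ← hεdef] at this
  have hlow := h.mem_lowerGroup_iff hord hunif hπ
  rw [← hεdef] at hlow ⊢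
  have hn : (0 : ℝ) < finrank F N := by exact_mod_cast finrank_pos (R := F) (M := N)
  have hne : finrank F N * ε = e := by rw [hεdef]; field_simp
  have hjε : ∀ g : N ≃ₐ[F] N, g ≠ 1 → ε ≤ ramFun w π g := fun g hg => by
    rw [hεdef]
    exact h.div_finrank_le_ramFun (hunif π hπ) hg
  have hcardG : Fintype.card (N ≃ₐ[F] N) = finrank F N := by
    rw [← Nat.card_eq_fintype_card, IsGalois.card_aut_eq_finrank]
  have h0 : ((lowerGroup A N F 0).ncard : ℝ) = finrank F N := by
    have : lowerGroup A N F 0 = Set.univ := by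
      ext g
      rw [hlow]
      simp only [Set.mem_univ, iff_true]
      by_cases hg : g = 1
      · exact Or.inl hg
      · right; simpa using hjε g hg
    rw [this, Set.ncard_univ, Nat.card_eq_fintype_card, hcardG]
  let f : (N ≃ₐ[F] N) → ℝ → ℝ := fun g t =>
    if g = 1 then 1 else if t ≤ ramFun w π g / ε - 1 then 1 else 0
  have hcard : ∀ t, ((lowerGroup A N F t).ncard : ℝ) = ∑ g, f g t := by
    intro t
    have : lowerGroup A N F t =
        ((univ.filter fun g => g ∈ lowerGroup A N F t : Finset (N ≃ₐ[F] N)) : Set (N ≃ₐ[F] N)) := by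
      ext g
      simp
    rw [this, Set.ncard_coe_finset, Finset.card_filter]
    push_cast
    refine sum_congr rfl fun g _ => ?_
    simp only [f]
    rw [hlow]
    by_cases hg : g = 1
    · simp [hg]
    · have : ε * (t + 1) ≤ ramFun w π g ↔ t ≤ ramFun w π g / ε - 1 := by
        rw [le_sub_iff_add_le, le_div_iff₀ hε, mul_comm]
      simp [hg, this]
  have hint : ∀ g, IntervalIntegrable (f g) volume 0 u := by
    intro g
    by_cases hg : g = 1
    · simp [f, hg]
    · simp only [f, hg, if_false]
      exact intervalIntegrable_ite_le _ _ _
  have hval : ∀ g, ∫ t in (0 : ℝ)..u, f g t = cap (ramFun w π) g (ε * (u + 1)) / ε - 1 := by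
    intro g
    by_cases hg : g = 1
    · simp only [f, hg, if_true, cap]
      simp
      field_simp
      ring
    · simp only [f, hg, if_false, cap]
      have h1 : 0 ≤ ramFun w π g / ε - 1 := by
        rw [sub_nonneg, le_div_iff₀ hε, one_mul]
        exact hjε g hg
      rw [intervalIntegral_ite_le h1 hu, ← min_div_div_right hε.le, ← min_sub_sub_right]
      congr 1
      field_simp
      ring
  unfold herbrandPhi
  simp only [h0, hcard]
  rw [intervalIntegral.integral_div, intervalIntegral.integral_finsetSum fun g _ => hint g]
  simp only [hval]
  rw [sum_sub_distrib, ← sum_div]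
  have hPhi : Phi (ramFun (F := F) w π) ⊤ (ε * (u + 1)) = ∑ g : N ≃ₐ[F] N, cap (ramFun w π) g (ε * (u + 1)) := by
    simp [Phi]
  rw [hPhi, ← hne]
  simp only [sum_const, card_univ, hcardG, nsmul_eq_mul, mul_one]
  field_simp

/-- The conductor in terms of an automorphism moving a uniformizer as little as possible. -/
theorem IsTotRam.ramConductor_eq {g₀ : N ≃ₐ[F] N} (hg₀ : g₀ ≠ 1)
    (hmax : ∀ g : N ≃ₐ[F] N, g ≠ 1 → ramFun w π g ≤ ramFun w π g₀) :
    ramConductor A N F = Phi (ramFun (F := F) w π) ⊤ (ramFun w π g₀) / e - 1 := by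
  obtain ⟨ε, hεdef⟩ : ∃ ε, ε = e / finrank F N := ⟨_, rfl⟩
  have hε : 0 < ε := by
    have := h.div_pos ⊤
    rwa [IntermediateField.finrank_top', ← hεdef] at this
  have hlow := h.mem_lowerGroup_iff hord hunif hπ
  have hphi := fun {u : ℝ} hu => h.herbrandPhi_eq hord hunif hπ (u := u) hu
  rw [← hεdef] at hlow hphi
  have he := h.pos
  have hn : (0 : ℝ) < finrank F N := by exact_mod_cast finrank_pos (R := F) (M := N)
  have hne : finrank F N * ε = e := by rw [hεdef]; field_simp
  have hjε : ∀ g : N ≃ₐ[F] N, g ≠ 1 → ε ≤ ramFun w π g := fun g hg => by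
    rw [hεdef]
    exact h.div_finrank_le_ramFun (hunif π hπ) hg
  have hphi0 : herbrandPhi A N F 0 = 0 := by simp [herbrandPhi]
  -- `herbrandPsi` is a genuine right inverse only once $\phi$ is known to reach every $v\ge0$. The
  -- upper endpoint is large enough because the identity alone contributes $s$ to $\Phi(s)$.
  have hsurj : ∀ v, 0 ≤ v → ∃ u ∈ Set.Ici (0 : ℝ), herbrandPhi A N F u = v := by
    intro v hv
    have hU : 0 ≤ (v + 1) * e / ε := by positivity
    have hcont : ContinuousOn (herbrandPhi A N F) (Set.Icc 0 ((v + 1) * e / ε)) := by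
      have : ContinuousOn (fun u => Phi (ramFun (F := F) w π) ⊤ (ε * (u + 1)) / e - 1)
          (Set.Icc 0 ((v + 1) * e / ε)) := by
        refine Continuous.continuousOn ?_
        have hc : ∀ g : N ≃ₐ[F] N, Continuous (cap (ramFun w π) g) := by
          intro g
          unfold cap
          split_ifs
          · exact continuous_id
          · exact continuous_const.min continuous_id
        have : Continuous (Phi (ramFun (F := F) w π) ⊤) := continuous_finsetSum _ fun g _ => hc g
        fun_prop
      exact this.congr fun u hu => hphi hu.1
    have hbig : v ≤ herbrandPhi A N F ((v + 1) * e / ε) := by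
      rw [hphi hU]
      have h1 : ε * ((v + 1) * e / ε + 1) ≤
          Phi (ramFun (F := F) w π) ⊤ (ε * ((v + 1) * e / ε + 1)) := by
        have h2 : cap (ramFun (F := F) w π) 1 (ε * ((v + 1) * e / ε + 1)) ≤
            Phi (ramFun (F := F) w π) ⊤ (ε * ((v + 1) * e / ε + 1)) := by
          refine single_le_sum (f := fun g => cap (ramFun (F := F) w π) g _)
            (fun g _ => ?_) (by simp)
          unfold cap
          split_ifs with hg
          · positivity
          · exact le_min (hε.le.trans (hjε g hg)) (by positivity)
        simpa [cap] using h2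
      rw [le_sub_iff_add_le, le_div_iff₀ he]
      refine le_trans ?_ h1
      have : ε * ((v + 1) * e / ε + 1) = (v + 1) * e + ε := by field_simp
      rw [this]
      linarith
    obtain ⟨u, hu, huv⟩ := intermediate_value_Icc hU hcont ⟨by rw [hphi0]; exact hv, hbig⟩
    exact ⟨u, hu.1, huv⟩
  -- The group $G_u$ is nontrivial exactly when $\varepsilon(u+1)\le j(g_0)$; applying the strictly
  -- increasing $\Phi$ turns this into a bound on $i=\phi(u)$. The supremum is attained.
  have hset : {i : ℝ | 0 ≤ i ∧ upperGroup A N F i ≠ {1}} =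
      Set.Icc 0 (Phi (ramFun (F := F) w π) ⊤ (ramFun w π g₀) / e - 1) := by
    ext i
    simp only [Set.mem_ofPred_eq, Set.mem_Icc]
    refine and_congr_right fun hi => ?_
    obtain ⟨hu0, hui⟩ := Function.invFunOn_pos (hsurj i hi)
    change herbrandPsi A N F i ∈ _ at hu0
    change herbrandPhi A N F (herbrandPsi A N F i) = i at hui
    unfold upperGroup
    obtain ⟨u, hudef⟩ : ∃ u, u = herbrandPsi A N F i := ⟨_, rfl⟩
    rw [← hudef] at hu0 hui ⊢
    have h1 : lowerGroup A N F u ≠ {1} ↔ ε * (u + 1) ≤ ramFun w π g₀ := by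
      constructor
      · intro hne1
        by_contra! hlt
        refine hne1 (Set.eq_singleton_iff_unique_mem.2 ⟨(hlow u 1).2 (Or.inl rfl), fun g hg => ?_⟩)
        by_contra hg1
        have h2 := ((hlow u g).1 hg).resolve_left hg1
        linarith [hmax g hg1]
      · intro hle heq
        have h2 : g₀ ∈ lowerGroup A N F u := (hlow u g₀).2 (Or.inr hle)
        rw [heq] at h2
        exact hg₀ h2
    rw [h1, ← (Phi_strictMono (j := ramFun (F := F) w π) ⊤).le_iff_le, ← hui, hphi hu0,
      sub_le_sub_iff_right, div_le_div_iff_of_pos_right he]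
  have hnonneg : 0 ≤ Phi (ramFun (F := F) w π) ⊤ (ramFun w π g₀) / e - 1 := by
    rw [← hphi0, hphi le_rfl, sub_le_sub_iff_right, div_le_div_iff_of_pos_right he]
    refine Phi_mono ⊤ ?_
    simpa using hjε g₀ hg₀
  rw [ramConductor, hset, csSup_Icc hnonneg]

end Conductor

end RamificationConductor

end

noncomputable section

namespace RamificationConductor

/-! ### Values of roots of unity and of $p$-th roots -/

section Kummer

open Module Finset
open scoped Classical IntermediateField

section Valuation

variable {N : Type*} [Field N] (w : AddValuation N (WithTop ℝ))

theorem map_natCast_nonneg (n : ℕ) : 0 ≤ w (n : N) := by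
  induction n with
  | zero => simp
  | succ n ih =>
    rw [Nat.cast_succ]
    exact w.map_le_add ih (by simp)

theorem map_natCast_eq_zero {p : ℕ} (hp : p.Prime) (hwp : 0 < w (p : N)) {n : ℕ} (hn : ¬ p ∣ n) :
    w (n : N) = 0 := by
  refine le_antisymm ?_ (map_natCast_nonneg w n)
  have hcop : IsCoprime (n : ℤ) (p : ℤ) := by
    rw [Nat.isCoprime_iff_coprime]
    exact ((Nat.Prime.coprime_iff_not_dvd hp).2 hn).symm
  obtain ⟨u, v, huv⟩ := hcop
  have hint : ∀ z : ℤ, 0 ≤ w (z : N) := by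
    intro z
    obtain ⟨m, rfl | rfl⟩ := z.eq_nat_or_neg
    · simpa using map_natCast_nonneg w m
    · simpa using map_natCast_nonneg w m
  by_contra! hlt
  have h1 : (0 : WithTop ℝ) < w (((u * n + v * p : ℤ)) : N) := by
    push_cast
    refine w.map_lt_add ?_ ?_
    · rw [AddValuation.map_mul, add_comm]
      exact add_pos_of_pos_of_nonneg hlt (hint u)
    · rw [AddValuation.map_mul, add_comm]
      exact add_pos_of_pos_of_nonneg hwp (hint v)
  rw [huv] at h1
  simp at h1

theorem le_map_one_add_pow_sub_one {η : N} (hη : 0 ≤ w η) (n : ℕ) :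
    w η ≤ w ((1 + η) ^ n - 1) := by
  have h1 : 0 ≤ w (1 + η) := w.map_le_add (by simp) hη
  have h2 : (1 + η) ^ n - 1 = η * ∑ i ∈ range n, (1 + η) ^ i := by
    rw [← mul_geom_sum, add_sub_cancel_left]
  rw [h2, AddValuation.map_mul]
  refine le_add_of_nonneg_right (w.map_le_sum fun i _ => ?_)
  rw [AddValuation.map_pow]
  exact nsmul_nonneg h1 _

/-- In $(1+\eta)^n-1=\eta\sum_{i<n}(1+\eta)^i$ the sum is congruent to $n$, a unit. -/
theorem map_one_add_pow_sub_one {p : ℕ} (hp : p.Prime) (hwp : 0 < w (p : N)) {η : N}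
    (hη : 0 < w η) {n : ℕ} (hn : ¬ p ∣ n) : w ((1 + η) ^ n - 1) = w η := by
  have h2 : (1 + η) ^ n - 1 = η * ∑ i ∈ range n, (1 + η) ^ i := by
    rw [← mul_geom_sum, add_sub_cancel_left]
  have h3 : ∑ i ∈ range n, (1 + η) ^ i = n + ∑ i ∈ range n, ((1 + η) ^ i - 1) := by
    simp
  have h4 : w (∑ i ∈ range n, (1 + η) ^ i) = 0 := by
    have h5 := map_natCast_eq_zero w hp hwp hn
    rw [h3, w.map_add_eq_of_lt_left, h5]
    rw [h5]
    exact w.map_lt_sum (by simp) fun i _ => hη.trans_le (le_map_one_add_pow_sub_one w hη.le i)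
  rw [h2, AddValuation.map_mul, h4, add_zero]

/-- $T$ collects the middle binomial terms divided by $ps$. Its constant term is $1$, so it is a
unit as soon as $w(s)>0$. -/
theorem exists_one_add_pow_prime_eq {p : ℕ} (hp : p.Prime) (s : N) :
    ∃ T : N, (1 + s) ^ p = 1 + s ^ p + p * s * T ∧ (0 ≤ w s → 0 ≤ w T) ∧
      (0 < w s → w T = 0) := by
  obtain ⟨c, hc⟩ : ∃ c : ℕ → ℕ, c = fun k => p.choose k / p := ⟨_, rfl⟩
  refine ⟨∑ k ∈ Ioo 0 p, s ^ (k - 1) * (c k : N), ?_, fun hs => ?_, fun hs => ?_⟩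
  · rw [add_comm 1 s, add_pow_prime_eq hp]
    simp [hc]
    ring
  · refine w.map_le_sum fun k _ => ?_
    rw [AddValuation.map_mul, AddValuation.map_pow]
    exact add_nonneg (nsmul_nonneg hs _) (map_natCast_nonneg w _)
  · have h1 : 1 ∈ Ioo 0 p := by simp [hp.one_lt]
    rw [← add_sum_erase _ _ h1]
    have hc1 : c 1 = 1 := by simp [hc, Nat.div_self hp.pos]
    have h2 : 0 < w (∑ k ∈ (Ioo 0 p).erase 1, s ^ (k - 1) * (c k : N)) := by
      refine w.map_lt_sum (by simp) fun k hk => ?_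
      simp only [mem_erase, mem_Ioo] at hk
      rw [AddValuation.map_mul, AddValuation.map_pow]
      refine add_pos_of_pos_of_nonneg ?_ (map_natCast_nonneg w _)
      obtain ⟨m, hm⟩ : ∃ m, k - 1 = m + 1 := ⟨k - 2, by omega⟩
      rw [hm, succ_nsmul, add_comm]
      exact add_pos_of_pos_of_nonneg hs (nsmul_nonneg hs.le _)
    simp only [hc1, Nat.sub_self, pow_zero, Nat.cast_one, mul_one]
    rw [w.map_add_eq_of_lt_left (by simpa using h2), AddValuation.map_one]

theorem map_eq_zero_of_pow {n : ℕ} (hn : n ≠ 0) {x : N} (hx : w (x ^ n) = 0) : w x = 0 := by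
  have hx0 : x ≠ 0 := by
    rintro rfl
    simp [hn] at hx
  obtain ⟨r, hr⟩ := exists_coe_eq w hx0
  rw [AddValuation.map_pow_coe w hr] at hx
  have h1 : (n : ℝ) * r = 0 := by exact_mod_cast hx
  have h2 : r = 0 := (mul_eq_zero.1 h1).resolve_left (by exact_mod_cast hn)
  rw [hr, h2]
  rfl

/-- The valuation of `ζ - 1` for a root of unity `ζ` of order `p`. -/
theorem map_sub_one_of_pow_prime_eq_one {p : ℕ} (hp : p.Prime) (hwp : w (p : N) = 1) {ζ : N}
    (hζ : ζ ^ p = 1) (hζ1 : ζ ≠ 1) : w (ζ - 1) = ((1 / ((p : ℝ) - 1) : ℝ) : WithTop ℝ) := by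
  have hp1 : (0 : ℝ) < (p : ℝ) - 1 := by
    have : (1 : ℝ) < p := by exact_mod_cast hp.one_lt
    linarith
  have hwζ : w ζ = 0 := map_eq_zero_of_pow w hp.ne_zero (by rw [hζ]; simp)
  obtain ⟨s, hs⟩ : ∃ s, s = ζ - 1 := ⟨_, rfl⟩
  have hs0 : s ≠ 0 := by rw [hs]; exact sub_ne_zero.2 hζ1
  have hws : 0 ≤ w s := by
    rw [hs]
    exact w.map_le_sub hwζ.ge (by simp)
  obtain ⟨T, h1, h2, h3⟩ := exists_one_add_pow_prime_eq w hp s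
  have h4 : s ^ (p - 1) = -(p * T) := by
    have h5 : 1 + s = ζ := by rw [hs]; ring
    rw [h5, hζ] at h1
    have h6 : s ^ p = s ^ (p - 1) * s := by rw [← pow_succ, Nat.sub_add_cancel hp.one_lt.le]
    rw [h6] at h1
    refine mul_right_cancel₀ hs0 ?_
    linear_combination -h1
  obtain ⟨r, hr⟩ := exists_coe_eq w hs0
  have h7 : ((((p : ℝ) - 1) * r : ℝ) : WithTop ℝ) = 1 + w T := by
    have := congrArg w h4
    rw [AddValuation.map_neg, AddValuation.map_mul, hwp, AddValuation.map_pow_coe w hr] at this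
    rw [← this]
    congr 2
    rw [Nat.cast_sub hp.one_lt.le, Nat.cast_one]
  -- The relation $s^{p-1}=-pT$ with $T$ integral forces $w(s)>0$; then $T$ is a unit and the same
  -- relation gives the exact value.
  have h8 : 0 < w s := by
    have h9 : (1 : WithTop ℝ) ≤ ((((p : ℝ) - 1) * r : ℝ) : WithTop ℝ) := by
      rw [h7]
      exact le_add_of_nonneg_right (h2 hws)
    have h10 : 1 ≤ ((p : ℝ) - 1) * r := by exact_mod_cast h9
    rw [hr]
    have : 0 < r := by
      by_contra! hle
      nlinarith
    exact_mod_cast this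
  rw [h3 h8, add_zero] at h7
  have h11 : ((p : ℝ) - 1) * r = 1 := by exact_mod_cast h7
  rw [← hs, hr, WithTop.coe_inj, eq_div_iff hp1.ne', mul_comm]
  exact h11

/-- `a` is `p`-primitive with respect to a field in which uniformizers have value `ε`, and
`a - 1` has order `n`. -/
structure IsPrim (p : ℕ) (ε : ℝ) (a : N) (n : ℤ) : Prop where
  map_sub_one : w (a - 1) = ((n * ε : ℝ) : WithTop ℝ)
  primitive : (∃ m : ℤ, w a = ((m * ε : ℝ) : WithTop ℝ) ∧ ¬ (p : ℤ) ∣ m ∧ 0 < m ∧ n = 0) ∨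
    (0 < n ∧ n * ε < p / ((p : ℝ) - 1) ∧ ¬ (p : ℤ) ∣ n)

variable {w}

/-- With $b=1+s$ and $w(s)=\sigma$, $a-1=s^p+psT$ has terms of value $p\sigma$ and at least
$1+\sigma$. If the second could compete, $\sigma\ge1/(p-1)$ and both would be at least $p/(p-1)$,
beyond the assumed range; so $s^p$ dominates. -/
theorem IsPrim.map_root_sub_one {p : ℕ} (hp : p.Prime) (hwp : w (p : N) = 1) {τ : ℝ} (h0 : 0 < τ)
    (hτ : τ < p / ((p : ℝ) - 1)) {a b : N} (ha : w (a - 1) = τ) (hb : b ^ p = a) :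
    w b = 0 ∧ w (b - 1) = ((τ / p : ℝ) : WithTop ℝ) := by
  have hp1 : (0 : ℝ) < (p : ℝ) - 1 := by
    have : (1 : ℝ) < p := by exact_mod_cast hp.one_lt
    linarith
  have hwa : w a = 0 := by
    have : w (1 + (a - 1)) = w 1 := w.map_add_eq_of_lt_left (by
      rw [ha, AddValuation.map_one]
      exact_mod_cast h0)
    simpa using this
  have hwb : w b = 0 := map_eq_zero_of_pow w hp.ne_zero (by rw [hb, hwa])
  refine ⟨hwb, ?_⟩
  obtain ⟨s, hs⟩ : ∃ s, s = b - 1 := ⟨_, rfl⟩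
  obtain ⟨T, h1, h2, -⟩ := exists_one_add_pow_prime_eq w hp s
  have ht : a - 1 = s ^ p + p * s * T := by
    have : 1 + s = b := by rw [hs]; ring
    rw [this, hb] at h1
    rw [h1]
    ring
  have hs0 : s ≠ 0 := by
    rintro h
    rw [ht, h] at ha
    simp [hp.ne_zero] at ha
  have hws : 0 ≤ w s := by
    rw [hs]
    exact w.map_le_sub hwb.ge (by simp)
  obtain ⟨σ, hσ⟩ := exists_coe_eq w hs0
  have hσ0 : 0 ≤ σ := by
    rw [hσ] at hws
    exact_mod_cast hws
  have hpow : w (s ^ p) = ((p * σ : ℝ) : WithTop ℝ) := AddValuation.map_pow_coe w hσ p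
  have hlin : ((1 + σ : ℝ) : WithTop ℝ) ≤ w (p * s * T) := by
    rw [AddValuation.map_mul, AddValuation.map_mul, hwp, hσ]
    exact le_add_of_nonneg_right (h2 hws)
  rw [← hs, hσ, WithTop.coe_inj, eq_div_iff (by exact_mod_cast hp.ne_zero), mul_comm]
  rcases lt_or_ge (p * σ) (1 + σ) with hlt | hge
  · have : w (a - 1) = w (s ^ p) := by
      rw [ht]
      refine w.map_add_eq_of_lt_left (lt_of_lt_of_le ?_ hlin)
      rw [hpow]
      exact_mod_cast hlt
    rw [ha, hpow] at this
    exact_mod_cast this.symm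
  · exfalso
    have hσ1 : 1 / ((p : ℝ) - 1) ≤ σ := by
      rw [div_le_iff₀ hp1]
      linarith
    have hpp : (p : ℝ) / ((p : ℝ) - 1) = 1 + 1 / ((p : ℝ) - 1) := by
      field_simp
      ring
    have h3 : ((p / ((p : ℝ) - 1) : ℝ) : WithTop ℝ) ≤ w (a - 1) := by
      rw [ht]
      refine w.map_le_add ?_ (le_trans ?_ hlin)
      · rw [hpow, WithTop.coe_le_coe, hpp]
        linarith
      · rw [WithTop.coe_le_coe, hpp]
        linarith
    rw [ha, WithTop.coe_le_coe] at h3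
    linarith

/-- An element `z` of value prime to `p`, whose movement is known. -/
theorem IsPrim.exists_generator {p : ℕ} (hp : p.Prime) (hwp : w (p : N) = 1) {ε : ℝ} (hε : 0 < ε)
    {a b : N} {n : ℤ} (ha : IsPrim w p ε a n) (hb : b ^ p = a) :
    IsPrim w p (ε / p) b n ∧ ∃ (z : N) (m : ℤ), (z = b ∨ z = b - 1) ∧ ¬ (p : ℤ) ∣ m ∧
      w z = ((m * (ε / p) : ℝ) : WithTop ℝ) ∧
      0 < 1 / ((p : ℝ) - 1) - n * (ε / p) ∧
      ∀ ζ : N, ζ ^ p = 1 → ζ ≠ 1 →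
        w ((ζ * b - b) / z) = ((1 / ((p : ℝ) - 1) - n * (ε / p) : ℝ) : WithTop ℝ) := by
  have hp1 : (0 : ℝ) < (p : ℝ) - 1 := by
    have : (1 : ℝ) < p := by exact_mod_cast hp.one_lt
    linarith
  have hp0 : (0 : ℝ) < p := by linarith
  have hmv : ∀ ζ : N, ζ * b - b = (ζ - 1) * b := fun ζ => by ring
  have hζv := fun {ζ : N} h1 h2 => map_sub_one_of_pow_prime_eq_one w hp hwp (ζ := ζ) h1 h2
  -- The witness is $z=b$ when $p\nmid v(a)$, with $n=0$ and $m=v(a)$, and $z=b-1$ otherwise, with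
  -- $m=n$. One formula for the movement covers both cases.
  rcases ha.primitive with ⟨m, hm, hpm, hm0, rfl⟩ | ⟨hn0, hn1, hpn⟩
  · have hb0 : b ≠ 0 := by
      rintro rfl
      rw [← hb, zero_pow hp.ne_zero, AddValuation.map_zero] at hm
      exact WithTop.top_ne_coe hm
    obtain ⟨r, hr⟩ := exists_coe_eq w hb0
    have hwb : w b = ((m * (ε / p) : ℝ) : WithTop ℝ) := by
      rw [← hb, AddValuation.map_pow_coe w hr, WithTop.coe_inj] at hm
      rw [hr, WithTop.coe_inj, mul_div_assoc', eq_div_iff hp0.ne', mul_comm]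
      exact hm
    have hpos : 0 < (m : ℝ) * (ε / p) := by
      have : (0 : ℝ) < m := by exact_mod_cast hm0
      positivity
    refine ⟨⟨?_, Or.inl ⟨m, hwb, hpm, hm0, rfl⟩⟩, b, m, Or.inl rfl, hpm, hwb, ?_, ?_⟩
    · have : w (b - 1) = w 1 := w.map_sub_eq_of_lt_right (by
        rw [hwb, AddValuation.map_one]
        exact_mod_cast hpos)
      rw [this]
      simp
    · simpa using hp1
    · intro ζ h1 h2
      rw [hmv, mul_div_assoc, div_self hb0, mul_one, hζv h1 h2]
      simp
  · have hτ0 : 0 < (n : ℝ) * ε := by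
      have : (0 : ℝ) < n := by exact_mod_cast hn0
      positivity
    obtain ⟨hwb, hws⟩ := IsPrim.map_root_sub_one hp hwp hτ0 hn1 ha.map_sub_one hb
    rw [mul_div_assoc] at hws
    have hlt : (n : ℝ) * (ε / p) < 1 / ((p : ℝ) - 1) := by
      rw [mul_div_assoc', div_lt_iff₀ hp0, one_div_mul_eq_div]
      exact hn1
    refine ⟨⟨hws, Or.inr ⟨hn0, hlt.trans_le ?_, hpn⟩⟩, b - 1, n, Or.inr rfl, hpn, hws,
      by linarith, ?_⟩
    · gcongr
      exact_mod_cast hp.one_lt.le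
    · intro ζ h1 h2
      rw [hmv, AddValuation.map_div, AddValuation.map_mul, hζv h1 h2, hwb, hws, add_zero]
      rfl

end Valuation

end Kummer

end RamificationConductor

end

noncomputable section

namespace RamificationConductor

/-! ### Adjoining roots of $p$-power order -/

section KummerTower

set_option linter.unusedSectionVars false

open Module Finset
open scoped Classical IntermediateField

variable {F N : Type*} [Field F] [Field N] [Algebra F N] [FiniteDimensional F N]
  {w : AddValuation N (WithTop ℝ)} {e : ℝ}

theorem mem_fixingSubgroup_sup_adjoin {M : IntermediateField F N} {b : N} {g : N ≃ₐ[F] N} :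
    g ∈ (M ⊔ F⟮b⟯).fixingSubgroup ↔ g ∈ M.fixingSubgroup ∧ g b = b := by
  rw [IntermediateField.fixingSubgroup_sup, Subgroup.mem_inf]
  refine and_congr_right fun _ => ?_
  rw [IntermediateField.mem_fixingSubgroup_iff]
  refine ⟨fun h => h b (IntermediateField.mem_adjoin_simple_self F b), fun h x hx => ?_⟩
  have hle : F⟮b⟯ ≤ IntermediateField.fixedField (Subgroup.zpowers g) := by
    rw [IntermediateField.adjoin_simple_le_iff, IntermediateField.mem_fixedField_iff]
    intro f hf
    have : Subgroup.zpowers g ≤ MulAction.stabilizer (N ≃ₐ[F] N) b := by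
      rw [Subgroup.zpowers_le]
      exact h
    exact this hf
  exact (IntermediateField.mem_fixedField_iff _ _).1 (hle hx) g (Subgroup.mem_zpowers g)

theorem mem_sup_adjoin (M : IntermediateField F N) (b : N) : b ∈ M ⊔ F⟮b⟯ :=
  (le_sup_right : F⟮b⟯ ≤ M ⊔ F⟮b⟯) (IntermediateField.mem_adjoin_simple_self F b)

/-- Only an upper bound for the degree; the lower bounds come later from the values of elements. -/
theorem exists_finrank_sup_adjoin_le {M : IntermediateField F N} {b : N}
    {P : Polynomial M} (hP : P ≠ 0) (hPb : Polynomial.aeval b P = 0) :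
    ∃ d, 0 < d ∧ d ≤ P.natDegree ∧ finrank F ↥(M ⊔ F⟮b⟯) = d * finrank F M := by
  have hint : IsIntegral M b := IsIntegral.of_finite M b
  refine ⟨finrank M M⟮b⟯, finrank_pos, ?_, ?_⟩
  · rw [IntermediateField.adjoin.finrank hint]
    exact Polynomial.natDegree_le_of_dvd (minpoly.dvd M b hPb) hP
  · rw [← IntermediateField.restrictScalars_adjoin_eq_sup, mul_comm]
    exact (finrank_mul_finrank F M M⟮b⟯).symm

/-- Herbrand functions in a step in which all nontrivial movements of a uniformizer agree. -/
theorem IsTotRam.Phi_step (h : IsTotRam F N w e) [IsGalois F N] {π : N}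
    (hπ : w π = ((e / finrank F N : ℝ) : WithTop ℝ)) {M E : IntermediateField F N} (hME : M ≤ E)
    {d : ℕ} (hd : finrank F E = d * finrank F M) {ϖ : N} (hϖE : ϖ ∈ E)
    (hϖ : w ϖ = ((e / finrank F E : ℝ) : WithTop ℝ)) {j₀ : ℝ}
    (hj₀ : ∀ g ∈ M.fixingSubgroup, g ∉ E.fixingSubgroup → w (g ϖ - ϖ) = j₀) :
    (∀ s, Phi (ramFun w π) M.fixingSubgroup s = Phi (ramFun w π) E.fixingSubgroup s +
        ((d : ℝ) - 1) * min j₀ (Phi (ramFun w π) E.fixingSubgroup s)) ∧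
      (∀ g ∈ M.fixingSubgroup, g ∉ E.fixingSubgroup →
        Phi (ramFun w π) E.fixingSubgroup (ramFun w π g) ≤ j₀) ∧
      (1 < d → ∃ g ∈ M.fixingSubgroup, g ∉ E.fixingSubgroup ∧
        Phi (ramFun w π) E.fixingSubgroup (ramFun w π g) = j₀) := by
  have hj := h.isRamFun hπ
  have hle : E.fixingSubgroup ≤ M.fixingSubgroup := IntermediateField.fixingSubgroup_le hME
  have hsum : ∀ g ∈ M.fixingSubgroup, g ∉ E.fixingSubgroup →
      ∑ x with x ∈ E.fixingSubgroup, ramFun w π (g * x) = j₀ := by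
    intro g hg hg'
    have h1 := h.map_sub_eq_sum hπ hϖE hϖ hg'
    rw [hj₀ g hg hg', WithTop.coe_inj] at h1
    exact h1.symm
  have hcard : Nat.card M.fixingSubgroup = d * Nat.card E.fixingSubgroup := by
    rw [IsGalois.card_fixingSubgroup_eq_finrank, IsGalois.card_fixingSubgroup_eq_finrank]
    have h1 := finrank_mul_finrank F M N
    have h2 := finrank_mul_finrank F E N
    have h3 : 0 < finrank F M := finrank_pos
    rw [hd, ← h1] at h2
    refine Nat.eq_of_mul_eq_mul_left h3 ?_
    rw [← h2]
    ring
  refine ⟨hj.Phi_step hle hcard hsum, fun g => hj.Phi_step_le hsum, fun hd1 => ?_⟩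
  refine hj.exists_Phi_step_eq hle hsum fun heq => ?_
  rw [heq] at hcard
  have : 0 < Nat.card M.fixingSubgroup := Nat.card_pos
  nlinarith

/-- The Bézout coefficient of $m$ is reduced modulo $p$ so that it is a natural number, usable as
the exponent in `map_one_add_pow_sub_one`, where it must be prime to $p$. -/
theorem exists_nat_mul_add_int_mul_eq_one {p : ℕ} (hp : p.Prime) {m : ℤ} (hm : ¬ (p : ℤ) ∣ m) :
    ∃ (x : ℕ) (y : ℤ), (x : ℤ) * m + y * p = 1 ∧ ¬ p ∣ x := by
  have hp' : Prime (p : ℤ) := Nat.prime_iff_prime_int.1 hp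
  obtain ⟨v, u, huv⟩ := (hp'.coprime_iff_not_dvd).2 hm
  have hp0 : (p : ℤ) ≠ 0 := by exact_mod_cast hp.ne_zero
  have hx := Int.emod_nonneg u hp0
  have hdiv := Int.emod_add_mul_ediv u p
  have key : (((u % p).toNat : ℕ) : ℤ) * m + (v + u / p * m) * p = 1 := by
    rw [Int.toNat_of_nonneg hx]
    linear_combination huv + m * hdiv
  refine ⟨(u % p).toNat, v + u / p * m, key, fun hdvd => ?_⟩
  obtain ⟨k, hk⟩ := hdvd
  rw [hk] at key
  refine hp'.not_isUnit (isUnit_of_dvd_one ⟨k * m + (v + u / p * m), ?_⟩)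
  rw [← key]
  push_cast
  ring

/-- Adjoining a `p`-th root of a primitive element. -/
theorem IsTotRam.kummer_step (h : IsTotRam F N w e) {p : ℕ} (hp : p.Prime) (hwp : w (p : N) = 1)
    {M : IntermediateField F N} {a b : N} {n : ℤ} (haM : a ∈ M)
    (ha : IsPrim w p (e / finrank F M) a n) (hb : b ^ p = a) :
    finrank F ↥(M ⊔ F⟮b⟯) = p * finrank F M ∧
      IsPrim w p (e / finrank F ↥(M ⊔ F⟮b⟯)) b n ∧
      ∃ ϖ ∈ M ⊔ F⟮b⟯, w ϖ = ((e / finrank F ↥(M ⊔ F⟮b⟯) : ℝ) : WithTop ℝ) ∧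
        ∀ g ∈ M.fixingSubgroup, g ∉ (M ⊔ F⟮b⟯).fixingSubgroup →
          w (g ϖ - ϖ) = ((1 / ((p : ℝ) - 1) - (n - 1) * (e / finrank F ↥(M ⊔ F⟮b⟯)) : ℝ) :
            WithTop ℝ) := by
  have hε := h.div_pos M
  obtain ⟨hprim, z, m, hz, hpm, hwz, hpos, hmove⟩ := ha.exists_generator hp hwp hε hb
  have hp0 : (0 : ℝ) < p := by exact_mod_cast hp.pos
  have hM0 : (0 : ℝ) < finrank F M := by exact_mod_cast finrank_pos (R := F) (M := M)
  have hbE := mem_sup_adjoin M b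
  have hzE : z ∈ M ⊔ F⟮b⟯ := by
    rcases hz with rfl | rfl
    · exact hbE
    · exact sub_mem hbE (one_mem _)
  have hz0 : z ≠ 0 := by
    rintro rfl
    rw [AddValuation.map_zero] at hwz
    exact WithTop.top_ne_coe hwz
  have hdeg : finrank F ↥(M ⊔ F⟮b⟯) = p * finrank F M := by
    obtain ⟨d, hd0, hdp, hd⟩ := exists_finrank_sup_adjoin_le (M := M) (b := b)
      (P := Polynomial.X ^ p - Polynomial.C ⟨a, haM⟩)
      (Polynomial.X_pow_sub_C_ne_zero hp.pos _) (by
        simp only [map_sub, map_pow, Polynomial.aeval_X, Polynomial.aeval_C, hb]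
        exact sub_self a)
    rw [Polynomial.natDegree_X_pow_sub_C] at hdp
    -- The value $m\varepsilon_M/p$ of $z$, with $p\nmid m$, is an integral multiple of
    -- $\varepsilon_M/d$; hence $p\mid d$, and $d\le p$ gives $d=p$.
    obtain ⟨k, hk⟩ := h.exists_int _ z hzE hz0
    rw [hwz, WithTop.coe_inj, hd] at hk
    have hd0' : (0 : ℝ) < d := by exact_mod_cast hd0
    have he := h.pos
    have h1 : (m : ℝ) * d = k * p := by
      push_cast at hk
      field_simp at hk
      linarith
    have h2 : m * d = k * p := by exact_mod_cast h1
    have h3 : (p : ℤ) ∣ m * d := ⟨k, by rw [h2, mul_comm]⟩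
    have h4 : (p : ℤ) ∣ d := ((Nat.prime_iff_prime_int.1 hp).dvd_or_dvd h3).resolve_left hpm
    have h5 : d = p := le_antisymm hdp (Nat.le_of_dvd hd0 (by exact_mod_cast h4))
    rw [hd, h5]
  have hεE : e / finrank F ↥(M ⊔ F⟮b⟯) = e / finrank F M / p := by
    rw [hdeg]
    push_cast
    field_simp
  rw [hεE]
  refine ⟨hdeg, hprim, ?_⟩
  -- Bézout exponents make $z^x\varpi^y$ a uniformizer of $M(b)$.
  obtain ⟨x, y, hxy, hpx⟩ := exists_nat_mul_add_int_mul_eq_one hp hpm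
  obtain ⟨ϖ, hϖM, hϖ⟩ := h.exists_unif M
  have hval : w (z ^ x * ϖ ^ y) = ((e / finrank F M / p : ℝ) : WithTop ℝ) := by
    rw [AddValuation.map_mul, RamificationConductor.AddValuation.map_pow_coe w hwz,
      RamificationConductor.AddValuation.map_zpow_coe w hϖ, ← WithTop.coe_add, WithTop.coe_inj]
    have : ((x : ℝ) * m + y * p) = 1 := by exact_mod_cast hxy
    field_simp
    linear_combination e * this
  refine ⟨z ^ x * ϖ ^ y, mul_mem (pow_mem hzE x) (zpow_mem
    ((le_sup_left : M ≤ M ⊔ F⟮b⟯) hϖM) y), hval, fun g hg hg' => ?_⟩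
  have hgb : g b ≠ b := fun h1 => hg' (mem_fixingSubgroup_sup_adjoin.2 ⟨hg, h1⟩)
  have hgM := (IntermediateField.mem_fixingSubgroup_iff M g).1 hg
  have hb0 : b ≠ 0 := by
    rintro rfl
    exact hgb (map_zero g)
  have hη := hmove (g b / b) (by
      rw [div_pow, ← map_pow, hb, hgM a haM, ← hb, div_self (pow_ne_zero _ hb0)])
    (by rwa [Ne, div_eq_one_iff_eq hb0])
  rw [div_mul_cancel₀ _ hb0] at hη
  obtain ⟨η, hηdef⟩ : ∃ η, η = (g b - b) / z := ⟨_, rfl⟩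
  rw [← hηdef] at hη
  have hgz : g z = z * (1 + η) := by
    have : g z - z = g b - b := by
      rcases hz with rfl | rfl
      · rfl
      · rw [map_sub, map_one]; ring
    rw [hηdef, ← this]
    field_simp
    ring
  -- The uniformizer contributes $\varepsilon_E$ and $(1+\eta)^x-1$ contributes
  -- $w(\eta)=1/(p-1)-n\varepsilon_E$, whence the coefficient $n-1$.
  have hmv : g (z ^ x * ϖ ^ y) - z ^ x * ϖ ^ y = z ^ x * ϖ ^ y * ((1 + η) ^ x - 1) := by
    rw [map_mul, map_pow, map_zpow₀, hgM ϖ hϖM, hgz, mul_pow]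
    ring
  rw [hmv, AddValuation.map_mul, hval, map_one_add_pow_sub_one w hp (by rw [hwp]; exact zero_lt_one)
    (by rw [hη]; exact_mod_cast hpos) hpx, hη, ← WithTop.coe_add, WithTop.coe_inj]
  ring

/-- Adjoining a root of order `p ^ c` of a primitive element. -/
theorem IsTotRam.kummer_tower (h : IsTotRam F N w e) [IsGalois F N] {π : N}
    (hπ : w π = ((e / finrank F N : ℝ) : WithTop ℝ))
    {p : ℕ} (hp : p.Prime) (hwp : w (p : N) = 1)
    {M : IntermediateField F N} {a : N} {n : ℤ} (haM : a ∈ M)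
    (ha : IsPrim w p (e / finrank F M) a n) (c : ℕ) :
    ∀ b : N, b ^ p ^ c = a → ∀ E, E = M ⊔ F⟮b⟯ → ∀ J : ℝ,
      J = 1 / ((p : ℝ) - 1) - (n - 1) * (e / finrank F E) →
      finrank F E = p ^ c * finrank F M ∧
      IsPrim w p (e / finrank F E) b n ∧
      (∀ s, J ≤ Phi (ramFun w π) E.fixingSubgroup s → Phi (ramFun w π) M.fixingSubgroup s =
        Phi (ramFun w π) E.fixingSubgroup s - J +
          (1 / ((p : ℝ) - 1) - (n - 1) * (e / finrank F M) + c)) ∧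
      (∀ g ∈ M.fixingSubgroup, g ∉ E.fixingSubgroup →
        Phi (ramFun w π) E.fixingSubgroup (ramFun w π g) ≤ J) ∧
      (1 ≤ c → ∃ g ∈ M.fixingSubgroup, g ∉ E.fixingSubgroup ∧
        Phi (ramFun w π) E.fixingSubgroup (ramFun w π g) = J) := by
  have hp1 : (0 : ℝ) < (p : ℝ) - 1 := by
    have : (1 : ℝ) < p := by exact_mod_cast hp.one_lt
    linarith
  have hp0 : (0 : ℝ) < p := by linarith
  induction c with
  | zero =>
    intro b hb E hE J hJ
    rw [pow_zero, pow_one] at hb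
    have hEM : E = M := by
      rw [hE, sup_eq_left, IntermediateField.adjoin_simple_le_iff, hb]
      exact haM
    subst hEM
    subst hb
    refine ⟨by simp, ha, fun s _ => ?_, fun g hg hg' => absurd hg hg', by simp⟩
    rw [hJ]
    push_cast
    ring
  | succ c ih =>
    intro b hb E hE J hJ
    rw [pow_succ', pow_mul] at hb
    obtain ⟨E', hE'⟩ : ∃ E', E' = M ⊔ F⟮b ^ p⟯ := ⟨_, rfl⟩
    obtain ⟨J', hJ'⟩ : ∃ J', J' = 1 / ((p : ℝ) - 1) - (n - 1) * (e / finrank F E') := ⟨_, rfl⟩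
    obtain ⟨ih1, ih2, ih3, ih4, -⟩ := ih (b ^ p) hb E' hE' J' hJ'
    have hEE' : E = E' ⊔ F⟮b⟯ := by
      rw [hE, hE', sup_assoc]
      congr 1
      rw [eq_comm, sup_eq_right, IntermediateField.adjoin_simple_le_iff]
      exact pow_mem (IntermediateField.mem_adjoin_simple_self F b) p
    have hbE' : b ^ p ∈ E' := hE' ▸ mem_sup_adjoin M (b ^ p)
    obtain ⟨s1, s2, ϖ, s3, s4, s5⟩ := h.kummer_step hp hwp hbE' ih2 rfl
    rw [← hEE'] at s1 s2 s3 s4 s5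
    rw [← hJ] at s5
    obtain ⟨t1, t2, t3⟩ := h.Phi_step hπ (hEE' ▸ le_sup_left : E' ≤ E) s1 s3 s4 s5
    -- For $\Phi_E\ge J$ this gives $\Phi_{E'}=\Phi_E+(p-1)J\ge J'+1$, so the induction hypothesis
    -- applies, and the constant grows by exactly $1$.
    have hpJ : p * J = J' + 1 := by
      rw [hJ, hJ', s1]
      have h1 : (0 : ℝ) < finrank F E' := by exact_mod_cast finrank_pos (R := F) (M := E')
      push_cast
      field_simp
      ring
    refine ⟨by rw [s1, ih1, pow_succ']; ring, s2, fun s hs => ?_, fun g hg hg' => ?_, fun _ => ?_⟩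
    · have h1 := t1 s
      rw [min_eq_left hs] at h1
      rw [ih3 s (by linarith), h1]
      push_cast
      linarith
    · by_cases hgE' : g ∈ E'.fixingSubgroup
      · exact t2 g hgE' hg'
      -- Otherwise $\Phi_{E'}>J'+1$ at $j(g)$, against the bound $J'$ for elements that move $E'$.
      · by_contra! hlt
        have h1 := t1 (ramFun w π g)
        rw [min_eq_left hlt.le] at h1
        linarith [ih4 g hg hgE']
    · obtain ⟨g, hg, hg', hgJ⟩ := t3 hp.one_lt
      exact ⟨g, IntermediateField.fixingSubgroup_le (hE' ▸ le_sup_left : M ≤ E') hg, hg', hgJ⟩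

end KummerTower

end RamificationConductor

end

noncomputable section

namespace RamificationConductor

/-! ### Witt vectors as base ring -/

section WittVector

open IsLocalRing

variable (p : ℕ) [Fact p.Prime] (k : Type*) [Field k] [CharP k p]

theorem charZero_wittVector : CharZero (WittVector p k) := by
  have hp0 : (p : WittVector p k) ≠ 0 := (WittVector.irreducible p).ne_zero
  rw [← CharP.ringChar_zero_iff_CharZero]
  by_contra h0
  have hr : (ringChar (WittVector p k)).Prime :=
    (CharP.char_is_prime_or_zero (WittVector p k) (ringChar (WittVector p k))).resolve_right h0
  have h1 : ((ringChar (WittVector p k) : ℕ) : k) = 0 := by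
    have := congrArg (WittVector.constantCoeff (p := p) (R := k))
      (ringChar.Nat.cast_ringChar (R := WittVector p k))
    simpa only [map_natCast, map_zero] using this
  have h2 : p ∣ ringChar (WittVector p k) := (CharP.cast_eq_zero_iff k p _).1 h1
  have h3 : p = ringChar (WittVector p k) := (Nat.prime_dvd_prime_iff_eq Fact.out hr).1 h2
  exact hp0 ((congrArg (Nat.cast (R := WittVector p k)) h3).trans ringChar.Nat.cast_ringChar)

variable [IsAlgClosed k]

theorem maximalIdeal_wittVector :
    maximalIdeal (WittVector p k) = Ideal.span {(p : WittVector p k)} :=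
  (WittVector.irreducible p).maximalIdeal_eq

theorem isAdicComplete_wittVector :
    IsAdicComplete (maximalIdeal (WittVector p k)) (WittVector p k) := by
  rw [maximalIdeal_wittVector]
  infer_instance

theorem isAlgClosed_residueField_wittVector : IsAlgClosed (ResidueField (WittVector p k)) :=
  IsAlgClosed.of_ringEquiv k _ ((WittVector.quotientPEquiv (p := p) (k := k)).symm.trans
    (Ideal.quotEquivOfEq (maximalIdeal_wittVector p k).symm))

end WittVector

/-! ### The cyclotomic tower -/

section Cyclotomic

open Module Finset
open scoped Classical IntermediateField

variable {F N : Type*} [Field F] [Field N] [Algebra F N] [FiniteDimensional F N] [IsGalois F N]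
  {w : AddValuation N (WithTop ℝ)}

/-- The field generated by a root of unity of order `p`. -/
theorem IsTotRam.cyclotomic_prime_step {e : ℝ} (h : IsTotRam F N w e) (he : e = 1) {π : N}
    (hπ : w π = ((e / finrank F N : ℝ) : WithTop ℝ))
    {p : ℕ} (hp : p.Prime) (hwp : w (p : N) = 1) {ζ : N} (hζ : IsPrimitiveRoot ζ p) :
    finrank F F⟮ζ⟯ = p - 1 ∧
    (∀ s, Phi (ramFun (F := F) w π) ⊤ s = Phi (ramFun w π) F⟮ζ⟯.fixingSubgroup s +
      ((p : ℝ) - 2) * min (1 / ((p : ℝ) - 1)) (Phi (ramFun w π) F⟮ζ⟯.fixingSubgroup s)) ∧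
    (∀ g ∉ F⟮ζ⟯.fixingSubgroup,
      Phi (ramFun w π) F⟮ζ⟯.fixingSubgroup (ramFun w π g) ≤ 1 / ((p : ℝ) - 1)) := by
  have hp1 : (0 : ℝ) < (p : ℝ) - 1 := by
    have : (1 : ℝ) < p := by exact_mod_cast hp.one_lt
    linarith
  have hcast : ((p - 1 : ℕ) : ℝ) = (p : ℝ) - 1 := by
    rw [Nat.cast_sub hp.one_lt.le, Nat.cast_one]
  have hζv := fun {ξ : N} h1 h2 => map_sub_one_of_pow_prime_eq_one w hp hwp (ζ := ξ) h1 h2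
  have hζ1 := hζv hζ.pow_eq_one (hζ.ne_one hp.one_lt)
  have hmem : ζ ∈ F⟮ζ⟯ := IntermediateField.mem_adjoin_simple_self F ζ
  have hsup : (⊥ : IntermediateField F N) ⊔ F⟮ζ⟯ = F⟮ζ⟯ := bot_sup_eq _
  have hdeg : finrank F F⟮ζ⟯ = p - 1 := by
    obtain ⟨d, hd0, hdp, hd⟩ := exists_finrank_sup_adjoin_le (M := (⊥ : IntermediateField F N))
      (b := ζ) (P := Polynomial.cyclotomic p _) (Polynomial.cyclotomic_ne_zero p _) (by
        rw [Polynomial.aeval_def, Polynomial.eval₂_eq_eval_map, Polynomial.map_cyclotomic]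
        exact hζ.isRoot_cyclotomic hp.pos)
    rw [Polynomial.natDegree_cyclotomic, Nat.totient_prime hp] at hdp
    rw [hsup, IntermediateField.finrank_bot, mul_one] at hd
    -- The value $1/(p-1)$ of $\zeta-1$ forces $p-1\mid d$, so the degree is full and $\zeta-1$ is a
    -- uniformizer.
    obtain ⟨z, hz⟩ := h.exists_int F⟮ζ⟯ (ζ - 1) (sub_mem hmem (one_mem _))
      (sub_ne_zero.2 (hζ.ne_one hp.one_lt))
    rw [hζ1, WithTop.coe_inj, he, hd] at hz
    have hd0' : (0 : ℝ) < d := by exact_mod_cast hd0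
    have h1 : (d : ℝ) = z * ((p - 1 : ℕ) : ℝ) := by
      rw [hcast]
      field_simp at hz
      linarith
    have h2 : (d : ℤ) = z * ((p - 1 : ℕ) : ℤ) := by exact_mod_cast h1
    have h3 : (p - 1) ∣ d := by
      have : ((p - 1 : ℕ) : ℤ) ∣ d := ⟨z, by rw [h2, mul_comm]⟩
      exact_mod_cast this
    rw [hd]
    exact le_antisymm hdp (Nat.le_of_dvd hd0 h3)
  have hbot : (⊥ : IntermediateField F N).fixingSubgroup = ⊤ := IntermediateField.fixingSubgroup_bot
  obtain ⟨s1, s2, -⟩ := h.Phi_step hπ (bot_le : ⊥ ≤ F⟮ζ⟯) (d := p - 1)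
    (by rw [IntermediateField.finrank_bot, mul_one, hdeg]) (ϖ := ζ - 1)
    (sub_mem hmem (one_mem _)) (by rw [hζ1, hdeg, he, hcast])
    (j₀ := 1 / ((p : ℝ) - 1)) (by
      intro g _ hg
      have hζ0 : ζ ≠ 0 := hζ.ne_zero hp.ne_zero
      have hgζ : g ζ ≠ ζ := fun h1 => hg (by
        rw [← hsup]
        exact mem_fixingSubgroup_sup_adjoin.2 ⟨by rw [hbot]; trivial, h1⟩)
      have hwζ : w ζ = 0 := map_eq_zero_of_pow w hp.ne_zero (by rw [hζ.pow_eq_one]; simp)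
      have h1 : g (ζ - 1) - (ζ - 1) = (g ζ / ζ - 1) * ζ := by
        rw [map_sub, map_one]
        field_simp
        ring
      rw [h1, AddValuation.map_mul, hwζ, add_zero]
      refine hζv ?_ (by rwa [Ne, div_eq_one_iff_eq hζ0])
      rw [div_pow, ← map_pow, hζ.pow_eq_one, map_one, div_one])
  rw [hbot] at s1 s2
  refine ⟨hdeg, fun s => ?_, fun g hg => s2 g trivial hg⟩
  rw [s1 s, hcast]
  ring

/-- The field generated by a root of unity of order `p ^ ℓ`. -/
theorem IsTotRam.cyclotomic_tower {e : ℝ} (h : IsTotRam F N w e) (he : e = 1) {π : N}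
    (hπ : w π = ((e / finrank F N : ℝ) : WithTop ℝ))
    {p : ℕ} (hp : p.Prime) (hwp : w (p : N) = 1) {ℓ : ℕ} (hℓ : 1 ≤ ℓ) {ζ : N}
    (hζ : IsPrimitiveRoot ζ (p ^ ℓ)) :
    (finrank F F⟮ζ⟯ : ℝ) = p ^ (ℓ - 1) * ((p : ℝ) - 1) ∧
    (∀ s, 1 / ((p : ℝ) - 1) ≤ Phi (ramFun w π) F⟮ζ⟯.fixingSubgroup s →
      Phi (ramFun (F := F) w π) ⊤ s =
        Phi (ramFun w π) F⟮ζ⟯.fixingSubgroup s + ℓ - 1 / ((p : ℝ) - 1)) ∧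
    (∀ g ∉ F⟮ζ⟯.fixingSubgroup,
      Phi (ramFun w π) F⟮ζ⟯.fixingSubgroup (ramFun w π g) ≤ 1 / ((p : ℝ) - 1)) ∧
    (2 ≤ ℓ → ∃ g ∉ F⟮ζ⟯.fixingSubgroup,
      Phi (ramFun w π) F⟮ζ⟯.fixingSubgroup (ramFun w π g) = 1 / ((p : ℝ) - 1)) := by
  have hp1 : (0 : ℝ) < (p : ℝ) - 1 := by
    have : (1 : ℝ) < p := by exact_mod_cast hp.one_lt
    linarith
  have hcast : ((p - 1 : ℕ) : ℝ) = (p : ℝ) - 1 := by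
    rw [Nat.cast_sub hp.one_lt.le, Nat.cast_one]
  obtain ⟨c, rfl⟩ : ∃ c, ℓ = c + 1 := ⟨ℓ - 1, by omega⟩
  obtain ⟨ξ, hξdef⟩ : ∃ ξ, ξ = ζ ^ p ^ c := ⟨_, rfl⟩
  have hξ : IsPrimitiveRoot ξ p := by
    rw [hξdef]
    exact hζ.pow (pow_pos hp.pos _) (pow_succ p c)
  obtain ⟨s1, s2, s3⟩ := h.cyclotomic_prime_step he hπ hp hwp hξ
  -- A root of unity of order $p$ is primitive with $n=1$. The factor $n-1$ then vanishes, so the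
  -- movement in every further layer is $1/(p-1)$.
  have hprim : IsPrim w p (e / finrank F F⟮ξ⟯) ξ 1 := by
    have h1 : e / finrank F F⟮ξ⟯ = 1 / ((p : ℝ) - 1) := by rw [s1, he, hcast]
    rw [h1]
    refine ⟨?_, Or.inr ⟨one_pos, ?_, fun hd => ?_⟩⟩
    · rw [map_sub_one_of_pow_prime_eq_one w hp hwp hξ.pow_eq_one (hξ.ne_one hp.one_lt)]
      simp
    · rw [Int.cast_one, one_mul, div_lt_div_iff_of_pos_right hp1]
      exact_mod_cast hp.one_lt
    · exact (Nat.prime_iff_prime_int.1 hp).not_isUnit (isUnit_of_dvd_one hd)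
  have hE : F⟮ζ⟯ = F⟮ξ⟯ ⊔ F⟮ζ⟯ := by
    rw [eq_comm, sup_eq_right, IntermediateField.adjoin_simple_le_iff, hξdef]
    exact pow_mem (IntermediateField.mem_adjoin_simple_self F ζ) _
  obtain ⟨t1, -, t3, t4, t5⟩ := h.kummer_tower hπ hp hwp
    (IntermediateField.mem_adjoin_simple_self F ξ) hprim c ζ hξdef.symm F⟮ζ⟯ hE
    (1 / ((p : ℝ) - 1)) (by push_cast; ring)
  have t3' : ∀ s, 1 / ((p : ℝ) - 1) ≤ Phi (ramFun w π) F⟮ζ⟯.fixingSubgroup s →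
      Phi (ramFun w π) F⟮ξ⟯.fixingSubgroup s = Phi (ramFun w π) F⟮ζ⟯.fixingSubgroup s + c := by
    intro s hs
    rw [t3 s hs]
    push_cast
    ring
  have hc0 : (0 : ℝ) ≤ c := Nat.cast_nonneg c
  refine ⟨?_, fun s hs => ?_, fun g hg => ?_, fun hℓ2 => ?_⟩
  · rw [t1, s1]
    push_cast
    rw [hcast]
  · have h1 := t3' s hs
    rw [s2 s, min_eq_left (by linarith), h1]
    push_cast
    field_simp
    ring
  · by_cases hgξ : g ∈ F⟮ξ⟯.fixingSubgroup
    · exact t4 g hgξ hg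
    · by_contra! hlt
      have h1 := t3' _ hlt.le
      have h2 := s3 g hgξ
      linarith
  · obtain ⟨g, -, hg, hgJ⟩ := t5 (by omega)
    exact ⟨g, hg, hgJ⟩

end Cyclotomic

/-! ### Normal subgroups fixing a root -/

section GaloisClosure

open Module
open scoped IntermediateField

variable {F N : Type*} [Field F] [Field N] [Algebra F N] [FiniteDimensional F N] [IsGalois F N]

/-- If `b` is a root of order `m` of `a ∈ M`, of full degree, then its conjugates are its multiples
by roots of unity. -/
theorem exists_apply_eq_mul {M : IntermediateField F N} {a b : N} (haM : a ∈ M) {m : ℕ}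
    (hm : 0 < m) (hb : b ^ m = a) (hdeg : finrank F ↥(M ⊔ F⟮b⟯) = m * finrank F M) {ξ : N}
    (hξ : ξ ^ m = 1) : ∃ g : N ≃ₐ[F] N, g b = ξ * b := by
  have hint : IsIntegral M b := IsIntegral.of_finite M b
  have hfin : finrank M M⟮b⟯ = m := by
    rw [← IntermediateField.restrictScalars_adjoin_eq_sup] at hdeg
    have h1 : finrank F M * finrank M M⟮b⟯ = m * finrank F M :=
      (finrank_mul_finrank F M M⟮b⟯).trans hdeg
    have h2 : 0 < finrank F M := finrank_pos
    exact Nat.eq_of_mul_eq_mul_left h2 (by rw [h1, mul_comm])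
  have hmin : minpoly M b = Polynomial.X ^ m - Polynomial.C ⟨a, haM⟩ := by
    refine (Polynomial.eq_of_monic_of_dvd_of_natDegree_le (minpoly.monic hint)
      (Polynomial.monic_X_pow_sub_C _ hm.ne') (minpoly.dvd M b ?_) ?_).symm
    · simp only [map_sub, map_pow, Polynomial.aeval_X, Polynomial.aeval_C, hb]
      exact sub_self a
    · rw [Polynomial.natDegree_X_pow_sub_C, ← IntermediateField.adjoin.finrank hint, hfin]
  obtain ⟨σ, hσ⟩ := minpoly.exists_algEquiv_of_root' (K := M) (x := ξ * b) (y := b)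
    hint.isAlgebraic (by
      rw [hmin]
      simp only [map_sub, map_pow, Polynomial.aeval_X, Polynomial.aeval_C, mul_pow, hξ, one_mul, hb]
      exact sub_self a)
  exact ⟨σ.restrictScalars F, hσ⟩

/-- A normal subgroup fixing such a root fixes the corresponding roots of unity. -/
theorem apply_root_of_unity_eq {M : IntermediateField F N} {a b : N} (haM : a ∈ M) {m : ℕ}
    (hm : 0 < m) (hb0 : b ≠ 0) (hb : b ^ m = a)
    (hdeg : finrank F ↥(M ⊔ F⟮b⟯) = m * finrank F M) {Q : Subgroup (N ≃ₐ[F] N)} (hQ : Q.Normal)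
    (hQb : Q ≤ (M ⊔ F⟮b⟯).fixingSubgroup) {q : N ≃ₐ[F] N} (hq : q ∈ Q) {ξ : N} (hξ : ξ ^ m = 1) :
    q ξ = ξ := by
  obtain ⟨g, hg⟩ := exists_apply_eq_mul haM hm hb hdeg hξ
  have h1 : ∀ q ∈ Q, q b = b := fun q hq => (mem_fixingSubgroup_sup_adjoin.1 (hQb hq)).2
  have h2 : q (g b) = g b := by
    -- The conjugate $g^{-1}qg$ lies in $Q$, so it fixes $b$; hence $q$ fixes $gb=\xi b$, and
    -- therefore $\xi$.
    have h3 := h1 _ (hQ.conj_mem q hq g⁻¹)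
    rw [inv_inv, AlgEquiv.mul_apply, AlgEquiv.mul_apply] at h3
    have h4 := congrArg g h3
    rwa [← AlgEquiv.mul_apply g g⁻¹, mul_inv_cancel, AlgEquiv.one_apply] at h4
  rw [hg, map_mul, h1 q hq] at h2
  exact mul_right_cancel₀ hb0 h2

end GaloisClosure

end RamificationConductor

end

noncomputable section

namespace RamificationConductor

/-! ### Conductors of Kummer extensions and of their Galois closures -/

section Conductor

set_option linter.unusedSectionVars false

open Module IsLocalRing
open scoped Classical IntermediateField

variable (A : Type*) [CommRing A] [IsDomain A] [IsDiscreteValuationRing A]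
  [IsAdicComplete (maximalIdeal A) A] [IsAlgClosed (ResidueField A)]
  (K : Type*) [Field K] [CharZero K] [Algebra A K] [IsFractionRing A K]

section Prim

variable {F : Type*} [Field F] [Algebra K F] [Algebra A F] [IsScalarTower A K F]
  [FiniteDimensional K F]

/-- If $p\nmid v(a)$ then $v(a)\ge0$ forces $v(a)>0$, so $a-1$ has order $0$. In the other case
$e_F=[F:K]$, because $p$ is a uniformizer of $A$. -/
theorem IsPPrimitive.exists_isPrim {p : ℕ} (hpA : Irreducible (p : A)) {a : F}
    (ha : IsPPrimitive A F p a) (ha₀ : 0 ≤ ord A F a) :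
    ∃ n : ℤ, ord A F (a - 1) = n ∧ IsPrim (ramVal A K F) p (finrank K F : ℝ)⁻¹ a n := by
  have := isDiscreteValuationRing_integralClosure A K F
  have := isFractionRing_integralClosure A K F
  have hF0 : (0 : ℝ) < finrank K F := by exact_mod_cast finrank_pos (R := K) (M := F)
  rcases ha with ⟨m, hm, hpm⟩ | ⟨n, e, hn, he, hn0, hne, hpn⟩
  · have hm0 : 0 < m := by
      rw [hm] at ha₀
      have h1 : 0 ≤ m := by exact_mod_cast ha₀
      rcases h1.eq_or_lt with rfl | h1
      · exact absurd (dvd_zero _) hpm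
      · exact h1
    have hwa := ramVal_eq_of_ord_eq A K hm
    have hw : ramVal A K F (a - 1) = ((((0 : ℤ) : ℝ) * (finrank K F : ℝ)⁻¹ : ℝ) : WithTop ℝ) := by
      have h1 : ramVal A K F 1 < ramVal A K F a := by
        rw [hwa, AddValuation.map_one, ← WithTop.coe_zero, WithTop.coe_lt_coe]
        have : (0 : ℝ) < m := by exact_mod_cast hm0
        positivity
      rw [AddValuation.map_sub_eq_of_lt_right _ h1,
        AddValuation.map_one]
      simp
    exact ⟨0, ord_eq_of_ramVal_eq A K hw, hw, Or.inl ⟨m, hwa, hpm, hm0, rfl⟩⟩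
  · refine ⟨n, hn, ramVal_eq_of_ord_eq A K hn, Or.inr ⟨hn0, ?_, hpn⟩⟩
    have h1 := ord_algebraMap_of_irreducible A K F hpA
    rw [map_natCast, he] at h1
    have h2 : e = (finrank K F : ℤ) := by exact_mod_cast h1
    rw [h2] at hne
    rw [← div_eq_mul_inv, div_lt_iff₀ hF0]
    exact_mod_cast hne

theorem IsPrim.map {F N : Type*} [Field F] [Field N] {w : AddValuation F (WithTop ℝ)}
    {w' : AddValuation N (WithTop ℝ)} {p : ℕ} {ε : ℝ} {a : F} {n : ℤ} (h : IsPrim w p ε a n)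
    (f : F →+* N) (hf : ∀ x, w' (f x) = w x) : IsPrim w' p ε (f a) n := by
  refine ⟨by rw [← map_one f, ← map_sub, hf, h.map_sub_one], ?_⟩
  rw [hf]
  exact h.primitive

theorem IsPrim.ne_zero_of_pow_eq {N : Type*} [Field N] {w : AddValuation N (WithTop ℝ)} {p : ℕ}
    (hp : p.Prime) {ε : ℝ} (hε : 0 < ε) {a b : N} {n : ℤ} (h : IsPrim w p ε a n) {c : ℕ}
    (hb : b ^ p ^ c = a) : b ≠ 0 := by
  rintro rfl
  rw [zero_pow (pow_pos hp.pos c).ne'] at hb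
  subst hb
  rcases h.primitive with ⟨m, hm, -⟩ | ⟨hn, -, -⟩
  · rw [AddValuation.map_zero] at hm
    exact WithTop.top_ne_coe hm
  · have h1 := h.map_sub_one
    rw [zero_sub, AddValuation.map_neg, AddValuation.map_one, ← WithTop.coe_zero,
      WithTop.coe_inj] at h1
    have hn' : (0 : ℝ) < n := by exact_mod_cast hn
    exact (mul_pos hn' hε).ne h1

end Prim

variable {F N : Type*} [Field F] [Field N] [Algebra F N] [FiniteDimensional F N] [IsGalois F N]
  [Algebra K F] [Algebra A F] [Algebra K N] [Algebra A N] [IsScalarTower A K N]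
  [IsScalarTower K F N] [IsScalarTower A F N] [FiniteDimensional K F] [FiniteDimensional K N]

theorem ramVal_eq_div_of_isUniformizer {π : N} (hπ : IsUniformizer A N π) :
    ramVal A K N π = (((finrank K F : ℝ)⁻¹ / finrank F N : ℝ) : WithTop ℝ) := by
  have := isDiscreteValuationRing_integralClosure A K N
  have := isFractionRing_integralClosure A K N
  rw [ramVal_eq_of_ord_eq A K hπ.ord_eq, ← finrank_mul_finrank K F N]
  push_cast
  rw [one_mul, mul_inv, div_eq_mul_inv]

/-- The maximum of $j$ is attained outside $H$, so $g_1$ need only dominate the elements outside $H$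
to realize the conductor. -/
theorem ramConductor_eq_Phi {π : N} (hπ : IsUniformizer A N π) {H : Subgroup (N ≃ₐ[F] N)}
    (hH : ∀ Q : Subgroup (N ≃ₐ[F] N), Q.Normal → Q ≤ H → Q = ⊥) {g₁ : N ≃ₐ[F] N} (hg₁ : g₁ ≠ 1)
    (hmax : ∀ g ∉ H, ramFun (ramVal A K N) π g ≤ ramFun (ramVal A K N) π g₁) :
    ramConductor A N F =
      Phi (ramFun (F := F) (ramVal A K N) π) ⊤ (ramFun (ramVal A K N) π g₁) * finrank K F - 1 := by
  have h := isTotRam_ramVal A K F N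
  have hunif := fun (π : N) hπ => ramVal_eq_div_of_isUniformizer A K (F := F) (π := π) hπ
  have hj := h.isRamFun (hunif π hπ)
  have : Nontrivial (N ≃ₐ[F] N) := ⟨g₁, 1, hg₁⟩
  obtain ⟨g₀, hg₀, hg₀max⟩ := hj.exists_max_notMem hH
  have := h.ramConductor_eq (A := A) (fun x => by
      rw [ramVal_apply, ← finrank_mul_finrank K F N]
      push_cast
      rw [mul_inv, div_eq_mul_inv]) hunif hπ hg₁
      (fun g hg => (hg₀max g hg).trans (hmax g₀ hg₀))
  rw [this, div_inv_eq_mul]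

variable (F N) in
/-- The conductor of a field generated, up to Galois closure, by a root of order `p ^ c` of a
primitive element. -/
theorem ramConductor_kummer {p : ℕ} (hp : p.Prime) (hpA : Irreducible (p : A))
    {a b : N} {n : ℤ} (haF : a ∈ (⊥ : IntermediateField F N))
    (ha : IsPrim (ramVal A K N) p (finrank K F : ℝ)⁻¹ a n) {c : ℕ} (hc : 1 ≤ c)
    (hb : b ^ p ^ c = a)
    (hgen : ∀ g : N ≃ₐ[F] N, g b = b → (∀ ξ : N, ξ ^ p ^ c = 1 → g ξ = ξ) → g = 1) :
    ramConductor A N F =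
      (1 / ((p : ℝ) - 1) - (n - 1) * (finrank K F : ℝ)⁻¹ + c) * finrank K F - 1 := by
  have := isDiscreteValuationRing_integralClosure A K N
  have := isFractionRing_integralClosure A K N
  obtain ⟨π, hπ⟩ := exists_isUniformizer (A := A) (E := N)
  have h := isTotRam_ramVal A K F N
  have hπ' := ramVal_eq_div_of_isUniformizer A K (F := F) hπ
  have hwp : ramVal A K N (p : N) = 1 := by
    rw [← ramVal_uniformizer A K N hpA, map_natCast (algebraMap A N)]
  have hbot : (⊥ : IntermediateField F N).fixingSubgroup = ⊤ := IntermediateField.fixingSubgroup_bot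
  obtain ⟨t1, -, t3, t4, t5⟩ := h.kummer_tower hπ' hp hwp haF
    (by rwa [IntermediateField.finrank_bot, Nat.cast_one, div_one]) c b hb F⟮b⟯ (bot_sup_eq _).symm _ rfl
  rw [hbot] at t3 t4 t5
  have hb0 : b ≠ 0 := ha.ne_zero_of_pow_eq hp (finrank_inv_pos K) hb
  have hH : ∀ Q : Subgroup (N ≃ₐ[F] N), Q.Normal → Q ≤ F⟮b⟯.fixingSubgroup → Q = ⊥ := by
    intro Q hQ hQb
    rw [← bot_sup_eq F⟮b⟯] at hQb t1
    refine (Subgroup.eq_bot_iff_forall Q).2 fun q hq => hgen q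
      (mem_fixingSubgroup_sup_adjoin.1 (hQb hq)).2 fun ξ hξ => ?_
    exact apply_root_of_unity_eq haF (pow_pos hp.pos c) hb0 hb t1 hQ hQb hq hξ
  obtain ⟨g₁, -, hg₁, hJ⟩ := t5 hc
  rw [ramConductor_eq_Phi A K hπ hH (g₁ := g₁) (fun h1 => hg₁ (h1 ▸ one_mem _)) (fun g hg => ?_),
    t3 _ hJ.ge, hJ, IntermediateField.finrank_bot, Nat.cast_one, div_one, sub_self, zero_add]
  rw [← (Phi_strictMono F⟮b⟯.fixingSubgroup).le_iff_le, hJ]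
  exact t4 g trivial hg

variable (N) in
theorem finrank_adjoin_isPrimitiveRoot [IsGalois K N] {p : ℕ} (hp : p.Prime)
    (hpA : Irreducible (p : A)) {ℓ : ℕ} (hℓ : 1 ≤ ℓ) {ζ : N} (hζ : IsPrimitiveRoot ζ (p ^ ℓ)) :
    (finrank K K⟮ζ⟯ : ℝ) = p ^ (ℓ - 1) * ((p : ℝ) - 1) := by
  have := isDiscreteValuationRing_integralClosure A K N
  have := isFractionRing_integralClosure A K N
  obtain ⟨π, hπ⟩ := exists_isUniformizer (A := A) (E := N)
  have he : (finrank K K : ℝ)⁻¹ = 1 := by rw [finrank_self, Nat.cast_one, inv_one]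
  have hwp : ramVal A K N (p : N) = 1 := by
    rw [← ramVal_uniformizer A K N hpA, map_natCast (algebraMap A N)]
  exact ((isTotRam_ramVal A K K N).cyclotomic_tower he
    (ramVal_eq_div_of_isUniformizer A K (F := K) hπ) hp hwp hℓ hζ).1

variable (N) in
/-- The conductor of the field generated, up to Galois closure, by a root of order `p ^ c` of a
primitive element of a cyclotomic field. -/
theorem ramConductor_kummer_cyclotomic [IsGalois K N] {p : ℕ} (hp : p.Prime)
    (hpA : Irreducible (p : A)) {ℓ : ℕ} (hℓ : 1 ≤ ℓ) {ζ : N} (hζ : IsPrimitiveRoot ζ (p ^ ℓ))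
    {a b : N} {n : ℤ} (haζ : a ∈ K⟮ζ⟯)
    (ha : IsPrim (ramVal A K N) p (finrank K K⟮ζ⟯ : ℝ)⁻¹ a n) {c : ℕ} (hc : 1 ≤ c)
    (hb : b ^ p ^ c = a)
    (hgen : ∀ Q : Subgroup (N ≃ₐ[K] N), Q.Normal → (∀ q ∈ Q, q ζ = ζ) → (∀ q ∈ Q, q b = b) →
      (∀ q ∈ Q, ∀ ξ : N, ξ ^ p ^ c = 1 → q ξ = ξ) → Q = ⊥) :
    ramConductor A N K = max ((ℓ : ℝ) - 1)
      ((c : ℝ) + ℓ - 1 - ((n : ℝ) - 1) / ((p : ℝ) ^ (ℓ - 1) * ((p : ℝ) - 1))) := by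
  have := isDiscreteValuationRing_integralClosure A K N
  have := isFractionRing_integralClosure A K N
  obtain ⟨π, hπ⟩ := exists_isUniformizer (A := A) (E := N)
  have h := isTotRam_ramVal A K K N
  have hπ' := ramVal_eq_div_of_isUniformizer A K (F := K) hπ
  have he : (finrank K K : ℝ)⁻¹ = 1 := by rw [finrank_self, Nat.cast_one, inv_one]
  have hwp : ramVal A K N (p : N) = 1 := by
    rw [← ramVal_uniformizer A K N hpA, map_natCast (algebraMap A N)]
  have hp1 : (0 : ℝ) < (p : ℝ) - 1 := by
    have : (1 : ℝ) < p := by exact_mod_cast hp.one_lt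
    linarith
  have hb0 : b ≠ 0 := ha.ne_zero_of_pow_eq hp (finrank_inv_pos K) hb
  obtain ⟨s1, s2, s3, s4⟩ := h.cyclotomic_tower he hπ' hp hwp hℓ hζ
  rw [he] at h hπ'
  obtain ⟨E, hE⟩ : ∃ E, E = K⟮ζ⟯ ⊔ K⟮b⟯ := ⟨_, rfl⟩
  obtain ⟨t1, -, t3, t4, t5⟩ := h.kummer_tower hπ' hp hwp haζ (by rwa [one_div]) c b hb E hE _ rfl
  have hH : ∀ Q : Subgroup (N ≃ₐ[K] N), Q.Normal → Q ≤ E.fixingSubgroup → Q = ⊥ := by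
    intro Q hQ hQE
    rw [hE] at hQE t1
    refine hgen Q hQ (fun q hq => ?_) (fun q hq => (mem_fixingSubgroup_sup_adjoin.1 (hQE hq)).2)
      fun q hq ξ hξ => apply_root_of_unity_eq haζ (pow_pos hp.pos c) hb0 hb t1 hQ hQE hq hξ
    exact (IntermediateField.mem_fixingSubgroup_iff _ _).1
      (mem_fixingSubgroup_sup_adjoin.1 (hQE hq)).1 ζ (IntermediateField.mem_adjoin_simple_self K ζ)
  have hε : (1 : ℝ) / finrank K K⟮ζ⟯ = 1 / ((p : ℝ) ^ (ℓ - 1) * ((p : ℝ) - 1)) := by rw [s1]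
  obtain ⟨ε, hεdef⟩ : ∃ ε : ℝ, ε = 1 / ((p : ℝ) ^ (ℓ - 1) * ((p : ℝ) - 1)) := ⟨_, rfl⟩
  have hnε : ((n : ℝ) - 1) / ((p : ℝ) ^ (ℓ - 1) * ((p : ℝ) - 1)) = (n - 1) * ε := by
    rw [hεdef, mul_one_div]
  rw [hnε]
  rw [hε, ← hεdef] at t3
  obtain ⟨J, hJdef⟩ : ∃ J : ℝ, J = 1 / ((p : ℝ) - 1) - (n - 1) * (1 / finrank K E) := ⟨_, rfl⟩
  rw [← hJdef] at t3 t4 t5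
  obtain ⟨g₁, -, hg₁, hJ₁⟩ := t5 hc
  have hne : ∀ {M : IntermediateField K N} {g : N ≃ₐ[K] N}, g ∉ M.fixingSubgroup → g ≠ 1 :=
    fun hg h1 => hg (h1 ▸ one_mem _)
  have hle : E.fixingSubgroup ≤ K⟮ζ⟯.fixingSubgroup :=
    IntermediateField.fixingSubgroup_le (hE ▸ le_sup_left)
  -- Both breaks are read off $\Phi_{K_\ell}$: the left side of the comparison is that of
  -- $K_\ell/K_0$, the right side that of the Kummer layers. The larger one decides the conductor.
  rcases le_or_gt (1 / ((p : ℝ) - 1)) (1 / ((p : ℝ) - 1) - (n - 1) * ε + c) with hβ | hβ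
  · have h1 := t3 _ hJ₁.ge
    rw [hJ₁, sub_self, zero_add] at h1
    rw [ramConductor_eq_Phi A K hπ hH (g₁ := g₁) (hne hg₁) (fun g hg => ?_),
      s2 _ (h1 ▸ hβ), h1, finrank_self, Nat.cast_one, mul_one, max_eq_right (by linarith)]
    · ring
    · by_cases hgζ : g ∈ K⟮ζ⟯.fixingSubgroup
      · rw [← (Phi_strictMono E.fixingSubgroup).le_iff_le, hJ₁]
        exact t4 g hgζ hg
      · rw [← (Phi_strictMono K⟮ζ⟯.fixingSubgroup).le_iff_le, h1]
        exact (s3 g hgζ).trans hβ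
  -- For $\ell=1$ primitivity gives $n\varepsilon\le p/(p-1)=1+\varepsilon$, so
  -- $(n-1)\varepsilon\le1\le c$ and the Kummer break cannot be the smaller one. For $\ell\ge2$ the
  -- cyclotomic break is attained.
  · have hℓ2 : 2 ≤ ℓ := by
      by_contra! hlt
      obtain rfl : ℓ = 1 := by omega
      rw [Nat.sub_self, pow_zero, one_mul] at hεdef
      have hc1 : (1 : ℝ) ≤ c := by exact_mod_cast hc
      have hn : (n : ℝ) * ε ≤ p / ((p : ℝ) - 1) := by
        rcases ha.primitive with ⟨-, -, -, -, hn⟩ | ⟨-, hn, -⟩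
        · rw [hn, Int.cast_zero, zero_mul]
          exact div_nonneg (Nat.cast_nonneg p) hp1.le
        · rw [← one_div, hε, Nat.sub_self, pow_zero, one_mul, ← hεdef] at hn
          exact hn.le
      have h2 : (p : ℝ) / ((p : ℝ) - 1) = 1 + ε := by
        rw [hεdef]
        field_simp
        ring
      linarith
    obtain ⟨g₂, hg₂, hJ₂⟩ := s4 hℓ2
    rw [ramConductor_eq_Phi A K hπ hH (g₁ := g₂) (hne hg₂) (fun g hg => ?_),
      s2 _ hJ₂.ge, hJ₂, finrank_self, Nat.cast_one, mul_one, max_eq_left (by linarith)]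
    · ring
    · rw [← (Phi_strictMono K⟮ζ⟯.fixingSubgroup).le_iff_le, hJ₂]
      by_cases hgζ : g ∈ K⟮ζ⟯.fixingSubgroup
      · have h3 : ramFun (ramVal A K N) π g ≤ ramFun (ramVal A K N) π g₁ := by
          rw [← (Phi_strictMono E.fixingSubgroup).le_iff_le, hJ₁]
          exact t4 g hgζ hg
        have h1 := t3 _ hJ₁.ge
        rw [hJ₁, sub_self, zero_add] at h1
        exact ((Phi_mono K⟮ζ⟯.fixingSubgroup h3).trans h1.le).trans hβ.le
      · exact s3 g hgζ

end Conductor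

end RamificationConductor

end

noncomputable section

namespace RamificationConductor

/-! ### The fields of the theorem inside the algebraic closure -/

section Cyclotomic

open Module
open scoped IntermediateField

variable {p : ℕ} {K₀ Ω : Type*} [Field K₀] [Field Ω] [Algebra K₀ Ω]

theorem cyc_eq_adjoin (hp : p.Prime) {n : ℕ} {ζ : Ω} (hζ : IsPrimitiveRoot ζ (p ^ n)) :
    cyc p K₀ Ω n = K₀⟮ζ⟯ := by
  refine le_antisymm (IntermediateField.adjoin_le_iff.2 fun ξ hξ => ?_)
    (IntermediateField.adjoin_simple_le_iff.2 (IntermediateField.subset_adjoin _ _ hζ))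
  have : NeZero (p ^ n) := ⟨(pow_pos hp.pos n).ne'⟩
  obtain ⟨i, -, rfl⟩ := hζ.eq_pow_of_pow_eq_one (IsPrimitiveRoot.pow_eq_one hξ)
  exact pow_mem (IntermediateField.mem_adjoin_simple_self K₀ ζ) i

theorem cyc_eq_lift (hp : p.Prime) {N : IntermediateField K₀ Ω} {n : ℕ} {ζ : N}
    (hζ : IsPrimitiveRoot ζ (p ^ n)) : cyc p K₀ Ω n = IntermediateField.lift K₀⟮ζ⟯ := by
  have hinj : Function.Injective N.val := Subtype.val_injective
  rw [cyc_eq_adjoin hp (hζ.map_of_injective hinj), IntermediateField.lift_adjoin_simple]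
  rfl

theorem finrank_adjoin_eq_finrank_cyc (hp : p.Prime) {N : IntermediateField K₀ Ω} {n : ℕ} {ζ : N}
    (hζ : IsPrimitiveRoot ζ (p ^ n)) : finrank K₀ K₀⟮ζ⟯ = finrank K₀ (cyc p K₀ Ω n) := by
  rw [cyc_eq_lift hp hζ]
  exact (IntermediateField.liftAlgEquiv K₀⟮ζ⟯).toLinearEquiv.finrank_eq

/-- Every root of unity of the relevant order is a power of $\zeta$, so containment reduces to two
generators. -/
theorem kummerExt_le_iff (hp : p.Prime) {ℓ c : ℕ} {b ζ : Ω}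
    (hζ : IsPrimitiveRoot ζ (p ^ max ℓ c)) {X : IntermediateField (cyc p K₀ Ω ℓ) Ω} :
    kummerExt p K₀ Ω ℓ c b ≤ X ↔ ζ ∈ X ∧ b ∈ X := by
  have hζmem : ζ ∈ cyc p K₀ Ω (max ℓ c) := IntermediateField.subset_adjoin _ _ hζ
  have h1 : ζ ∈ X → cyc p K₀ Ω (max ℓ c) ≤ X.restrictScalars K₀ := by
    intro h
    rw [cyc_eq_adjoin hp hζ, IntermediateField.adjoin_simple_le_iff]
    exact h
  rw [kummerExt, IntermediateField.adjoin_le_iff, Set.union_subset_iff, Set.singleton_subset_iff]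
  exact and_congr ⟨fun h => h hζmem, fun h x hx => h1 h hx⟩ Iff.rfl

theorem kummerExt_eq_adjoin (hp : p.Prime) {ℓ c : ℕ} {b ζ : Ω}
    (hζ : IsPrimitiveRoot ζ (p ^ max ℓ c)) :
    kummerExt p K₀ Ω ℓ c b = IntermediateField.adjoin (cyc p K₀ Ω ℓ) {ζ, b} :=
  eq_of_forall_ge_iff fun X => by
    rw [kummerExt_le_iff hp hζ, IntermediateField.adjoin_le_iff, Set.insert_subset_iff,
      Set.singleton_subset_iff]
    rfl

theorem mem_kummerExt (hp : p.Prime) {ℓ c : ℕ} {b ζ : Ω} (hζ : IsPrimitiveRoot ζ (p ^ max ℓ c)) :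
    ζ ∈ kummerExt p K₀ Ω ℓ c b ∧ b ∈ kummerExt p K₀ Ω ℓ c b :=
  (kummerExt_le_iff hp hζ).1 le_rfl

theorem algEquiv_kummerExt_eq_one (hp : p.Prime) {ℓ c : ℕ} {b : Ω}
    {g : kummerExt p K₀ Ω ℓ c b ≃ₐ[cyc p K₀ Ω ℓ] kummerExt p K₀ Ω ℓ c b}
    {ζ β : kummerExt p K₀ Ω ℓ c b} (hζ : IsPrimitiveRoot ζ (p ^ max ℓ c)) (hβ : (β : Ω) = b)
    (hgζ : g ζ = ζ) (hgβ : g β = β) : g = 1 := by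
  obtain ⟨X, hX⟩ : ∃ X, X = IntermediateField.lift
    (IntermediateField.fixedField (Subgroup.zpowers g)) := ⟨_, rfl⟩
  have hmem : ∀ x : kummerExt p K₀ Ω ℓ c b, (x : Ω) ∈ X ↔ g x = x := by
    intro x
    rw [hX, IntermediateField.mem_lift, IntermediateField.mem_fixedField_iff]
    refine ⟨fun h => h g (Subgroup.mem_zpowers g), fun h f hf => ?_⟩
    have h1 : Subgroup.zpowers g ≤ MulAction.stabilizer
        (kummerExt p K₀ Ω ℓ c b ≃ₐ[cyc p K₀ Ω ℓ] kummerExt p K₀ Ω ℓ c b) x := by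
      rw [Subgroup.zpowers_le]
      exact h
    exact h1 hf
  have hinj : Function.Injective (kummerExt p K₀ Ω ℓ c b).val := Subtype.val_injective
  have hβX : b ∈ X := by
    have h2 := (hmem β).2 hgβ
    rwa [hβ] at h2
  have hle := (kummerExt_le_iff hp (hζ.map_of_injective hinj)).2 ⟨(hmem ζ).2 hgζ, hβX⟩
  ext x
  rw [(hmem x).1 (hle x.2)]
  rfl

variable [IsAlgClosure K₀ Ω]

theorem kummerExt_le_kummerClosure {ℓ c : ℕ} {b x : Ω} (hx : x ∈ kummerExt p K₀ Ω ℓ c b) :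
    x ∈ kummerClosure p K₀ Ω ℓ c b := by
  have := IsAlgClosure.normal K₀ Ω
  exact IntermediateField.le_normalClosure ((kummerExt p K₀ Ω ℓ c b).restrictScalars K₀) hx

theorem kummerClosure_le {ℓ c : ℕ} {b : Ω} {X : IntermediateField K₀ Ω} [Normal K₀ X]
    (h : (kummerExt p K₀ Ω ℓ c b).restrictScalars K₀ ≤ X) : kummerClosure p K₀ Ω ℓ c b ≤ X := by
  have := IsAlgClosure.normal K₀ Ω
  exact IntermediateField.normalClosure_le_iff_of_normal.2 h

variable [CharZero K₀]

theorem exists_isPrimitiveRoot (K₀ : Type*) {Ω : Type*} [Field K₀] [Field Ω] [Algebra K₀ Ω]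
    [CharZero K₀] [IsAlgClosure K₀ Ω] {m : ℕ} (hm : m ≠ 0) : ∃ ζ : Ω, IsPrimitiveRoot ζ m := by
  have := IsAlgClosure.isAlgClosed K₀ (K := Ω)
  have : CharZero Ω := charZero_of_injective_algebraMap (algebraMap K₀ Ω).injective
  have : NeZero m := ⟨hm⟩
  have : NeZero (m : Ω) := ⟨Nat.cast_ne_zero.2 hm⟩
  exact HasEnoughRootsOfUnity.exists_primitiveRoot Ω m

theorem finiteDimensional_cyc (hp : p.Prime) (n : ℕ) : FiniteDimensional K₀ (cyc p K₀ Ω n) := by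
  obtain ⟨ζ, hζ⟩ := exists_isPrimitiveRoot K₀ (Ω := Ω) (pow_pos hp.pos n).ne'
  rw [cyc_eq_adjoin hp hζ]
  exact IntermediateField.adjoin.finiteDimensional
    (IsAlgClosure.isAlgebraic.isIntegral.isIntegral ζ)

theorem finiteDimensional_kummerExt (hp : p.Prime) (ℓ c : ℕ) (b : Ω) :
    FiniteDimensional (cyc p K₀ Ω ℓ) (kummerExt p K₀ Ω ℓ c b) := by
  obtain ⟨ζ, hζ⟩ := exists_isPrimitiveRoot K₀ (Ω := Ω) (pow_pos hp.pos (max ℓ c)).ne'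
  rw [kummerExt_eq_adjoin hp hζ]
  refine IntermediateField.finiteDimensional_adjoin fun x _ => ?_
  exact ((IsAlgClosure.isAlgebraic (R := K₀) (K := Ω)).isIntegral.isIntegral x).tower_top

/-- A conjugate of $b$ over $K_\ell$ is $b$ times a $p^c$-th root of unity, which already lies in
$K_{\max(\ell,c)}$. -/
theorem isGalois_kummerExt (hp : p.Prime) {ℓ c : ℕ} {b : Ω} (hb0 : b ≠ 0)
    (a : cyc p K₀ Ω ℓ) (hb : b ^ p ^ c = (a : Ω)) :
    IsGalois (cyc p K₀ Ω ℓ) (kummerExt p K₀ Ω ℓ c b) := by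
  have := IsAlgClosure.normal K₀ Ω
  have : Normal (cyc p K₀ Ω ℓ) Ω := Normal.tower_top_of_normal K₀ _ Ω
  obtain ⟨ζ, hζ⟩ := exists_isPrimitiveRoot K₀ (Ω := Ω) (pow_pos hp.pos (max ℓ c)).ne'
  have : NeZero (p ^ max ℓ c) := ⟨(pow_pos hp.pos _).ne'⟩
  obtain ⟨hζE, hbE⟩ := mem_kummerExt (K₀ := K₀) (b := b) hp hζ
  have hroot : ∀ ξ : Ω, ξ ^ p ^ max ℓ c = 1 → ξ ∈ kummerExt p K₀ Ω ℓ c b := by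
    intro ξ hξ
    obtain ⟨i, -, rfl⟩ := hζ.eq_pow_of_pow_eq_one hξ
    exact pow_mem hζE i
  have : Normal (cyc p K₀ Ω ℓ) (kummerExt p K₀ Ω ℓ c b) := by
    refine IntermediateField.normal_iff_forall_map_le.2 fun σ => ?_
    rw [IntermediateField.map_le_iff_le_comap, kummerExt_le_iff hp hζ]
    refine ⟨hroot _ ?_, ?_⟩
    · change σ ζ ^ _ = 1
      rw [← map_pow, hζ.pow_eq_one, map_one]
    · have h1 : σ b / b ∈ kummerExt p K₀ Ω ℓ c b := by
        refine hroot _ ?_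
        have h2 : (σ b / b) ^ p ^ c = 1 := by
          have h3 : σ (a : Ω) = a := σ.commutes a
          rw [div_pow, ← map_pow, hb, h3, ← hb, div_self (pow_ne_zero _ hb0)]
        obtain ⟨d, hd⟩ := pow_dvd_pow p (le_max_right ℓ c)
        rw [hd, pow_mul, h2, one_pow]
      have h4 := mul_mem h1 hbE
      rwa [div_mul_cancel₀ _ hb0] at h4
  exact IsGalois.mk

variable (p K₀ Ω) in
theorem finiteDimensional_kummerClosure (hp : p.Prime) (ℓ c : ℕ) (b : Ω) :
    FiniteDimensional K₀ (kummerClosure p K₀ Ω ℓ c b) := by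
  have := finiteDimensional_cyc (K₀ := K₀) (Ω := Ω) hp ℓ
  have := finiteDimensional_kummerExt (K₀ := K₀) hp ℓ c b
  have : FiniteDimensional K₀ ((kummerExt p K₀ Ω ℓ c b).restrictScalars K₀) :=
    FiniteDimensional.trans K₀ (cyc p K₀ Ω ℓ) (kummerExt p K₀ Ω ℓ c b)
  exact normalClosure.is_finiteDimensional K₀ _ Ω

variable (p K₀ Ω) in
theorem isGalois_kummerClosure (ℓ c : ℕ) (b : Ω) :
    IsGalois K₀ (kummerClosure p K₀ Ω ℓ c b) := by
  have := IsAlgClosure.normal K₀ Ω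
  have : Normal K₀ (kummerClosure p K₀ Ω ℓ c b) := normalClosure.normal K₀ _ Ω
  exact IsGalois.mk

/-- A normal subgroup of the Galois group of the closure is trivial if it fixes generators of the
field. -/
theorem eq_bot_of_forall_apply_eq (hp : p.Prime) {ℓ c : ℕ} {b : Ω}
    {Q : Subgroup (kummerClosure p K₀ Ω ℓ c b ≃ₐ[K₀] kummerClosure p K₀ Ω ℓ c b)} (hQ : Q.Normal)
    {ζ ξ β : kummerClosure p K₀ Ω ℓ c b} (hζ : IsPrimitiveRoot ζ (p ^ ℓ))
    (hξ : IsPrimitiveRoot ξ (p ^ max ℓ c)) (hβ : (β : Ω) = b) (hQζ : ∀ q ∈ Q, q ζ = ζ)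
    (hQξ : ∀ q ∈ Q, q ξ = ξ) (hQβ : ∀ q ∈ Q, q β = β) : Q = ⊥ := by
  have := finiteDimensional_kummerClosure p K₀ Ω hp ℓ c b
  have := isGalois_kummerClosure p K₀ Ω ℓ c b
  obtain ⟨X, hX⟩ : ∃ X, X = IntermediateField.lift (IntermediateField.fixedField Q) := ⟨_, rfl⟩
  -- Normality of $Q$ makes its fixed field normal over $K_0$; once it contains the generators of
  -- $K$ it contains the whole closure.
  have : IsGalois K₀ (IntermediateField.fixedField Q) := IsGalois.of_fixedField_normal_subgroup Q
  have : Normal K₀ X := by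
    rw [hX]
    exact Normal.of_algEquiv (IntermediateField.liftAlgEquiv (IntermediateField.fixedField Q))
  have hmem : ∀ x : kummerClosure p K₀ Ω ℓ c b, (x : Ω) ∈ X ↔ ∀ q ∈ Q, q x = x := by
    intro x
    rw [hX, IntermediateField.mem_lift, IntermediateField.mem_fixedField_iff]
  have hinj : Function.Injective (kummerClosure p K₀ Ω ℓ c b).val := Subtype.val_injective
  have hcyc : cyc p K₀ Ω ℓ ≤ X := by
    rw [cyc_eq_adjoin hp (hζ.map_of_injective hinj), IntermediateField.adjoin_simple_le_iff]
    exact (hmem ζ).2 hQζ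
  have hle : kummerClosure p K₀ Ω ℓ c b ≤ X := by
    refine kummerClosure_le ?_
    have h1 : kummerExt p K₀ Ω ℓ c b ≤ IntermediateField.extendScalars hcyc := by
      rw [kummerExt_le_iff hp (hξ.map_of_injective hinj)]
      have hβX : b ∈ X := by
        have h2 := (hmem β).2 hQβ
        rwa [hβ] at h2
      exact ⟨(hmem ξ).2 hQξ, hβX⟩
    exact h1
  rw [Subgroup.eq_bot_iff_forall]
  intro q hq
  ext x
  rw [(hmem x).1 (hle x.2) q hq]
  rfl

end Cyclotomic

end RamificationConductor

end

/-! ### The theorem -/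

open RamificationConductor in
theorem proposition4p2 (p : ℕ) [Fact p.Prime] (k : Type*) [Field k] [CharP k p] [IsAlgClosed k]
    (K₀ : Type*) [Field K₀] [Algebra (WittVector p k) K₀] [IsFractionRing (WittVector p k) K₀]
    (Ω : Type*) [Field Ω] [Algebra K₀ Ω] [IsAlgClosure K₀ Ω]
    [Algebra (WittVector p k) Ω] [IsScalarTower (WittVector p k) K₀ Ω]
    (ℓ c : ℕ) (hℓ : 1 ≤ ℓ) (hc : 1 ≤ c)
    (a t : cyc p K₀ Ω ℓ) (hat : a = 1 + t)
    (ha : IsPPrimitive (WittVector p k) (cyc p K₀ Ω ℓ) p a)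
    (ha₀ : 0 ≤ ord (WittVector p k) (cyc p K₀ Ω ℓ) a)
    (b : Ω) (hb : b ^ p ^ c = (a : Ω)) :
    ∃ n : ℤ, ord (WittVector p k) (cyc p K₀ Ω ℓ) t = n ∧
      IsGalois (cyc p K₀ Ω ℓ) (kummerExt p K₀ Ω ℓ c b) ∧
      ramConductor (WittVector p k) (kummerExt p K₀ Ω ℓ c b) (cyc p K₀ Ω ℓ) =
        ((c : ℝ) * ((p : ℝ) - 1) + 1) * (p : ℝ) ^ (ℓ - 1) - (n : ℝ) ∧
      ramConductor (WittVector p k) (kummerClosure p K₀ Ω ℓ c b) K₀ =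
        max ((ℓ : ℝ) - 1)
          ((c : ℝ) + (ℓ : ℝ) - 1 - ((n : ℝ) - 1) / ((p : ℝ) ^ (ℓ - 1) * ((p : ℝ) - 1))) := by
  have hp : p.Prime := Fact.out
  have := charZero_wittVector p k
  have := isAdicComplete_wittVector p k
  have := isAlgClosed_residueField_wittVector p k
  have : CharZero K₀ :=
    charZero_of_injective_algebraMap (IsFractionRing.injective (WittVector p k) K₀)
  have hpA : Irreducible (p : WittVector p k) := WittVector.irreducible p
  have := finiteDimensional_cyc (K₀ := K₀) (Ω := Ω) hp ℓ
  have := finiteDimensional_kummerExt (K₀ := K₀) hp ℓ c b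
  have := finiteDimensional_kummerClosure p K₀ Ω hp ℓ c b
  have := isGalois_kummerClosure p K₀ Ω ℓ c b
  have hta : t = a - 1 := by rw [hat, add_sub_cancel_left]
  obtain ⟨n, hn, hprim⟩ := ha.exists_isPrim (WittVector p k) K₀ hpA ha₀
  have ha0 : a ≠ 0 := hprim.ne_zero_of_pow_eq hp (finrank_inv_pos K₀) (c := 0) (by simp)
  have hb0 : b ≠ 0 := by
    rintro rfl
    rw [zero_pow (pow_pos hp.pos c).ne'] at hb
    exact ha0 (Subtype.val_injective hb.symm)
  have hgal := isGalois_kummerExt hp hb0 a hb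
  have : FiniteDimensional K₀ (kummerExt p K₀ Ω ℓ c b) :=
    FiniteDimensional.trans K₀ (cyc p K₀ Ω ℓ) (kummerExt p K₀ Ω ℓ c b)
  have : IsScalarTower (WittVector p k) K₀ (kummerExt p K₀ Ω ℓ c b) :=
    IsScalarTower.of_algebraMap_eq fun x =>
      Subtype.ext (IsScalarTower.algebraMap_apply (WittVector p k) K₀ Ω x)
  obtain ⟨ξ, hξ⟩ := exists_isPrimitiveRoot K₀ (Ω := Ω) (pow_pos hp.pos (max ℓ c)).ne'
  obtain ⟨ζ, hζ⟩ := exists_isPrimitiveRoot K₀ (Ω := Ω) (pow_pos hp.pos ℓ).ne'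
  have hζcyc : ζ ∈ cyc p K₀ Ω ℓ := IntermediateField.subset_adjoin _ _ hζ
  obtain ⟨hξE, hbE⟩ := mem_kummerExt (K₀ := K₀) (b := b) hp hξ
  have hcycL : cyc p K₀ Ω ℓ ≤ kummerClosure p K₀ Ω ℓ c b := fun x hx =>
    kummerExt_le_kummerClosure ((kummerExt p K₀ Ω ℓ c b).algebraMap_mem ⟨x, hx⟩)
  obtain ⟨ζ', hζ'⟩ : ∃ ζ' : kummerClosure p K₀ Ω ℓ c b, (ζ' : Ω) = ζ := ⟨⟨ζ, hcycL hζcyc⟩, rfl⟩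
  have hζ'prim : IsPrimitiveRoot ζ' (p ^ ℓ) :=
    IsPrimitiveRoot.of_map_of_injective (f := (kummerClosure p K₀ Ω ℓ c b).val)
      (by rw [IntermediateField.coe_val, hζ']; exact hζ) Subtype.val_injective
  -- The degree of $K_\ell$ comes from the cyclotomic tower, which is set up inside a finite Galois
  -- extension of $K_0$; the Galois closure serves.
  have hdeg := finrank_adjoin_isPrimitiveRoot (WittVector p k) K₀ (kummerClosure p K₀ Ω ℓ c b)
    hp hpA hℓ hζ'prim
  rw [finrank_adjoin_eq_finrank_cyc hp hζ'prim] at hdeg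
  have hp1 : (0 : ℝ) < (p : ℝ) - 1 := by
    have : (1 : ℝ) < p := by exact_mod_cast hp.one_lt
    linarith
  have hp0 : (0 : ℝ) < p := by linarith
  refine ⟨n, hta ▸ hn, hgal, ?_, ?_⟩
  · have hξ' : IsPrimitiveRoot (⟨ξ, hξE⟩ : kummerExt p K₀ Ω ℓ c b) (p ^ max ℓ c) :=
      IsPrimitiveRoot.of_map_of_injective (f := (kummerExt p K₀ Ω ℓ c b).val) hξ
        Subtype.val_injective
    rw [ramConductor_kummer (WittVector p k) K₀ (cyc p K₀ Ω ℓ) (kummerExt p K₀ Ω ℓ c b) hp hpA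
      (a := algebraMap _ _ a) (b := ⟨b, hbE⟩) (n := n) (IntermediateField.algebraMap_mem _ a)
      (hprim.map (algebraMap _ _) fun x => ramVal_map (WittVector p k) K₀
        (IsScalarTower.toAlgHom (WittVector p k) (cyc p K₀ Ω ℓ) (kummerExt p K₀ Ω ℓ c b)) x) hc
      (Subtype.ext hb) (fun g hgb hgroot => algEquiv_kummerExt_eq_one hp hξ' rfl ?_ hgb), hdeg]
    · field_simp
      ring
    -- The generating root of unity has order $p^{\max(\ell,c)}$: it is a $p^c$-th root of unity if
    -- $\ell\le c$, and lies in the base $K_\ell$ otherwise.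
    · rcases le_total ℓ c with hle | hle
      · refine hgroot _ ?_
        have h1 := hξ'.pow_eq_one
        rwa [max_eq_right hle] at h1
      · rw [max_eq_left hle] at hξ
        exact g.commutes ⟨ξ, IntermediateField.subset_adjoin _ _ hξ⟩
  · obtain ⟨ξ', hξ''⟩ : ∃ ξ' : kummerClosure p K₀ Ω ℓ c b, (ξ' : Ω) = ξ :=
      ⟨⟨ξ, kummerExt_le_kummerClosure hξE⟩, rfl⟩
    have hξ'prim : IsPrimitiveRoot ξ' (p ^ max ℓ c) :=
      IsPrimitiveRoot.of_map_of_injective (f := (kummerClosure p K₀ Ω ℓ c b).val)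
        (by rw [IntermediateField.coe_val, hξ'']; exact hξ) Subtype.val_injective
    obtain ⟨f, hf⟩ : ∃ f : cyc p K₀ Ω ℓ →ₐ[WittVector p k] kummerClosure p K₀ Ω ℓ c b,
        ∀ x, (f x : Ω) = x :=
      ⟨(IntermediateField.inclusion hcycL).restrictScalars (WittVector p k), fun x => rfl⟩
    refine ramConductor_kummer_cyclotomic (WittVector p k) K₀ (kummerClosure p K₀ Ω ℓ c b) hp hpA
      hℓ hζ'prim (a := f a) (b := ⟨b, kummerExt_le_kummerClosure hbE⟩) ?_ ?_ hc
      (Subtype.ext (by rw [hf]; exact hb)) (fun Q hQ hQζ hQb hQroot => ?_)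
    · rw [← IntermediateField.mem_lift, ← cyc_eq_lift hp hζ'prim, hf]
      exact a.2
    · rw [finrank_adjoin_eq_finrank_cyc hp hζ'prim]
      exact hprim.map f.toRingHom fun x => ramVal_map (WittVector p k) K₀ f x
    · refine eq_bot_of_forall_apply_eq hp hQ hζ'prim hξ'prim rfl hQζ (fun q hq => ?_) hQb
      rcases le_total ℓ c with hle | hle
      · refine hQroot q hq _ ?_
        have h1 := hξ'prim.pow_eq_one
        rwa [max_eq_right hle] at h1
      · rw [max_eq_left hle] at hξ'prim
        have : NeZero (p ^ ℓ) := ⟨(pow_pos hp.pos ℓ).ne'⟩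
        obtain ⟨i, -, hi⟩ := hζ'prim.eq_pow_of_pow_eq_one hξ'prim.pow_eq_one
        rw [← hi, map_pow, hQζ q hq]
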